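/- **Setting.** Let $N\ge 1$ agents choose $x_i\in\Omega_i\subseteq\mathbb R^{n_i}$, where $\Omega_i$ is nonempty, closed and convex. Put $\boldsymbol\Omega=\prod_i\Omega_i$, $\boldsymbol x=\operatorname{col}(x_1,\dots,x_N)$, and $$\boldsymbol{\mathcal X}=\{\boldsymbol x\in\boldsymbol\Omega:\ g(\boldsymbol x)\le 0\},\qquad g(\boldsymbol x)=\sum_{i=1}^N g_i(x_i),$$ with $g_i:\mathbb R^{n_i}\to\mathbb R^m$ componentwise convex and differentiable, $g$ Lipschitz on $\boldsymbol\Omega$, $\nabla g$ bounded on $\boldsymbol{\mathcal X}$, and some $\boldsymbol x\in\boldsymbol\Omega$ with $g(\boldsymbol x)<0$ componentwise (Slater). Agent $i$ has the cost $$\mathbb J_i(\boldsymbol x)=\mathbb E[J_i(\boldsymbol x,\xi)]+f_i(x_i),$$ where $\xi$ is a random vector in $\mathbb R^d$; $f_i:\mathbb R^{n_i}\to\mathbb R\cup\{+\infty\}$ is convex and lower semicontinuous with domain $\Omega_i$; $J_i$ is measurable and $\mathbb E[J_i(\boldsymbol x,\xi)]$ is well defined (i.e. $J_i(\boldsymbol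 x,\xi)$ is integrable) for $\boldsymbol x\in\boldsymbol{\mathcal X}$; and, for every $\boldsymbol x_{-i}\in\prod_{j\ne i}\Omega_j$ and every value of $\xi$, $J_i(\cdot,\boldsymbol x_{-i},\xi)$ is convex on $\Omega_i$, continuously differentiable around each point of $\Omega_i$, and Lipschitz on $\Omega_i$ with a constant that is integrable in $\xi$. A *stochastic generalized Nash equilibrium* (SGNE) is an $\boldsymbol x^*\in\boldsymbol{\mathcal X}$ such that, for all $i$, $\mathbb J_i(\boldsymbol x^*)\le\mathbb J_i(y,\boldsymbol x^*_{-i})$ for all $y$ with $(y,\boldsymbol x^*_{-i})\in\boldsymbol{\mathcal X}$. It is a *variational* SGNE (v-SGNE) if it also solves the stochastic variational inequality (SVI) $$\langle\mathbb F(\boldsymbol x^*),\boldsymbol x-\boldsymbol x^*\rangle+\sum_i\big(f_i(x_i)-f_i(x_i^*)\big)\ge 0\quad\text{for all }\boldsymbol x\in\boldsymbol{\mathcal X},\qquad \mathbb F(\boldsymbol x)=\operatorname{col}\big(\mathbb E[\nabla_{x_i}J_i(\boldsymbol x,\xi)]\big)_{i=1}^N.$$ Assume that the SVI has a solution, that $\mathbb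 F$ is monotone and Lipschitz on $\boldsymbol\Omega$, and that there are $p\ge2$, $\sigma_0\ge0$ and a real function $\sigma$ with $$\mathbb E\big[\|\operatorname{col}(\nabla_{x_i}J_i(\boldsymbol x,\xi))-\mathbb F(\boldsymbol x)\|^p\big]^{1/p}\le\sigma(\boldsymbol x^*)+\sigma_0\|\boldsymbol x-\boldsymbol x^*\|$$ for all $\boldsymbol x\in\boldsymbol\Omega$ and all solutions $\boldsymbol x^*$ of the SVI. **Graph.** Let $W=(w_{i,j})$ be a symmetric weighted adjacency matrix of a connected undirected graph on the agents ($w_{i,j}>0$ on edges, $w_{i,j}=0$ otherwise), and let $\mathbf L=L\otimes\mathrm{Id}_m$ with $L$ its Laplacian. **Algorithm.** Let $\alpha_i,\nu_i,\tau_i>0$ and $\delta\in\mathbb R$. Start from $x_i^0\in\Omega_i$, $\lambda_i^0\in\mathbb R^m_{\ge0}$, $z_i^0\in\mathbb R^m$ and arbitrary $\bar x_i^{-1},\bar z_i^{-1},\bar\lambda_i^{-1}$ (possibly random). For $k\ge0$ set $\bar x_i^k=(1-\delta)x_i^k+\delta\bar x_i^{k-1}$, likewise $\bar z_i^k$ and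 $\bar\lambda_i^k$, and $$\begin{aligned} x_i^{k+1}&=\operatorname{prox}_{\alpha_if_i}\big[\bar x_i^k-\alpha_i\big(\hat F_i^k+\nabla g_i(x_i^k)^\top\lambda_i^k\big)\big],\qquad \hat F_i^k=\tfrac1{S_k}\sum_{t=1}^{S_k}\nabla_{x_i}J_i(\boldsymbol x^k,\xi_i^{k,t}),\\ z_i^{k+1}&=\bar z_i^k-\nu_i\sum_jw_{i,j}(\lambda_i^k-\lambda_j^k),\\ \lambda_i^{k+1}&=\operatorname{proj}_{\mathbb R^m_{\ge0}}\Big\{\bar\lambda_i^k+\tau_ig_i(x_i^k)+\tau_i\sum_jw_{i,j}\big[(z_i^k-z_j^k)-(\lambda_i^k-\lambda_j^k)\big]\Big\}, \end{aligned}$$ where the samples $\xi_i^{k,t}$ are i.i.d. copies of $\xi$, independent of the initial data, and $S_k\ge c(k+k_0)^{a+1}$ for all $k\ge 0$ and some $c,k_0,a>0$. **Parameters.** Let $\Phi^{-1}=\operatorname{diag}(\alpha,\nu,\tau)$ be the block-diagonal step-size operator acting on $\boldsymbol\omega=\operatorname{col}(\boldsymbol x,\boldsymbol z,\boldsymbol\lambda)$,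 let $\varphi=\frac{1+\sqrt5}2$, and let $\ell_{\bar{\mathcal A}}\in[0,\infty]$ be the Lipschitz constant on $\boldsymbol\Omega\times\mathbb R^{Nm}\times\mathbb R^{Nm}_{\ge0}$ of $$\bar{\mathcal A}(\boldsymbol x,\boldsymbol z,\boldsymbol\lambda)=\operatorname{col}\big(\mathbb F(\boldsymbol x)+\operatorname{col}(\nabla g_i(x_i)^\top\lambda_i),\ \mathbf L\boldsymbol\lambda,\ \mathbf L\boldsymbol\lambda-\operatorname{col}(g_i(x_i))-\mathbf L\boldsymbol z\big).$$ Assume $\frac1\varphi\le\delta<1$ and $\|\Phi^{-1}\|\le\dfrac1{2\delta(2\ell_{\bar{\mathcal A}}+1)}$ (so, in particular, $\ell_{\bar{\mathcal A}}<\infty$). **Theorem.** Almost surely, the sequence $(\boldsymbol x^k)_{k\in\mathbb N}$ generated by the algorithm converges to a (possibly random) v-SGNE of the game. -/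

import Mathlib

open MeasureTheory ProbabilityTheory Filter Topology
open scoped NNReal ENNReal

noncomputable section

namespace SGNE

/-! ### Spaces -/

/-- Decision profiles `x = col(x_1, …, x_N)` with `x_i ∈ ℝ^{n_i}`, with the Euclidean norm. -/
abbrev Profile {N : ℕ} (n : Fin N → ℕ) : Type :=
  PiLp 2 (fun i : Fin N => EuclideanSpace ℝ (Fin (n i)))

/-- Stacked dual (or auxiliary) variables `col(v_1, …, v_N)` with `v_i ∈ ℝ^m`. -/
abbrev Dual (N m : ℕ) : Type :=
  PiLp 2 (fun _ : Fin N => EuclideanSpace ℝ (Fin m))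

/-- The state `ω = col(x, z, lam)`, with the Euclidean norm. -/
abbrev State {N : ℕ} (n : Fin N → ℕ) (m : ℕ) : Type :=
  WithLp 2 (Profile n × WithLp 2 (Dual N m × Dual N m))

namespace State

variable {N m : ℕ} {n : Fin N → ℕ}

/-- The state with blocks `x`, `z`, `lam`. -/
def mk (x : Profile n) (z lam : Dual N m) : State n m :=
  WithLp.toLp 2 (x, WithLp.toLp 2 (z, lam))

/-- Primal block. -/
def x (ω : State n m) : Profile n := ω.fst

/-- Auxiliary block. -/
def z (ω : State n m) : Dual N m := ω.snd.fst

/-- Dual block. -/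
def lam (ω : State n m) : Dual N m := ω.snd.snd

end State

/-- The profile `(y, x_{-i})`. -/
def replace {N : ℕ} {n : Fin N → ℕ} (x : Profile n) (i : Fin N)
    (y : EuclideanSpace ℝ (Fin (n i))) : Profile n :=
  WithLp.toLp 2 (Function.update x.ofLp i y)

/-- `u = prox_h(v)`, that is, `u` minimizes `y ↦ h y + ‖y - v‖² / 2`. -/
def IsProx {E : Type*} [NormedAddCommGroup E] (h : E → EReal) (v u : E) : Prop :=
  IsMinOn (fun y => h y + ((‖y - v‖ ^ 2 / 2 : ℝ) : EReal)) Set.univ u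

/-- `u = proj_C(v)`. -/
def IsProj {E : Type*} [NormedAddCommGroup E] (C : Set E) (v u : E) : Prop :=
  u ∈ C ∧ IsMinOn (fun y => ‖y - v‖) C u

/-- The nonnegative orthant of `ℝ^m`. -/
def orthant (m : ℕ) : Set (EuclideanSpace ℝ (Fin m)) := {v | ∀ j, 0 ≤ v j}

/-- The smallest Lipschitz constant of `F` on `s`, which is `⊤` if `F` is not Lipschitz on `s`
(recall `0 / 0 = 0` in `ℝ≥0∞`). -/
def lipschitzConst {X Y : Type*} [PseudoEMetricSpace X] [PseudoEMetricSpace Y]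
    (F : X → Y) (s : Set X) : ℝ≥0∞ :=
  ⨆ (a ∈ s) (b ∈ s), edist (F a) (F b) / edist a b

/-! ### The game -/

/-- The data of a stochastic generalized Nash game: local sets `Ω_i`, nonsmooth local costs `f_i`,
sample costs `J_i(x, ξ)`, separable coupling constraints `∑ i, g_i(x_i) ≤ 0`, and the
distribution of the random vector `ξ`. -/
structure Game (N m d : ℕ) (n : Fin N → ℕ) where
  /-- local decision sets -/
  Ω : ∀ i, Set (EuclideanSpace ℝ (Fin (n i)))
  /-- nonsmooth local costs -/
  f : ∀ i, EuclideanSpace ℝ (Fin (n i)) → EReal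
  /-- sample costs -/
  J : Fin N → Profile n → EuclideanSpace ℝ (Fin d) → ℝ
  /-- local parts of the coupling constraint -/
  g : ∀ i, EuclideanSpace ℝ (Fin (n i)) → EuclideanSpace ℝ (Fin m)
  /-- distribution of the uncertainty -/
  law : Measure (EuclideanSpace ℝ (Fin d))

namespace Game

variable {N m d : ℕ} {n : Fin N → ℕ} (G : Game N m d n)

/-- `𝛀 = ∏ Ω_i`. -/
def localSet : Set (Profile n) := {x | ∀ i, x i ∈ G.Ω i}

/-- `g(x) = ∑ g_i(x_i)`. -/
def coupling (x : Profile n) : EuclideanSpace ℝ (Fin m) := ∑ i, G.g i (x i)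

/-- The collective feasible set `𝓧`. -/
def feasible : Set (Profile n) := {x | x ∈ G.localSet ∧ ∀ j, G.coupling x j ≤ 0}

/-- The cost `𝕁_i(x) = 𝔼[J_i(x, ξ)] + f_i(x_i)`. -/
def cost (i : Fin N) (x : Profile n) : EReal :=
  ((∫ ξ, G.J i x ξ ∂G.law : ℝ) : EReal) + G.f i (x i)

/-- The partial gradient `∇_{x_i} J_i(x, ξ)`. -/
def partialGrad (i : Fin N) (x : Profile n) (ξ : EuclideanSpace ℝ (Fin d)) :
    EuclideanSpace ℝ (Fin (n i)) :=
  gradient (fun y => G.J i (replace x i y) ξ) (x i)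

/-- The one-sample pseudogradient. -/
def sampleGrad (x : Profile n) (ξ : EuclideanSpace ℝ (Fin d)) : Profile n :=
  WithLp.toLp 2 (fun i => G.partialGrad i x ξ)

/-- The pseudogradient `𝔽(x) = col(𝔼[∇_{x_i} J_i(x, ξ)])`. -/
def pseudograd (x : Profile n) : Profile n :=
  WithLp.toLp 2 (fun i => ∫ ξ, G.partialGrad i x ξ ∂G.law)

/-- The mini-batch estimate of the `i`-th block of the pseudogradient at `x`, from the first `S`
of the samples `ξ 0, ξ 1, …` of agent `i`. -/
def batchGrad (S : ℕ) (i : Fin N) (x : Profile n) (ξ : ℕ → EuclideanSpace ℝ (Fin d)) :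
    EuclideanSpace ℝ (Fin (n i)) :=
  (S : ℝ)⁻¹ • ∑ t ∈ Finset.range S, G.partialGrad i x (ξ t)

/-- `∇g_i(x_i)^⊤ v`. -/
def jacT (i : Fin N) (y : EuclideanSpace ℝ (Fin (n i))) (v : EuclideanSpace ℝ (Fin m)) :
    EuclideanSpace ℝ (Fin (n i)) :=
  ContinuousLinearMap.adjoint (fderiv ℝ (G.g i) y) v

/-- Stochastic generalized Nash equilibrium. -/
def IsSGNE (x : Profile n) : Prop :=
  x ∈ G.feasible ∧
    ∀ (i : Fin N) (y : EuclideanSpace ℝ (Fin (n i))),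
      replace x i y ∈ G.feasible → G.cost i x ≤ G.cost i (replace x i y)

/-- `x` solves the stochastic variational inequality `SVI(𝓧, 𝔽)`; the values `f_i` that occur
are finite. -/
def IsSVISol (x : Profile n) : Prop :=
  x ∈ G.feasible ∧
    ∀ y ∈ G.feasible,
      0 ≤ inner ℝ (G.pseudograd x) (y - x)
        + ∑ i, ((G.f i (y i)).toReal - (G.f i (x i)).toReal)

/-- Variational equilibrium: an SGNE that solves the associated SVI. -/
def IsVSGNE (x : Profile n) : Prop := G.IsSGNE x ∧ G.IsSVISol x

/-! ### Assumptions on the game -/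

/-- Nonempty closed convex local sets, and Slater's condition. -/
structure ConstraintQualification : Prop where
  nonempty : ∀ i, (G.Ω i).Nonempty
  closed : ∀ i, IsClosed (G.Ω i)
  convex : ∀ i, Convex ℝ (G.Ω i)
  slater : ∃ x ∈ G.localSet, ∀ j, G.coupling x j < 0

/-- The functions `g_i` are convex and differentiable; `g` is Lipschitz with bounded gradient. -/
structure CouplingAssumption : Prop where
  convex : ∀ i j, ConvexOn ℝ Set.univ (fun y => G.g i y j)
  differentiable : ∀ i, Differentiable ℝ (G.g i)
  lipschitz : ∃ ℓ : ℝ≥0, LipschitzOnWith ℓ G.coupling G.localSet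
  bounded : ∃ B : ℝ, ∀ x ∈ G.feasible, ‖fderiv ℝ G.coupling x‖ ≤ B

/-- The functions `f_i : ℝ^{n_i} → ℝ ∪ {+∞}` are lower semicontinuous and convex, with domain
`Ω_i`. -/
structure NonsmoothCostAssumption : Prop where
  ne_bot : ∀ i y, G.f i y ≠ ⊥
  lsc : ∀ i, LowerSemicontinuous (G.f i)
  convex : ∀ i, Convex ℝ {p : EuclideanSpace ℝ (Fin (n i)) × ℝ | G.f i p.1 ≤ (p.2 : EReal)}
  dom : ∀ i, {y | G.f i y < ⊤} = G.Ω i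

/-- The sample costs are measurable with well-defined expectation on the feasible set; for each
sample, `J_i(·, x_{-i}, ξ)` is convex, continuously differentiable, and Lipschitz with a
constant that is integrable in `ξ`. -/
structure SampleCostAssumption : Prop where
  measurable : ∀ i, Measurable (Function.uncurry (G.J i))
  integrable : ∀ i, ∀ x ∈ G.feasible, Integrable (G.J i x) G.law
  convex : ∀ i, ∀ x ∈ G.localSet, ∀ ξ, ConvexOn ℝ (G.Ω i) (fun y => G.J i (replace x i y) ξ)
  contDiff : ∀ i, ∀ x ∈ G.localSet, ∀ ξ, ∀ y ∈ G.Ω i,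
    ContDiffAt ℝ 1 (fun y => G.J i (replace x i y) ξ) y
  lipschitz : ∀ i, ∀ x ∈ G.localSet, ∃ ℓ : EuclideanSpace ℝ (Fin d) → ℝ,
    Integrable ℓ G.law ∧ ∀ ξ, ∀ y ∈ G.Ω i, ∀ y' ∈ G.Ω i,
      |G.J i (replace x i y) ξ - G.J i (replace x i y') ξ| ≤ ℓ ξ * ‖y - y'‖

/-- The pseudogradient is monotone and Lipschitz continuous. -/
structure MonotoneLipschitz : Prop where
  monotone : ∀ x ∈ G.localSet, ∀ y ∈ G.localSet,
    0 ≤ inner ℝ (G.pseudograd x - G.pseudograd y) (x - y)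
  lipschitz : ∃ ℓ : ℝ≥0, LipschitzOnWith ℓ G.pseudograd G.localSet

/-- Variance control: for some real `p ≥ 2`, the `L^p` norm of the one-sample error at `x` is at
most `σ(x*) + σ₀ ‖x - x*‖`, for every solution `x*` of the SVI. -/
def VarianceControl : Prop :=
  ∃ (p : ℝ≥0) (σ₀ : ℝ) (σ : Profile n → ℝ), 2 ≤ p ∧ 0 ≤ σ₀ ∧
    ∀ x ∈ G.localSet, ∀ x', G.IsSVISol x' →
      eLpNorm (fun ξ => G.sampleGrad x ξ - G.pseudograd x) p G.law
        ≤ ENNReal.ofReal (σ x' + σ₀ * ‖x - x'‖)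

end Game

/-! ### The multiplier graph -/

/-- `W` is a weighted adjacency matrix of the undirected graph `A`. -/
structure IsWeightMatrix {N : ℕ} (A : SimpleGraph (Fin N)) (W : Fin N → Fin N → ℝ) : Prop where
  symm : ∀ i j, W i j = W j i
  pos : ∀ i j, A.Adj i j → 0 < W i j
  zero : ∀ i j, ¬ A.Adj i j → W i j = 0

/-- `((D - W) ⊗ Id_m) v`, where `D` is the diagonal matrix of the degrees `∑ j, w_{i,j}`: its
`i`-th block is `∑ j, w_{i,j} (v_i - v_j)`. -/
def laplacian {N m : ℕ} (W : Fin N → Fin N → ℝ) (v : Dual N m) : Dual N m :=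
  WithLp.toLp 2 (fun i => ∑ j, W i j • (v i - v j))

/-! ### The algorithm -/

/-- The constant step sizes `α_i`, `ν_i`, `τ_i` of the three blocks of variables. -/
structure Steps (N : ℕ) where
  /-- primal step sizes -/
  α : Fin N → ℝ
  /-- auxiliary step sizes -/
  ν : Fin N → ℝ
  /-- dual step sizes -/
  τ : Fin N → ℝ

/-- All step sizes are positive, i.e. `Φ = diag(α⁻¹, ν⁻¹, τ⁻¹) ≻ 0`. -/
structure Steps.Positive {N : ℕ} (st : Steps N) : Prop where
  α : ∀ i, 0 < st.α i
  ν : ∀ i, 0 < st.ν i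
  τ : ∀ i, 0 < st.τ i

/-- The block diagonal operator `Φ⁻¹ = diag(α, ν, τ)` on the state space. -/
def Steps.phiInv {N : ℕ} (st : Steps N) (n : Fin N → ℕ) (m : ℕ) : State n m →L[ℝ] State n m :=
  LinearMap.toContinuousLinearMap
    { toFun := fun ω => State.mk (WithLp.toLp 2 fun i => st.α i • ω.x i)
        (WithLp.toLp 2 fun i => st.ν i • ω.z i) (WithLp.toLp 2 fun i => st.τ i • ω.lam i)
      map_add' := by
        intro a b
        simp only [smul_add, State.x, State.z, State.lam, WithLp.add_fst, WithLp.add_snd,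
          PiLp.add_apply]
        rfl
      map_smul' := by
        intro c a
        simp only [State.x, State.z, State.lam, WithLp.smul_fst, WithLp.smul_snd,
          PiLp.smul_apply, RingHom.id_apply, smul_comm _ c]
        rfl }

namespace Game

variable {N m d : ℕ} {n : Fin N → ℕ} (G : Game N m d n)

/-- The extended operator `Ā(x, z, lam) =
col(𝔽(x) + ∇g(x)^⊤ lam, L lam, L lam - g(x) - L z)`, where here `g(x) = col(g_i(x_i))` and
`∇g(x)^⊤ lam = col(∇g_i(x_i)^⊤ lam_i)`. -/
def extOp (W : Fin N → Fin N → ℝ) (ω : State n m) : State n m :=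
  State.mk
    (WithLp.toLp 2 fun i => G.pseudograd ω.x i + G.jacT i (ω.x i) (ω.lam i))
    (laplacian W ω.lam)
    (WithLp.toLp 2 fun i =>
      laplacian W ω.lam i - G.g i (ω.x i) - laplacian W ω.z i)

/-- The domain `𝛀 × ℝ^{Nm} × ℝ^{Nm}_{≥0}` of the states. -/
def stateDomain : Set (State n m) :=
  {ω | ω.x ∈ G.localSet ∧ ∀ i, ω.lam i ∈ orthant m}

/-- The step size bound `‖Φ⁻¹‖ ≤ 1 / (2 δ (2 ℓ + 1))`, where `ℓ ∈ [0, ∞]` is the Lipschitz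
constant of the extended operator (so that no step size is admitted if `ℓ = ∞`). -/
def StepSizeBound (W : Fin N → Fin N → ℝ) (st : Steps N) (δ : ℝ) : Prop :=
  ENNReal.ofReal ‖st.phiInv n m‖
    ≤ 1 / (2 * ENNReal.ofReal δ * (2 * lipschitzConst (G.extOp W) G.stateDomain + 1))

/-- `(ω, ωbar)` is a run of the distributed stochastic relaxed forward--backward algorithm along
the samples `ξ k i t` (iteration `k`, agent `i`, `t`-th element of the batch of size `S k`).
Here `ω k` is the `k`-th iterate, and `ωbar k` is the average with index `k - 1`: the start
`ωbar 0` is arbitrary and the average with index `k` is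
`ωbar (k + 1) = (1 - δ) ω k + δ ωbar k`. -/
structure IsSRFB (W : Fin N → Fin N → ℝ) (st : Steps N) (δ : ℝ) (S : ℕ → ℕ)
    (ξ : ℕ → Fin N → ℕ → EuclideanSpace ℝ (Fin d)) (ω ωbar : ℕ → State n m) : Prop where
  init : ω 0 ∈ G.stateDomain
  average : ∀ k, ωbar (k + 1) = (1 - δ) • ω k + δ • ωbar k
  primal : ∀ k i,
    IsProx (fun y => (st.α i : EReal) * G.f i y)
      ((ωbar (k + 1)).x i
        - st.α i • (G.batchGrad (S k) i (ω k).x (ξ k i)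
            + G.jacT i ((ω k).x i) ((ω k).lam i)))
      ((ω (k + 1)).x i)
  auxiliary : ∀ k i,
    (ω (k + 1)).z i
      = (ωbar (k + 1)).z i - st.ν i • ∑ j, W i j • ((ω k).lam i - (ω k).lam j)
  dual : ∀ k i,
    IsProj (orthant m)
      ((ωbar (k + 1)).lam i + st.τ i • G.g i ((ω k).x i)
        + st.τ i • ∑ j, W i j •
            (((ω k).z i - (ω k).z j) - ((ω k).lam i - (ω k).lam j)))
      ((ω (k + 1)).lam i)

/-- The samples `ξ k i t` are independent random vectors with the law of the uncertainty, and
they are independent of the initial data `init` of the algorithm. -/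
structure IsSampling {Θ B : Type*} [MeasurableSpace Θ] [MeasurableSpace B] (P : Measure Θ)
    (ξ : ℕ → Fin N → ℕ → Θ → EuclideanSpace ℝ (Fin d)) (init : Θ → B) : Prop where
  measurable : ∀ k i t, Measurable (ξ k i t)
  law_eq : ∀ k i t, P.map (ξ k i t) = G.law
  indep : iIndepFun (fun q : ℕ × Fin N × ℕ => ξ q.1 q.2.1 q.2.2) P
  measurable_init : Measurable init
  indep_init : IndepFun init (fun θ (q : ℕ × Fin N × ℕ) => ξ q.1 q.2.1 q.2.2 θ) P

end Game

/-- Increasing batch sizes: `S_k ≥ c (k + k₀)^{a + 1}` for some `c, k₀, a > 0`. -/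
def IncreasingBatch (S : ℕ → ℕ) : Prop :=
  ∃ c k₀ a : ℝ, 0 < c ∧ 0 < k₀ ∧ 0 < a ∧ ∀ k : ℕ, c * ((k : ℝ) + k₀) ^ (a + 1) ≤ (S k : ℝ)

end SGNE

end

/-! The algorithm is a stochastic golden ratio method for a monotone mixed variational inequality on
the states (x, z, lam). Let `C` be the state domain, `h` the sum of the f_i, and `Q` the square root
of Φ. One iteration is a proximal step in the metric of Φ, taken from the averaged point along
`extOp` at the current state plus the mini-batch error (`IsSRFB.isResolvent`). On `C` the operator
`extOp` is monotone: convexity of the g_i against nonnegative multipliers handles the constraints,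
and the Laplacian blocks split into a positive semidefinite part and a skew part. The primal blocks
of the points of `viSol` are exactly the solutions of the SVI: connectedness forces consensus of the
multipliers (`isSVISol_of_mem_viSol`), and Slater's condition supplies a multiplier for the converse
(`nonempty_viSol_of_isSVISol`).

For a solution z, two consecutive proximal inequalities, the variational inequality and monotonicity
add up to the decrease of an energy (`energy_le`). The golden ratio enters as 1/δ ≤ 1 + δ, which
disposes of the one term of the wrong sign. The step size bound pays for the Lipschitz term and for
part of the noise.

The iterate is a function of the initial data and the past batches, and the new batch is independent
of them. So the error is centered on every past event, and its second moment there is at most (K /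
S_k) times that of 1 + ‖u - z‖², a summable factor (`isNoise_of_indep`). Then `robbins_siegmund`
gives, almost surely, convergence of the energy, while increments and errors tend to zero
(`IsRun.ae_tendsto_of_memLp`).

A countable dense set of solutions z leaves only one null set. Outside it, cluster points of the
iterates are solutions, and convergence of the distances to the dense set upgrades this to
convergence of the whole sequence (`StepCondition.exists_tendsto`). Finally, the integrated gradient
inequality shows that a solution of the SVI is an equilibrium (`IsSVISol.isVSGNE`). -/

namespace SGNE

/-! ### Energy inequality of the golden ratio iteration. -/

section Abstract

variable {E : Type*} [NormedAddCommGroup E] [InnerProductSpace ℝ E]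

/-- Solutions of the mixed variational inequality of `A` and `h` on `C`. -/
def viSol (C : Set E) (A : E → E) (h : E → ℝ) : Set E :=
  {z | z ∈ C ∧ ∀ y ∈ C, 0 ≤ inner ℝ (A z) (y - z) + (h y - h z)}

/-- `u` is the proximal point, in the metric of `Q† Q`, of a step from `v` along `a`. -/
def IsResolvent (Q : E →L[ℝ] E) (C : Set E) (h : E → ℝ) (v a u : E) : Prop :=
  u ∈ C ∧ ∀ y ∈ C, 0 ≤ inner ℝ (Q (u - v)) (Q (y - u)) + inner ℝ a (y - u) + (h y - h u)

/-- The standing assumptions on the operator, the metric, and the averaging parameter. -/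
structure StepCondition (Q : E →L[ℝ] E) (C : Set E) (A : E → E) (δ η : ℝ) (ℓ : ℝ≥0) : Prop where
  lip : LipschitzOnWith ℓ A C
  mono : ∀ a ∈ C, ∀ b ∈ C, 0 ≤ inner ℝ (A a - A b) (a - b)
  eta_nonneg : 0 ≤ η
  norm_sq_le : ∀ a, ‖a‖ ^ 2 ≤ η * ‖Q a‖ ^ 2
  step : η * (2 * ℓ + 1) ≤ 1 / (2 * δ)
  delta_golden : 1 ≤ δ ^ 2 + δ
  delta_half : 1 / 2 ≤ δ
  delta_lt_one : δ < 1

variable {Q : E →L[ℝ] E} {C : Set E} {A : E → E} {h : E → ℝ} {δ η : ℝ} {ℓ : ℝ≥0}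

theorem StepCondition.delta_pos (H : StepCondition Q C A δ η ℓ) : 0 < δ := by
  linarith [H.delta_half]

/-- The two summands of `2 * ℓ + 1` have separate uses in `energy_le`: this half pays for the noise,
and `lip_mul_eta_le` pays for the Lipschitz term. -/
theorem StepCondition.eta_le (H : StepCondition Q C A δ η ℓ) : η ≤ 1 / (2 * δ) := by
  nlinarith [H.step, H.eta_nonneg, ℓ.2, mul_nonneg H.eta_nonneg ℓ.2]

theorem StepCondition.eta_mul_delta_le (H : StepCondition Q C A δ η ℓ) : η * δ ≤ 1 / 2 := by
  have h1 := H.eta_le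
  have hδ := H.delta_pos
  calc η * δ ≤ 1 / (2 * δ) * δ := by gcongr
    _ = 1 / 2 := by field_simp

theorem StepCondition.eta_le_one (H : StepCondition Q C A δ η ℓ) : η ≤ 1 := by
  nlinarith [H.eta_mul_delta_le, H.delta_half, H.eta_nonneg]

theorem StepCondition.lip_mul_eta_le (H : StepCondition Q C A δ η ℓ) : ℓ * η ≤ 1 / (4 * δ) := by
  have h1 := H.step
  have h2 : 1 / (2 * δ) = 2 * (1 / (4 * δ)) := by have := H.delta_pos; field_simp; norm_num
  nlinarith [H.eta_nonneg]

theorem StepCondition.norm_sq_le' (H : StepCondition Q C A δ η ℓ) (a : E) :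
    ‖a‖ ^ 2 ≤ ‖Q a‖ ^ 2 :=
  (H.norm_sq_le a).trans (mul_le_of_le_one_left (sq_nonneg _) H.eta_le_one)

theorem StepCondition.norm_le (H : StepCondition Q C A δ η ℓ) (a : E) : ‖a‖ ≤ ‖Q a‖ :=
  (sq_le_sq₀ (norm_nonneg _) (norm_nonneg _)).1 (H.norm_sq_le' a)

theorem StepCondition.norm_map_sub_le (H : StepCondition Q C A δ η ℓ) {a b : E}
    (ha : a ∈ C) (hb : b ∈ C) : ‖A a - A b‖ ≤ ℓ * ‖a - b‖ := by
  simpa [dist_eq_norm] using H.lip.dist_le_mul a ha b hb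

/-- The Lyapunov function of the iteration: `v` is the average that includes `u`, `u₀` is the
previous iterate, and `e₀` is the error of the previous step. -/
noncomputable def energy (Q : E →L[ℝ] E) (δ : ℝ) (z v u u₀ e₀ : E) : ℝ :=
  1 / (1 - δ) * ‖Q (v - z)‖ ^ 2 + 1 / (4 * δ) * ‖Q (u - u₀)‖ ^ 2 + 4 * ‖e₀‖ ^ 2

/-- The decrease of the Lyapunov function. -/
noncomputable def decrease (Q : E →L[ℝ] E) (δ : ℝ) (v u u' : E) : ℝ :=
  1 / δ * ‖Q (u - v)‖ ^ 2 + 1 / (4 * δ) * ‖Q (u' - u)‖ ^ 2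

theorem StepCondition.energy_nonneg (H : StepCondition Q C A δ η ℓ) (z v u u₀ e₀ : E) :
    0 ≤ energy Q δ z v u u₀ e₀ := by
  have h1 := H.delta_pos
  have h2 : 0 < 1 - δ := by linarith [H.delta_lt_one]
  unfold energy; positivity

theorem StepCondition.decrease_nonneg (H : StepCondition Q C A δ η ℓ) (v u u' : E) :
    0 ≤ decrease Q δ v u u' := by
  have h1 := H.delta_pos
  unfold decrease; positivity

/-- Converts variance bounds in ‖u - z‖ into bounds in the energy. The energy measures the distance
of `v`, not of `u`, so the gap `u - v` is charged to the decrease. -/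
theorem StepCondition.norm_sub_sq_le (H : StepCondition Q C A δ η ℓ) (z v u u₀ e₀ u' : E) :
    ‖u - z‖ ^ 2 ≤ 2 * (decrease Q δ v u u' + energy Q δ z v u u₀ e₀) := by
  have h1 := H.delta_pos
  have h2 : 0 < 1 - δ := by linarith [H.delta_lt_one]
  have h3 : ‖Q (u - z)‖ ^ 2 ≤ 2 * (‖Q (u - v)‖ ^ 2 + ‖Q (v - z)‖ ^ 2) := by
    have : Q (u - z) = Q (u - v) + Q (v - z) := by rw [← map_add]; congr 1; abel
    rw [this]
    nlinarith [norm_add_le (Q (u - v)) (Q (v - z)), norm_nonneg (Q (u - v) + Q (v - z)),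
      sq_nonneg (‖Q (u - v)‖ - ‖Q (v - z)‖), norm_nonneg (Q (u - v)), norm_nonneg (Q (v - z))]
  have h4 : ‖Q (u - v)‖ ^ 2 ≤ decrease Q δ v u u' := by
    have : 1 ≤ 1 / δ := by rw [le_div_iff₀ h1]; linarith [H.delta_lt_one]
    have h5 : 0 ≤ 1 / (4 * δ) * ‖Q (u' - u)‖ ^ 2 := by positivity
    unfold decrease
    nlinarith [sq_nonneg ‖Q (u - v)‖]
  have h6 : ‖Q (v - z)‖ ^ 2 ≤ energy Q δ z v u u₀ e₀ := by
    have : 1 ≤ 1 / (1 - δ) := by rw [le_div_iff₀ h2]; linarith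
    have h5 : 0 ≤ 1 / (4 * δ) * ‖Q (u - u₀)‖ ^ 2 := by positivity
    unfold energy
    nlinarith [sq_nonneg ‖Q (v - z)‖, sq_nonneg ‖e₀‖]
  linarith [H.norm_sq_le' (u - z)]

theorem two_inner_sub_sub (a b c : E) :
    2 * inner ℝ (a - b) (c - a) = ‖b - c‖ ^ 2 - ‖a - b‖ ^ 2 - ‖a - c‖ ^ 2 := by
  have h1 : b - c = -((a - b) + (c - a)) := by abel
  rw [h1, norm_neg, @norm_add_sq_real, norm_sub_rev a c]; ring

/-- One step of the stochastic golden ratio iteration. -/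
theorem StepCondition.energy_le (H : StepCondition Q C A δ η ℓ) {z v₀ u₀ e₀ u v e u' v' : E}
    (hz : z ∈ viSol C A h) (hu₀ : u₀ ∈ C) (hu : IsResolvent Q C h v₀ (A u₀ + e₀) u)
    (hv : v = (1 - δ) • u + δ • v₀) (hu' : IsResolvent Q C h v (A u + e) u')
    (hv' : v' = (1 - δ) • u' + δ • v) :
    energy Q δ z v' u' u e
      ≤ energy Q δ z v u u₀ e₀ - decrease Q δ v u u' + 2 * inner ℝ e (z - u)
        + 8 * ‖e‖ ^ 2 := by
  have hδ := H.delta_pos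
  have hδ1 : 0 < 1 - δ := by linarith [H.delta_lt_one]
  -- The ingredients: the new step tested at the solution, the previous step tested at the new
  -- point, the variational inequality of `z` at `u`, and monotonicity between `u` and `z`.
  have i1 := hu'.2 z hz.1
  have i2 := hu.2 u' hu'.1
  have i3 := hz.2 u hu.1
  have i4 := H.mono u hu.1 z hz.1
  -- The averaging rule trades the old base point `v₀` for `v`, at the price of the factor 1/δ.
  have e1 : u - v₀ = (1 / δ) • (u - v) := by
    rw [hv]
    have : u - ((1 - δ) • u + δ • v₀) = δ • (u - v₀) := by module
    rw [this, smul_smul]; field_simp; simp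
  rw [e1, map_smul, inner_smul_left] at i2
  simp only [conj_trivial] at i2
  have p1 := two_inner_sub_sub (Q u') (Q v) (Q z)
  have p2 := two_inner_sub_sub (Q u) (Q v) (Q u')
  simp only [← map_sub] at p1 p2
  have p3 : ‖Q (v' - z)‖ ^ 2 = (1 - δ) * ‖Q (u' - z)‖ ^ 2 + δ * ‖Q (v - z)‖ ^ 2
      - δ * (1 - δ) * ‖Q (u' - v)‖ ^ 2 := by
    have q1 : v' - z = (1 - δ) • (u' - z) + δ • (v - z) := by rw [hv']; module
    have q2 : Q (u' - v) = Q (u' - z) - Q (v - z) := by rw [← map_sub]; congr 1; abel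
    rw [q1, q2, map_add, map_smul, map_smul, @norm_add_sq_real, @norm_sub_sq_real,
      norm_smul, norm_smul, inner_smul_left, inner_smul_right]
    simp only [conj_trivial, Real.norm_eq_abs, mul_pow, sq_abs]
    ring
  have c1 : inner ℝ (A u - A u₀) (u - u') ≤ ℓ * ‖u - u₀‖ * ‖u' - u‖ := by
    refine (real_inner_le_norm _ _).trans ?_
    rw [norm_sub_rev u u']
    gcongr
    exact H.norm_map_sub_le hu.1 hu₀
  have c2 : 2 * (ℓ * ‖u - u₀‖ * ‖u' - u‖)
      ≤ 1 / (4 * δ) * ‖Q (u - u₀)‖ ^ 2 + 1 / (4 * δ) * ‖Q (u' - u)‖ ^ 2 := by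
    have a1 := H.norm_sq_le (u - u₀)
    have a2 := H.norm_sq_le (u' - u)
    have a3 := H.lip_mul_eta_le
    calc 2 * (ℓ * ‖u - u₀‖ * ‖u' - u‖) ≤ ℓ * (‖u - u₀‖ ^ 2 + ‖u' - u‖ ^ 2) := by
          nlinarith [mul_nonneg ℓ.2 (sq_nonneg (‖u - u₀‖ - ‖u' - u‖))]
      _ ≤ ℓ * (η * ‖Q (u - u₀)‖ ^ 2 + η * ‖Q (u' - u)‖ ^ 2) := by gcongr
      _ = (ℓ * η) * (‖Q (u - u₀)‖ ^ 2 + ‖Q (u' - u)‖ ^ 2) := by ring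
      _ ≤ 1 / (4 * δ) * (‖Q (u - u₀)‖ ^ 2 + ‖Q (u' - u)‖ ^ 2) := by gcongr
      _ = _ := by ring
  have d4 : 1 / (2 * δ) = 2 * (1 / (4 * δ)) := by field_simp; norm_num
  -- Young's inequality 2rs ≤ 2r² + s²/2 with r = ‖e‖ + ‖e₀‖. The share of `e₀` is paid by the last
  -- term of the previous energy.
  have c3 : 2 * inner ℝ (e - e₀) (u - u')
      ≤ 4 * ‖e‖ ^ 2 + 4 * ‖e₀‖ ^ 2 + 1 / (4 * δ) * ‖Q (u' - u)‖ ^ 2 := by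
    have a4 : 1 / 2 * ‖u' - u‖ ^ 2 ≤ 1 / (4 * δ) * ‖Q (u' - u)‖ ^ 2 := by
      have a5 := H.norm_sq_le (u' - u)
      have := mul_le_mul_of_nonneg_right H.eta_le (sq_nonneg ‖Q (u' - u)‖)
      rw [d4] at this
      linarith
    have a6 : inner ℝ (e - e₀) (u - u') ≤ (‖e‖ + ‖e₀‖) * ‖u' - u‖ := by
      refine (real_inner_le_norm _ _).trans ?_
      rw [norm_sub_rev u u']
      gcongr
      exact norm_sub_le _ _
    nlinarith [sq_nonneg (‖u' - u‖ - 2 * (‖e‖ + ‖e₀‖)), sq_nonneg (‖e‖ - ‖e₀‖)]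
  have d1 : 1 / (1 - δ) * ‖Q (v' - z)‖ ^ 2 = ‖Q (u' - z)‖ ^ 2 + δ / (1 - δ) * ‖Q (v - z)‖ ^ 2
      - δ * ‖Q (u' - v)‖ ^ 2 := by
    rw [p3]; field_simp
  have d2 : 1 / (1 - δ) * ‖Q (v - z)‖ ^ 2 = ‖Q (v - z)‖ ^ 2 + δ / (1 - δ) * ‖Q (v - z)‖ ^ 2 := by
    field_simp; ring
  -- The coefficient of ‖Q (u' - v)‖² collects 1/δ from `p2'`, -1 from `p1` and -δ from `d1`.
  have d3 : (1 / δ - 1 - δ) * ‖Q (u' - v)‖ ^ 2 ≤ 0 := by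
    apply mul_nonpos_of_nonpos_of_nonneg _ (sq_nonneg _)
    have : 1 / δ ≤ 1 + δ := by rw [div_le_iff₀ hδ]; nlinarith [H.delta_golden]
    linarith
  have d5 : 1 / δ = 4 * (1 / (4 * δ)) := by field_simp
  have s1 : inner ℝ (A u + e) (z - u') + inner ℝ (A u₀ + e₀) (u' - u)
      = - inner ℝ (A u - A z) (u - z) - inner ℝ (A z) (u - z) + inner ℝ e (z - u)
        + inner ℝ (A u - A u₀) (u - u') + inner ℝ (e - e₀) (u - u') := by
    simp only [inner_add_left, inner_sub_left, inner_sub_right]; ring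
  unfold energy decrease
  have p2' : 2 * (1 / δ * inner ℝ (Q (u - v)) (Q (u' - u)))
      = 1 / δ * ‖Q (v - u')‖ ^ 2 - 1 / δ * ‖Q (u - v)‖ ^ 2 - 1 / δ * ‖Q (u - u')‖ ^ 2 := by
    rw [← mul_sub, ← mul_sub, ← p2]; ring
  have n1 : ‖Q (v - u')‖ = ‖Q (u' - v)‖ := by rw [← norm_neg, ← map_neg, neg_sub]
  have n2 : ‖Q (u - u')‖ = ‖Q (u' - u)‖ := by rw [← norm_neg, ← map_neg, neg_sub]
  rw [n1, n2] at p2'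
  rw [d1, d2]
  -- In units of `B`, ‖Q (u' - u)‖² comes with -4 from `p2'`. The Lipschitz term, the noise term,
  -- the new energy and the decrease use one unit each.
  set B := 1 / (4 * δ)
  rw [d5] at p2' d3 i2 ⊢
  linarith

end Abstract
-- Resolvents, and convergence along one sample path.
section Abstract

variable {E : Type*} [NormedAddCommGroup E] [InnerProductSpace ℝ E]
variable {Q : E →L[ℝ] E} {C : Set E} {A : E → E} {h : E → ℝ} {δ η : ℝ} {ℓ : ℝ≥0}

/-- Solutions are fixed points of the step, so the Lipschitz bound for resolvents compares iterates
with solutions. -/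
theorem isResolvent_of_mem_viSol {z : E} (hz : z ∈ viSol C A h) :
    IsResolvent Q C h z (A z) z :=
  ⟨hz.1, fun y hy => by simpa using hz.2 y hy⟩

/-- The resolvent is Lipschitz in the base point and the direction. -/
theorem StepCondition.norm_map_resolvent_sub_le (H : StepCondition Q C A δ η ℓ)
    {v₁ a₁ u₁ v₂ a₂ u₂ : E}
    (h₁ : IsResolvent Q C h v₁ a₁ u₁) (h₂ : IsResolvent Q C h v₂ a₂ u₂) :
    ‖Q (u₁ - u₂)‖ ≤ ‖Q‖ * ‖v₁ - v₂‖ + ‖a₁ - a₂‖ := by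
  have i1 := h₁.2 u₂ h₂.1
  have i2 := h₂.2 u₁ h₁.1
  have e1 : inner ℝ (Q (u₁ - v₁)) (Q (u₂ - u₁)) + inner ℝ (Q (u₂ - v₂)) (Q (u₁ - u₂))
      = - ‖Q (u₁ - u₂)‖ ^ 2 + inner ℝ (Q (v₁ - v₂)) (Q (u₁ - u₂)) := by
    rw [← real_inner_self_eq_norm_sq]
    simp only [map_sub, inner_sub_left, inner_sub_right]; ring
  have e2 : inner ℝ a₁ (u₂ - u₁) + inner ℝ a₂ (u₁ - u₂) = - inner ℝ (a₁ - a₂) (u₁ - u₂) := by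
    simp only [inner_sub_left, inner_sub_right]; ring
  have b1 : inner ℝ (Q (v₁ - v₂)) (Q (u₁ - u₂)) ≤ ‖Q‖ * ‖v₁ - v₂‖ * ‖Q (u₁ - u₂)‖ := by
    refine (real_inner_le_norm _ _).trans ?_
    gcongr
    exact Q.le_opNorm _
  have b2 : - inner ℝ (a₁ - a₂) (u₁ - u₂) ≤ ‖a₁ - a₂‖ * ‖Q (u₁ - u₂)‖ := by
    rw [← inner_neg_left]
    refine (real_inner_le_norm _ _).trans ?_
    rw [norm_neg]
    gcongr
    exact H.norm_le _
  have key : ‖Q (u₁ - u₂)‖ * ‖Q (u₁ - u₂)‖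
      ≤ (‖Q‖ * ‖v₁ - v₂‖ + ‖a₁ - a₂‖) * ‖Q (u₁ - u₂)‖ := by nlinarith
  rcases (norm_nonneg (Q (u₁ - u₂))).eq_or_lt with h0 | h0
  · rw [← h0]; positivity
  · exact le_of_mul_le_mul_right key h0

theorem StepCondition.norm_resolvent_sub_le (H : StepCondition Q C A δ η ℓ)
    {v₁ a₁ u₁ v₂ a₂ u₂ : E}
    (h₁ : IsResolvent Q C h v₁ a₁ u₁) (h₂ : IsResolvent Q C h v₂ a₂ u₂) :
    ‖u₁ - u₂‖ ≤ ‖Q‖ * ‖v₁ - v₂‖ + ‖a₁ - a₂‖ :=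
  (H.norm_le _).trans (H.norm_map_resolvent_sub_le h₁ h₂)

/-- Where a proximal point exists, it is a Lipschitz function of base point and direction. That
function extends continuously to all of `E × E`, so existence elsewhere is not needed. -/
theorem StepCondition.measurable_resolvent [FiniteDimensional ℝ E] [MeasurableSpace E]
    [BorelSpace E] (H : StepCondition Q C A δ η ℓ) {Θ : Type*} [MeasurableSpace Θ]
    {v a u : Θ → E} (hv : Measurable v) (ha : Measurable a)
    (hu : ∀ θ, IsResolvent Q C h (v θ) (a θ) (u θ)) : Measurable u := by
  classical
  let D : Set (E × E) := {p | ∃ w, IsResolvent Q C h p.1 p.2 w}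
  let T : E × E → E := fun p => if hp : ∃ w, IsResolvent Q C h p.1 p.2 w then hp.choose else 0
  have hT : ∀ p ∈ D, IsResolvent Q C h p.1 p.2 (T p) := by
    intro p hp
    have hp' : ∃ w, IsResolvent Q C h p.1 p.2 w := hp
    simp only [T, dif_pos hp']
    exact hp'.choose_spec
  have hL : LipschitzOnWith (‖Q‖₊ + 1) T D := by
    refine LipschitzOnWith.of_dist_le_mul fun p hp q hq => ?_
    rw [dist_eq_norm]
    refine (H.norm_resolvent_sub_le (hT p hp) (hT q hq)).trans ?_
    have h1 : ‖p.1 - q.1‖ ≤ dist p q := by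
      rw [← dist_eq_norm]; exact le_max_left _ _
    have h2 : ‖p.2 - q.2‖ ≤ dist p q := by
      rw [← dist_eq_norm]; exact le_max_right _ _
    push_cast
    rw [add_mul, one_mul]
    gcongr
  obtain ⟨T', hT', hEq⟩ := hL.extend_finite_dimension
  have hu' : u = fun θ => T' (v θ, a θ) := by
    funext θ
    have hθ : (v θ, a θ) ∈ D := ⟨u θ, hu θ⟩
    rw [← hEq hθ, ← sub_eq_zero, ← norm_le_zero_iff]
    simpa using H.norm_resolvent_sub_le (hu θ) (hT _ hθ)
  rw [hu']
  exact hT'.continuous.measurable.comp (hv.prodMk ha)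

/-- Limits of iterates with vanishing increments and errors solve the variational inequality. -/
theorem StepCondition.mem_viSol_of_tendsto (H : StepCondition Q C A δ η ℓ) (hC : IsClosed C)
    (hh : LowerSemicontinuousOn h C) {u v e u' : ℕ → E} {w : E} (hu : ∀ n, u n ∈ C)
    (hstep : ∀ n, IsResolvent Q C h (v n) (A (u n) + e n) (u' n))
    (huw : Tendsto u atTop (𝓝 w)) (huw' : Tendsto u' atTop (𝓝 w))
    (huv : Tendsto (fun n => Q (u' n - v n)) atTop (𝓝 0))
    (he : Tendsto e atTop (𝓝 0)) : w ∈ viSol C A h := by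
  have hw : w ∈ C := hC.mem_of_tendsto huw (Eventually.of_forall hu)
  refine ⟨hw, fun y hy => ?_⟩
  have hA : Tendsto (fun n => A (u n)) atTop (𝓝 (A w)) := by
    have h1 : Tendsto u atTop (𝓝[C] w) :=
      tendsto_nhdsWithin_iff.2 ⟨huw, Eventually.of_forall hu⟩
    exact (H.lip.continuousOn w hw).tendsto.comp h1
  set c : ℕ → ℝ := fun n =>
    inner ℝ (Q (u' n - v n)) (Q (y - u' n)) + inner ℝ (A (u n) + e n) (y - u' n) + h y with hcdef
  have hc : Tendsto c atTop (𝓝 (inner ℝ (A w) (y - w) + h y)) := by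
    have t1 : Tendsto (fun n => y - u' n) atTop (𝓝 (y - w)) := tendsto_const_nhds.sub huw'
    have t2 : Tendsto (fun n => Q (y - u' n)) atTop (𝓝 (Q (y - w))) :=
      (Q.continuous.tendsto _).comp t1
    have t3 := ((huv.inner (𝕜 := ℝ) t2).add ((hA.add he).inner (𝕜 := ℝ) t1)).add_const (h y)
    simpa [hcdef] using t3
  have hle : ∀ n, h (u' n) ≤ c n := by
    intro n
    have := (hstep n).2 y hy
    simp only [hcdef]; linarith
  -- Since `h` is only lower semicontinuous, the limit is taken by contradiction: a value `r`
  -- between the limit of `c` and `h w` would eventually separate `c n` from `h (u' n)`.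
  by_contra! hlt
  obtain ⟨r, hr1, hr2⟩ := exists_between (show inner ℝ (A w) (y - w) + h y < h w by linarith)
  have h2 : Tendsto u' atTop (𝓝[C] w) :=
    tendsto_nhdsWithin_iff.2 ⟨huw', Eventually.of_forall fun n => (hstep n).1⟩
  have h3 := h2.eventually (hh w hw r hr2)
  have h4 := hc.eventually_lt_const hr1
  obtain ⟨n, hn3, hn4⟩ := (h3.and h4).exists
  linarith [hle n]

/-- Convergence of the iterates along a sample path. -/
theorem StepCondition.exists_tendsto [FiniteDimensional ℝ E] (H : StepCondition Q C A δ η ℓ)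
    (hC : IsClosed C) (hh : LowerSemicontinuousOn h C) {u v e : ℕ → E} {D : Set E}
    (hu : ∀ n, u n ∈ C)
    (hstep : ∀ n, IsResolvent Q C h (v n) (A (u n) + e n) (u (n + 1)))
    (hDne : D.Nonempty) (hZD : viSol C A h ⊆ closure D)
    (hlim : ∀ z ∈ D, ∃ l, Tendsto (fun n => ‖Q (v n - z)‖) atTop (𝓝 l))
    (huv : Tendsto (fun n => ‖Q (u n - v n)‖) atTop (𝓝 0))
    (huu : Tendsto (fun n => ‖Q (u (n + 1) - u n)‖) atTop (𝓝 0))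
    (he : Tendsto e atTop (𝓝 0)) :
    ∃ z ∈ viSol C A h, Tendsto u atTop (𝓝 z) := by
  have hlim' : ∀ z ∈ D, ∃ l, Tendsto (fun n => ‖Q (u n - z)‖) atTop (𝓝 l) := by
    intro z hz
    obtain ⟨l, hl⟩ := hlim z hz
    refine ⟨l, ?_⟩
    have h1 : Tendsto (fun n => ‖Q (u n - z)‖ - ‖Q (v n - z)‖) atTop (𝓝 0) := by
      refine squeeze_zero_norm (fun n => ?_) huv
      have : Q (u n - v n) = Q (u n - z) - Q (v n - z) := by rw [← map_sub]; congr 1; abel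
      rw [this]
      exact abs_norm_sub_norm_le _ _
    simpa using h1.add hl
  obtain ⟨z₀, hz₀⟩ := hDne
  obtain ⟨l₀, hl₀⟩ := hlim' z₀ hz₀
  obtain ⟨R, hR⟩ := hl₀.bddAbove_range
  have hbdd : ∀ n, u n ∈ Metric.closedBall z₀ R := by
    intro n
    rw [mem_closedBall_iff_norm]
    exact (H.norm_le _).trans (hR ⟨n, rfl⟩)
  obtain ⟨w, -, φ, hφ, hw⟩ := (isCompact_closedBall z₀ R).tendsto_subseq hbdd
  have hdiff : ∀ a : ℕ → E, Tendsto (fun n => ‖Q (a n)‖) atTop (𝓝 0) → Tendsto a atTop (𝓝 0) :=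
    fun a ha => squeeze_zero_norm (fun n => H.norm_le _) ha
  have hw' : Tendsto (fun n => u (φ n + 1)) atTop (𝓝 w) := by
    have := ((hdiff _ huu).comp hφ.tendsto_atTop).add hw
    simpa using this
  have huv' : Tendsto (fun n => Q (u (φ n + 1) - v (φ n))) atTop (𝓝 0) := by
    have h1 := tendsto_zero_iff_norm_tendsto_zero.2 huv
    have h2 := tendsto_zero_iff_norm_tendsto_zero.2 huu
    have h3 := (h2.add h1).comp hφ.tendsto_atTop
    simpa [Function.comp_def] using h3
  have hwZ : w ∈ viSol C A h :=
    H.mem_viSol_of_tendsto hC hh (fun n => hu (φ n)) (fun n => hstep (φ n)) hw hw' huv'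
      (he.comp hφ.tendsto_atTop)
  refine ⟨w, hwZ, ?_⟩
  rw [tendsto_iff_norm_sub_tendsto_zero]
  refine squeeze_zero (fun _ => norm_nonneg _) (fun n => H.norm_le _) ?_
  rw [Metric.tendsto_atTop]
  intro ε hε
  have hQ : 0 < ‖Q‖ + 1 := by positivity
  -- The cluster point `w` need not lie in `D`, where distances are known to converge. For a nearby
  -- `z ∈ D` the limit can be read off along the subsequence, so it is at most ε/4.
  obtain ⟨z, hzD, hz⟩ := Metric.mem_closure_iff.1 (hZD hwZ) (ε / (4 * (‖Q‖ + 1))) (by positivity)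
  have hzw : ‖Q (w - z)‖ < ε / 4 := by
    rw [dist_eq_norm] at hz
    calc ‖Q (w - z)‖ ≤ ‖Q‖ * ‖w - z‖ := Q.le_opNorm _
      _ ≤ (‖Q‖ + 1) * ‖w - z‖ := by gcongr; linarith
      _ < (‖Q‖ + 1) * (ε / (4 * (‖Q‖ + 1))) := by gcongr
      _ = ε / 4 := by field_simp
  obtain ⟨l, hl⟩ := hlim' z hzD
  have hl4 : l ≤ ε / 4 := by
    have h1 : Tendsto (fun n => ‖Q (u (φ n) - z)‖) atTop (𝓝 ‖Q (w - z)‖) :=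
      ((Q.continuous.tendsto _).comp (hw.sub_const z)).norm
    exact (tendsto_nhds_unique (hl.comp hφ.tendsto_atTop) h1).le.trans hzw.le
  obtain ⟨n₀, hn₀⟩ := eventually_atTop.1 (hl.eventually_lt_const (show l < ε / 2 by linarith))
  refine ⟨n₀, fun n hn => ?_⟩
  rw [Real.dist_0_eq_abs, abs_of_nonneg (norm_nonneg _)]
  have : Q (u n - w) = Q (u n - z) - Q (w - z) := by rw [← map_sub]; congr 1; abel
  rw [this]
  linarith [norm_sub_le (Q (u n - z)) (Q (w - z)), hn₀ n hn]

end Abstract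
-- The Robbins–Siegmund theorem.
section RobbinsSiegmund

variable {Θ : Type*} {m0 : MeasurableSpace Θ} {μ : Measure Θ}

theorem ae_tendsto_zero_of_summable_integral {f : ℕ → Θ → ℝ} (hf : ∀ k, Integrable (f k) μ)
    (hf0 : ∀ k θ, 0 ≤ f k θ) (hs : Summable fun k => ∫ θ, f k θ ∂μ) :
    ∀ᵐ θ ∂μ, Tendsto (fun k => f k θ) atTop (𝓝 0) := by
  have h1 : ∫⁻ θ, ∑' k, ENNReal.ofReal (f k θ) ∂μ ≠ ⊤ := by
    rw [lintegral_tsum fun k => (hf k).aemeasurable.ennreal_ofReal]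
    have : ∀ k, ∫⁻ θ, ENNReal.ofReal (f k θ) ∂μ = ENNReal.ofReal (∫ θ, f k θ ∂μ) := fun k =>
      (ofReal_integral_eq_lintegral_ofReal (hf k) (Eventually.of_forall (hf0 k))).symm
    simp_rw [this]
    exact hs.tsum_ofReal_ne_top
  have h2 := ae_lt_top' (AEMeasurable.tsum fun k => (hf k).aemeasurable.ennreal_ofReal) h1
  filter_upwards [h2] with θ hθ
  have h3 := ENNReal.tendsto_atTop_zero_of_tsum_ne_top hθ.ne
  have h4 := (ENNReal.tendsto_toReal ENNReal.zero_ne_top).comp h3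
  simpa [Function.comp_def, ENNReal.toReal_ofReal (hf0 _ θ)] using h4

/-- The Robbins–Siegmund theorem, with the conditional expectations in integrated form. -/
theorem robbins_siegmund [IsFiniteMeasure μ] {F : Filtration ℕ m0} {Y D : ℕ → Θ → ℝ}
    {β : ℕ → ℝ} (hY : ∀ k, Measurable[F k] (Y k)) (hYi : ∀ k, Integrable (Y k) μ)
    (hY0 : ∀ k θ, 0 ≤ Y k θ) (hDi : ∀ k, Integrable (D k) μ) (hD0 : ∀ k θ, 0 ≤ D k θ)
    (hβ0 : ∀ k, 0 ≤ β k) (hβ : Summable β)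
    (hstep : ∀ k s, MeasurableSet[F k] s →
      ∫ θ in s, Y (k + 1) θ ∂μ + ∫ θ in s, D k θ ∂μ ≤ (1 + β k) * ∫ θ in s, Y k θ ∂μ) :
    (∀ᵐ θ ∂μ, ∃ l, Tendsto (fun k => Y k θ) atTop (𝓝 l)) ∧
      (∀ᵐ θ ∂μ, Tendsto (fun k => D k θ) atTop (𝓝 0)) ∧
      ∃ M, ∀ k, ∫ θ, Y k θ ∂μ ≤ M ∧ ∫ θ, D k θ ∂μ ≤ M := by
  set B : ℕ → ℝ := fun k => ∑ j ∈ Finset.range k, β j with hB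
  have hBle : ∀ k, B k ≤ ∑' j, β j := fun k => hβ.sum_le_tsum _ fun j _ => hβ0 j
  set T := ∑' j, β j
  have hT0 : 0 ≤ T := tsum_nonneg hβ0
  have hB0 : ∀ k, 0 ≤ B k := fun k => Finset.sum_nonneg fun j _ => hβ0 j
  have hBs : ∀ k, B (k + 1) = B k + β k := fun k => Finset.sum_range_succ _ _
  -- Discounting absorbs the factors 1 + β k, because 1 + β ≤ exp β, and the discount never falls
  -- below exp (-T).
  set X : ℕ → Θ → ℝ := fun k θ => Real.exp (-B k) * Y k θ with hX
  have hXi : ∀ k, Integrable (X k) μ := fun k => (hYi k).const_mul _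
  have hX0 : ∀ k θ, 0 ≤ X k θ := fun k θ => mul_nonneg (Real.exp_pos _).le (hY0 k θ)
  have hXY : ∀ k (s : Set Θ), ∫ θ in s, X k θ ∂μ = Real.exp (-B k) * ∫ θ in s, Y k θ ∂μ :=
    fun k s => integral_const_mul _ _
  have hXstep : ∀ k s, MeasurableSet[F k] s →
      ∫ θ in s, X (k + 1) θ ∂μ + Real.exp (-T) * ∫ θ in s, D k θ ∂μ ≤ ∫ θ in s, X k θ ∂μ := by
    intro k s hs
    rw [hXY, hXY]
    have i0 : 0 ≤ ∫ θ in s, Y k θ ∂μ := integral_nonneg (hY0 k)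
    have i1 : 0 ≤ ∫ θ in s, D k θ ∂μ := integral_nonneg (hD0 k)
    have e1 : Real.exp (-T) ≤ Real.exp (-B (k + 1)) :=
      Real.exp_le_exp.2 (neg_le_neg (hBle _))
    have e2 : Real.exp (-B (k + 1)) * (1 + β k) ≤ Real.exp (-B k) := by
      have : Real.exp (-B k) = Real.exp (-B (k + 1)) * Real.exp (β k) := by
        rw [← Real.exp_add, hBs]; congr 1; ring
      rw [this]
      gcongr
      linarith [Real.add_one_le_exp (β k)]
    calc _ ≤ Real.exp (-B (k + 1)) * ∫ θ in s, Y (k + 1) θ ∂μ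
          + Real.exp (-B (k + 1)) * ∫ θ in s, D k θ ∂μ := by gcongr
      _ = Real.exp (-B (k + 1)) * (∫ θ in s, Y (k + 1) θ ∂μ + ∫ θ in s, D k θ ∂μ) := by ring
      _ ≤ Real.exp (-B (k + 1)) * ((1 + β k) * ∫ θ in s, Y k θ ∂μ) := by
          gcongr; exact hstep k s hs
      _ = (Real.exp (-B (k + 1)) * (1 + β k)) * ∫ θ in s, Y k θ ∂μ := by ring
      _ ≤ _ := by gcongr
  have hXstep' : ∀ k, ∫ θ, X (k + 1) θ ∂μ + Real.exp (-T) * ∫ θ, D k θ ∂μ ≤ ∫ θ, X k θ ∂μ := by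
    intro k
    simpa using hXstep k Set.univ MeasurableSet.univ
  have hDint0 : ∀ k, 0 ≤ ∫ θ, D k θ ∂μ := fun k => integral_nonneg (hD0 k)
  have hsum : ∀ n, ∫ θ, X n θ ∂μ + ∑ k ∈ Finset.range n, Real.exp (-T) * ∫ θ, D k θ ∂μ
      ≤ ∫ θ, X 0 θ ∂μ := by
    intro n
    induction n with
    | zero => simp
    | succ n ih => rw [Finset.sum_range_succ]; linarith [hXstep' n]
  have hXint0 : ∀ k, 0 ≤ ∫ θ, X k θ ∂μ := fun k => integral_nonneg (hX0 k)
  have hXle : ∀ n, ∫ θ, X n θ ∂μ ≤ ∫ θ, X 0 θ ∂μ := by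
    intro n
    have : 0 ≤ ∑ k ∈ Finset.range n, Real.exp (-T) * ∫ θ, D k θ ∂μ :=
      Finset.sum_nonneg fun k _ => mul_nonneg (Real.exp_pos _).le (hDint0 k)
    linarith [hsum n]
  have hDsum : Summable fun k => ∫ θ, D k θ ∂μ := by
    refine summable_of_sum_range_le (c := Real.exp T * ∫ θ, X 0 θ ∂μ) hDint0 fun n => ?_
    have h1 := hsum n
    rw [← Finset.mul_sum] at h1
    have h2 : Real.exp (-T) * ∑ k ∈ Finset.range n, ∫ θ, D k θ ∂μ ≤ ∫ θ, X 0 θ ∂μ := by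
      linarith [hXint0 n]
    calc _ = Real.exp T * (Real.exp (-T) * ∑ k ∈ Finset.range n, ∫ θ, D k θ ∂μ) := by
          rw [← mul_assoc, ← Real.exp_add]; simp
      _ ≤ _ := by gcongr
  refine ⟨?_, ae_tendsto_zero_of_summable_integral hDi hD0 hDsum, ?_⟩
  · have hsm : ∀ k, StronglyMeasurable[F k] (X k) := fun k =>
      ((hY k).const_mul (Real.exp (-B k))).stronglyMeasurable
    have hsup : Supermartingale X F μ := by
      refine supermartingale_of_setIntegral_succ_le hsm hXi fun k s hs => ?_
      have i1 : 0 ≤ ∫ θ in s, D k θ ∂μ := integral_nonneg (hD0 k)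
      have := mul_nonneg (Real.exp_pos (-T)).le i1
      linarith [hXstep k s hs]
    have hbdd : ∀ k, eLpNorm ((-X) k) 1 μ ≤ ((∫ θ, X 0 θ ∂μ).toNNReal : ℝ≥0) := by
      intro k
      rw [Pi.neg_apply, eLpNorm_neg, eLpNorm_one_eq_lintegral_enorm]
      have : ∫⁻ θ, ‖X k θ‖ₑ ∂μ = ENNReal.ofReal (∫ θ, X k θ ∂μ) := by
        rw [ofReal_integral_eq_lintegral_ofReal (hXi k) (Eventually.of_forall (hX0 k))]
        refine lintegral_congr fun θ => ?_
        rw [Real.enorm_eq_ofReal (hX0 k θ)]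
      rw [this]
      exact ENNReal.ofReal_le_ofReal (hXle k)
    -- `-X` is an L¹-bounded submartingale, hence converges. The discount can be undone because the
    -- partial sums `B` converge.
    filter_upwards [hsup.neg.exists_ae_tendsto_of_bdd hbdd] with θ hθ
    obtain ⟨c, hc⟩ := hθ
    have h1 : Tendsto B atTop (𝓝 T) := hβ.hasSum.tendsto_sum_nat
    have h2 := ((Real.continuous_exp.tendsto _).comp h1).mul hc.neg
    refine ⟨_, h2.congr fun k => ?_⟩
    simp only [hX, Function.comp, Pi.neg_apply, neg_neg]
    rw [← mul_assoc, ← Real.exp_add]; simp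
  · refine ⟨max (Real.exp T * ∫ θ, X 0 θ ∂μ) (∑' k, ∫ θ, D k θ ∂μ), fun k => ⟨?_, ?_⟩⟩
    · refine le_max_of_le_left ?_
      have h1 : ∫ θ, X k θ ∂μ = Real.exp (-B k) * ∫ θ, Y k θ ∂μ := integral_const_mul _ _
      calc ∫ θ, Y k θ ∂μ = Real.exp (B k) * ∫ θ, X k θ ∂μ := by
            rw [h1, ← mul_assoc, ← Real.exp_add]; simp
        _ ≤ _ := mul_le_mul (Real.exp_le_exp.2 (hBle k)) (hXle k) (hXint0 k) (Real.exp_pos _).le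
    · exact le_max_of_le_right (hDsum.le_tsum k fun j _ => hDint0 j)

end RobbinsSiegmund

/-! ### Square integrability and the noise model. -/

section Moments

theorem memLp_two_map {E E' : Type*} [NormedAddCommGroup E] [NormedSpace ℝ E]
    [NormedAddCommGroup E'] [NormedSpace ℝ E'] {Θ : Type*}
    {m0 : MeasurableSpace Θ} {μ : Measure Θ} {u : Θ → E} (hu : MemLp u 2 μ) (T : E →L[ℝ] E') :
    MemLp (fun θ => T (u θ)) 2 μ :=
  T.comp_memLp' hu

theorem integrable_norm_sq {E : Type*} [NormedAddCommGroup E] {Θ : Type*}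
    {m0 : MeasurableSpace Θ} {μ : Measure Θ} {u : Θ → E} (hu : MemLp u 2 μ) :
    Integrable (fun θ => ‖u θ‖ ^ 2) μ :=
  hu.integrable_norm_pow (by norm_num)

theorem integrable_inner_of_memLp {E : Type*} [NormedAddCommGroup E] [InnerProductSpace ℝ E]
    {Θ : Type*} {m0 : MeasurableSpace Θ} {μ : Measure Θ} {u v : Θ → E} (hu : MemLp u 2 μ)
    (hv : MemLp v 2 μ) : Integrable (fun θ => inner ℝ (u θ) (v θ)) μ :=
  (hu.norm.integrable_mul hv.norm).mono' (hu.1.inner hv.1)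
    (Eventually.of_forall fun _ => norm_inner_le_norm _ _)

variable {E : Type*} [NormedAddCommGroup E] [InnerProductSpace ℝ E]
  {Θ : Type*} {m0 : MeasurableSpace Θ} {μ : Measure Θ}

/-- The errors `e` are conditionally centered, with conditional second moments that are
controlled by the distance to `z`. -/
structure IsNoise (μ : Measure Θ) (F : Filtration ℕ m0) (u e : ℕ → Θ → E) (z : E)
    (b : ℕ → ℝ) : Prop where
  second : ∀ k s, MeasurableSet[F k] s → MemLp (fun θ => u k θ - z) 2 (μ.restrict s) →
    MemLp (e k) 2 (μ.restrict s) ∧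
      ∫ θ in s, ‖e k θ‖ ^ 2 ∂μ ≤ b k * ∫ θ in s, (1 + ‖u k θ - z‖ ^ 2) ∂μ
  mean : ∀ k s, MeasurableSet[F k] s → MemLp (fun θ => u k θ - z) 2 (μ.restrict s) →
    ∫ θ in s, inner ℝ (e k θ) (z - u k θ) ∂μ = 0

/-- Used to truncate the initial data, which need not be square integrable. -/
theorem IsNoise.restrict {F : Filtration ℕ m0} {u e : ℕ → Θ → E} {z : E} {b : ℕ → ℝ}
    (hn : IsNoise μ F u e z b) {T : Set Θ} (hT : MeasurableSet[F 0] T) :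
    IsNoise (μ.restrict T) F u e z b := by
  have hm : ∀ {k : ℕ} {s}, MeasurableSet[F k] s →
      MeasurableSet[F k] (s ∩ T) ∧ (μ.restrict T).restrict s = μ.restrict (s ∩ T) :=
    fun {k} s hs => ⟨hs.inter (F.mono (Nat.zero_le k) _ hT), Measure.restrict_restrict (F.le k _ hs)⟩
  constructor
  · intro k s hs hu
    rw [(hm hs).2] at hu ⊢
    exact hn.second k _ (hm hs).1 hu
  · intro k s hs hu
    rw [(hm hs).2] at hu ⊢
    exact hn.mean k _ (hm hs).1 hu

end Moments

/-! ### Almost sure convergence of the golden ratio iteration. -/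

section Abstract

variable {E : Type*} [NormedAddCommGroup E] [InnerProductSpace ℝ E] [FiniteDimensional ℝ E]
  [MeasurableSpace E] [BorelSpace E]
variable {Q : E →L[ℝ] E} {C : Set E} {A : E → E} {h : E → ℝ} {δ η : ℝ} {ℓ : ℝ≥0}
variable {Θ : Type*} {m0 : MeasurableSpace Θ} {μ : Measure Θ}

/-- `u`, with averages `v`, is an adapted run of the golden ratio iteration with errors `e`. -/
structure IsRun (Q : E →L[ℝ] E) (C : Set E) (A : E → E) (h : E → ℝ) (δ : ℝ)
    (F : Filtration ℕ m0) (u v e : ℕ → Θ → E) : Prop where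
  mem : ∀ k θ, u k θ ∈ C
  average : ∀ k θ, v (k + 1) θ = (1 - δ) • u (k + 1) θ + δ • v k θ
  step : ∀ k θ, IsResolvent Q C h (v k θ) (A (u k θ) + e k θ) (u (k + 1) θ)
  measurable_u : ∀ k, Measurable[F k] (u k)
  measurable_v : ∀ k, Measurable[F k] (v k)
  measurable_e : ∀ k, Measurable[F (k + 1)] (e k)

/-- By induction: the next iterate is compared with the fixed point `z`, and the error has a second
moment as soon as the current iterate has one. -/
theorem IsRun.memLp [IsFiniteMeasure μ] {F : Filtration ℕ m0} {u v e : ℕ → Θ → E}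
    (H : StepCondition Q C A δ η ℓ) (hr : IsRun Q C A h δ F u v e) {z : E} {b : ℕ → ℝ}
    (hz : z ∈ viSol C A h) (hn : IsNoise μ F u e z b) (hu0 : MemLp (u 0) 2 μ)
    (hv0 : MemLp (v 0) 2 μ) (k : ℕ) : MemLp (u k) 2 μ ∧ MemLp (v k) 2 μ ∧ MemLp (e k) 2 μ := by
  have hconst : MemLp (fun _ : Θ => z) 2 μ := memLp_const z
  have he : ∀ k, MemLp (u k) 2 μ → MemLp (e k) 2 μ := by
    intro k hk
    have := (hn.second k Set.univ MeasurableSet.univ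
      (by rw [Measure.restrict_univ]; exact hk.sub hconst)).1
    simpa using this
  have key : ∀ k, MemLp (u k) 2 μ ∧ MemLp (v k) 2 μ := by
    intro k
    induction k with
    | zero => exact ⟨hu0, hv0⟩
    | succ k ih =>
      have h1 : MemLp (u (k + 1)) 2 μ := by
        have hb : MemLp (fun θ => ‖Q‖ * ‖v k θ - z‖ + (ℓ * ‖u k θ - z‖ + ‖e k θ‖)) 2 μ :=
          ((ih.2.sub hconst).norm.const_mul _).add
            (((ih.1.sub hconst).norm.const_mul _).add (he k ih.1).norm)
        have hm : Measurable (u (k + 1)) := (hr.measurable_u (k + 1)).mono (F.le _) le_rfl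
        have h2 : MemLp (fun θ => u (k + 1) θ - z) 2 μ := by
          refine hb.mono' (hm.sub_const z).aestronglyMeasurable (Eventually.of_forall fun θ => ?_)
          refine (H.norm_resolvent_sub_le (hr.step k θ) (isResolvent_of_mem_viSol hz)).trans ?_
          gcongr
          have : A (u k θ) + e k θ - A z = (A (u k θ) - A z) + e k θ := by abel
          rw [this]
          refine (norm_add_le _ _).trans ?_
          gcongr
          exact H.norm_map_sub_le (hr.mem k θ) hz.1
        have h3 := h2.add hconst
        rwa [show ((fun θ => u (k + 1) θ - z) + fun _ => z) = u (k + 1) by ext; simp] at h3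
      refine ⟨h1, ?_⟩
      have : v (k + 1) = fun θ => (1 - δ) • u (k + 1) θ + δ • v k θ := funext (hr.average k)
      rw [this]
      exact (h1.const_smul _).add (ih.2.const_smul _)
  exact ⟨(key k).1, (key k).2, he k (key k).1⟩

theorem measurable_energy {m : MeasurableSpace Θ} {v u u₀ e₀ : Θ → E} {z : E}
    (hv : Measurable v) (hu : Measurable u) (hu₀ : Measurable u₀) (he₀ : Measurable e₀) :
    Measurable fun θ => energy Q δ z (v θ) (u θ) (u₀ θ) (e₀ θ) := by
  have hQ := Q.continuous.measurable
  exact ((((hQ.comp (hv.sub_const z)).norm.pow_const 2).const_mul _).add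
    (((hQ.comp (hu.sub hu₀)).norm.pow_const 2).const_mul _)).add
    ((he₀.norm.pow_const 2).const_mul _)

/-- The filtration with the first `n` σ-algebras dropped. -/
def shiftFiltration (F : Filtration ℕ m0) (n : ℕ) : Filtration ℕ m0 where
  seq k := F (k + n)
  mono' _ _ hij := F.mono (Nat.add_le_add_right hij n)
  le' k := F.le (k + n)

theorem IsRun.ae_tendsto_of_memLp [IsFiniteMeasure μ] {F : Filtration ℕ m0}
    {u v e : ℕ → Θ → E} (H : StepCondition Q C A δ η ℓ) (hr : IsRun Q C A h δ F u v e)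
    {z : E} {b : ℕ → ℝ} (hb0 : ∀ k, 0 ≤ b k) (hb : Summable b)
    (hz : z ∈ viSol C A h) (hn : IsNoise μ F u e z b) (hu0 : MemLp (u 0) 2 μ)
    (hv0 : MemLp (v 0) 2 μ) :
    ∀ᵐ θ ∂μ, (∃ l, Tendsto (fun k => ‖Q (v k θ - z)‖) atTop (𝓝 l)) ∧
      Tendsto (fun k => ‖Q (u k θ - v k θ)‖) atTop (𝓝 0) ∧
      Tendsto (fun k => ‖Q (u (k + 1) θ - u k θ)‖) atTop (𝓝 0) ∧
      Tendsto (fun k => e k θ) atTop (𝓝 0) := by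
  have hδ := H.delta_pos
  have hδ1 : 0 < 1 - δ := by linarith [H.delta_lt_one]
  have hLp := hr.memLp H hz hn hu0 hv0
  have hconst : MemLp (fun _ : Θ => z) 2 μ := memLp_const z
  -- `V k` contains the error of step `k`, so it is adapted to `F (k + 1)` only. This accounts for
  -- the shift by `n + 1` below.
  set V : ℕ → Θ → ℝ := fun k θ =>
    energy Q δ z (v (k + 1) θ) (u (k + 1) θ) (u k θ) (e k θ) with hV
  set D : ℕ → Θ → ℝ := fun k θ =>
    decrease Q δ (v (k + 1) θ) (u (k + 1) θ) (u (k + 2) θ) with hD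
  have hV0 : ∀ k θ, 0 ≤ V k θ := fun k θ => H.energy_nonneg _ _ _ _ _
  have hD0 : ∀ k θ, 0 ≤ D k θ := fun k θ => H.decrease_nonneg _ _ _
  have hVi : ∀ k, Integrable (V k) μ := fun k =>
    (((integrable_norm_sq (memLp_two_map ((hLp (k + 1)).2.1.sub hconst) Q)).const_mul _).add
      ((integrable_norm_sq (memLp_two_map ((hLp (k + 1)).1.sub (hLp k).1) Q)).const_mul _)).add
      ((integrable_norm_sq (hLp k).2.2).const_mul _)
  have hDi : ∀ k, Integrable (D k) μ := fun k =>
    ((integrable_norm_sq (memLp_two_map ((hLp (k + 1)).1.sub (hLp (k + 1)).2.1) Q)).const_mul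
      _).add ((integrable_norm_sq
        (memLp_two_map ((hLp (k + 2)).1.sub (hLp (k + 1)).1) Q)).const_mul _)
  have hVm : ∀ k, Measurable[F (k + 1)] (V k) := by
    intro k
    have m1 := hr.measurable_v (k + 1)
    have m2 := hr.measurable_u (k + 1)
    have m3 : Measurable[F (k + 1)] (u k) :=
      (hr.measurable_u k).mono (F.mono (Nat.le_succ k)) le_rfl
    exact measurable_energy m1 m2 m3 (hr.measurable_e k)
  have hpath : ∀ k θ, V (k + 1) θ ≤ V k θ - D k θ
      + 2 * inner ℝ (e (k + 1) θ) (z - u (k + 1) θ) + 8 * ‖e (k + 1) θ‖ ^ 2 := fun k θ =>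
    H.energy_le hz (hr.mem k θ) (hr.step k θ) (hr.average k θ) (hr.step (k + 1) θ)
      (hr.average (k + 1) θ)
  have hdist : ∀ k θ, ‖u (k + 1) θ - z‖ ^ 2 ≤ 2 * (D k θ + V k θ) := fun k θ =>
    H.norm_sub_sq_le _ _ _ _ _ _
  have hei : ∀ k, Integrable (fun θ => inner ℝ (e k θ) (z - u k θ)) μ := fun k =>
    integrable_inner_of_memLp (hLp k).2.2 (hconst.sub (hLp k).1)
  have hcondm : ∀ k s, MeasurableSet[F k] s →
      ∫ θ in s, inner ℝ (e k θ) (z - u k θ) ∂μ = 0 := fun k s hs =>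
    hn.mean k s hs (((hLp k).1.sub hconst).restrict s)
  -- The constant in 1 + ‖u - z‖² is absorbed by working with `V + 1`: additive noise becomes a
  -- factor 1 + O(b).
  have hcond2 : ∀ k s, MeasurableSet[F (k + 1)] s → ∫ θ in s, ‖e (k + 1) θ‖ ^ 2 ∂μ
      ≤ b (k + 1) * (2 * ∫ θ in s, D k θ ∂μ + 2 * ∫ θ in s, (V k θ + 1) ∂μ) := by
    intro k s hs
    refine (hn.second (k + 1) s hs (((hLp (k + 1)).1.sub hconst).restrict s)).2.trans ?_
    gcongr
    · exact hb0 _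
    · have i1 : Integrable (fun θ => V k θ + 1) (μ.restrict s) :=
        ((hVi k).add (integrable_const 1)).restrict
      rw [← integral_const_mul, ← integral_const_mul, ← integral_add
        ((hDi k).restrict.const_mul 2) (i1.const_mul 2)]
      refine integral_mono (((integrable_const 1).add
        (integrable_norm_sq ((hLp (k + 1)).1.sub hconst))).restrict)
        (((hDi k).restrict.const_mul 2).add (i1.const_mul 2)) fun θ => ?_
      have := hdist k θ
      simp only
      linarith
  have hstep : ∀ k s, MeasurableSet[F (k + 1)] s →
      ∫ θ in s, (V (k + 1) θ + 1) ∂μ + (1 - 16 * b (k + 1)) * ∫ θ in s, D k θ ∂μ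
        ≤ (1 + 16 * b (k + 1)) * ∫ θ in s, (V k θ + 1) ∂μ := by
    intro k s hs
    have i0 : Integrable (fun θ => V k θ + 1) (μ.restrict s) :=
      ((hVi k).add (integrable_const 1)).restrict
    have i1 : Integrable (D k) (μ.restrict s) := (hDi k).restrict
    have i2 : Integrable (fun θ => inner ℝ (e (k + 1) θ) (z - u (k + 1) θ)) (μ.restrict s) :=
      (hei (k + 1)).restrict
    have i3 : Integrable (fun θ => ‖e (k + 1) θ‖ ^ 2) (μ.restrict s) :=
      (integrable_norm_sq (hLp (k + 1)).2.2).restrict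
    have h1 : ∫ θ in s, (V (k + 1) θ + 1) ∂μ ≤ ∫ θ in s, (((V k θ + 1) - D k θ)
        + (2 * inner ℝ (e (k + 1) θ) (z - u (k + 1) θ) + 8 * ‖e (k + 1) θ‖ ^ 2)) ∂μ := by
      refine integral_mono ((hVi (k + 1)).add (integrable_const 1)).restrict
        ((i0.sub i1).add ((i2.const_mul 2).add (i3.const_mul 8))) fun θ => ?_
      have := hpath k θ
      simp only
      linarith
    rw [integral_add (f := fun θ => V k θ + 1 - D k θ)
        (g := fun θ => 2 * inner ℝ (e (k + 1) θ) (z - u (k + 1) θ) + 8 * ‖e (k + 1) θ‖ ^ 2)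
        (i0.sub i1) ((i2.const_mul 2).add (i3.const_mul 8)), integral_sub i0 i1,
      integral_add (i2.const_mul 2) (i3.const_mul 8), integral_const_mul, integral_const_mul,
      hcondm (k + 1) s hs] at h1
    have h2 := hcond2 k s hs
    linarith
  -- From `n` on, 16 b ≤ 1/2, so half of the decrease survives the share of the noise charged to it.
  obtain ⟨n, hn2⟩ : ∃ n, ∀ k ≥ n, b k ≤ 1 / 32 :=
    eventually_atTop.1 (hb.tendsto_atTop_zero.eventually_le_const (by norm_num))
  obtain ⟨r1, r2, M, r3⟩ := robbins_siegmund (μ := μ) (F := shiftFiltration F (n + 1))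
    (Y := fun k θ => V (k + n) θ + 1) (D := fun k θ => 1 / 2 * D (k + n) θ)
    (β := fun k => 16 * b (k + n + 1))
    (fun k => (hVm (k + n)).add_const 1)
    (fun k => (hVi (k + n)).add (integrable_const 1))
    (fun k θ => by linarith [hV0 (k + n) θ])
    (fun k => (hDi (k + n)).const_mul _)
    (fun k θ => by linarith [hD0 (k + n) θ])
    (fun k => by linarith [hb0 (k + n + 1)])
    (((summable_nat_add_iff (n + 1)).2 hb).mul_left 16)
    (fun k s hs => by
      have h1 := hstep (k + n) s hs
      have h2 : 0 ≤ ∫ θ in s, D (k + n) θ ∂μ := integral_nonneg (hD0 _)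
      have h3 := hn2 (k + n + 1) (by lia)
      have h4 : k + 1 + n = k + n + 1 := by lia
      rw [integral_const_mul, h4]
      nlinarith)
  -- `M` bounds the integrals of V + 1 and of D/2, so `hcond2` bounds the second moments by b (4M +
  -- 2M), a summable sequence.
  have r4 : ∀ᵐ θ ∂μ, Tendsto (fun k => ‖e (k + n + 1) θ‖ ^ 2) atTop (𝓝 0) := by
    refine ae_tendsto_zero_of_summable_integral
      (fun k => integrable_norm_sq (hLp _).2.2) (fun k θ => sq_nonneg _) ?_
    refine Summable.of_nonneg_of_le (fun k => integral_nonneg fun θ => sq_nonneg _) (fun k => ?_)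
      (((summable_nat_add_iff (n + 1)).2 hb).mul_right (6 * M))
    have h1 := hcond2 (k + n) Set.univ MeasurableSet.univ
    simp only [Measure.restrict_univ] at h1
    refine h1.trans (mul_le_mul_of_nonneg_left ?_ (hb0 _))
    have h2 := r3 k
    rw [integral_const_mul] at h2
    linarith
  filter_upwards [r1, r2, r4] with θ h1 h2 h4
  have e1 : Tendsto (fun k => e k θ) atTop (𝓝 0) := by
    rw [← tendsto_add_atTop_iff_nat (n + 1), tendsto_zero_iff_norm_tendsto_zero]
    have := h4.sqrt
    simpa [Real.sqrt_sq (norm_nonneg _), add_assoc] using this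
  have d1 : Tendsto (fun k => D k θ) atTop (𝓝 0) := by
    rw [← tendsto_add_atTop_iff_nat n]
    simpa using h2.const_mul 2
  have hsq : ∀ {f : ℕ → E} {c : ℝ}, 0 < c → (∀ k, c * ‖f k‖ ^ 2 ≤ D k θ) →
      Tendsto (fun k => ‖f k‖) atTop (𝓝 0) := by
    intro f c hc hf
    have h3 : Tendsto (fun k => ‖f k‖ ^ 2) atTop (𝓝 0) := by
      refine squeeze_zero (fun k => sq_nonneg _) (fun k => ?_)
        (by simpa using d1.const_mul c⁻¹ : Tendsto (fun k => c⁻¹ * D k θ) atTop (𝓝 0))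
      rw [inv_mul_eq_div, le_div_iff₀ hc]
      linarith [hf k]
    simpa [Real.sqrt_sq (norm_nonneg _)] using h3.sqrt
  have d2 : Tendsto (fun k => ‖Q (u (k + 1) θ - v (k + 1) θ)‖) atTop (𝓝 0) :=
    hsq (one_div_pos.2 hδ) fun k => by
      simp only [hD, decrease]
      have : 0 ≤ 1 / (4 * δ) * ‖Q (u (k + 2) θ - u (k + 1) θ)‖ ^ 2 := by positivity
      linarith
  have d3 : Tendsto (fun k => ‖Q (u (k + 2) θ - u (k + 1) θ)‖) atTop (𝓝 0) :=
    hsq (show 0 < 1 / (4 * δ) by positivity) fun k => by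
      simp only [hD, decrease]
      have : 0 ≤ 1 / δ * ‖Q (u (k + 1) θ - v (k + 1) θ)‖ ^ 2 := by positivity
      linarith
  have d4 : Tendsto (fun k => ‖Q (u (k + 1) θ - u k θ)‖) atTop (𝓝 0) :=
    (tendsto_add_atTop_iff_nat 1).1 d3
  refine ⟨?_, (tendsto_add_atTop_iff_nat 1).1 d2, d4, e1⟩
  obtain ⟨l, hl⟩ := h1
  have hl' : Tendsto (fun k => V k θ) atTop (𝓝 (l - 1)) := by
    rw [← tendsto_add_atTop_iff_nat n]
    simpa using hl.sub_const 1
  -- The energy is solved for its first term. The other two terms vanish in the limit.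
  have f1 : Tendsto (fun k => ‖Q (v (k + 1) θ - z)‖ ^ 2) atTop
      (𝓝 ((1 - δ) * ((l - 1) - 1 / (4 * δ) * 0 ^ 2 - 4 * ‖(0 : E)‖ ^ 2))) := by
    refine (((hl'.sub ((d4.pow 2).const_mul (1 / (4 * δ)))).sub
      ((e1.norm.pow 2).const_mul 4)).const_mul (1 - δ)).congr fun k => ?_
    simp only [hV, energy]
    field_simp
    ring
  refine ⟨_, (tendsto_add_atTop_iff_nat 1).1 (f1.sqrt.congr fun k => ?_)⟩
  exact Real.sqrt_sq (norm_nonneg _)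

/-- Almost sure convergence of the stochastic golden ratio iteration. -/
theorem IsRun.ae_exists_tendsto [IsFiniteMeasure μ] {F : Filtration ℕ m0}
    {u v e : ℕ → Θ → E} (H : StepCondition Q C A δ η ℓ) (hC : IsClosed C)
    (hh : LowerSemicontinuousOn h C) (hr : IsRun Q C A h δ F u v e)
    (hne : (viSol C A h).Nonempty)
    (hn : ∀ z ∈ viSol C A h, ∃ b : ℕ → ℝ, (∀ k, 0 ≤ b k) ∧ Summable b ∧ IsNoise μ F u e z b) :
    ∀ᵐ θ ∂μ, ∃ z ∈ viSol C A h, Tendsto (fun k => u k θ) atTop (𝓝 z) := by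
  -- The exceptional null set depends on the solution, so only countably many solutions may be used.
  obtain ⟨D, hDZ, hDc, hZD⟩ :=
    (TopologicalSpace.IsSeparable.of_separableSpace (viSol C A h)).exists_countable_dense_subset
  have hDne : D.Nonempty := closure_nonempty_iff.1 (hne.mono hZD)
  have hmu0 := hr.measurable_u 0
  have hmv0 := hr.measurable_v 0
  -- On these events of `F 0` the initial data are bounded, hence square integrable. They exhaust
  -- `Θ` as `R` grows.
  let T : ℕ → Set Θ := fun R => {θ | ‖u 0 θ‖ ≤ R ∧ ‖v 0 θ‖ ≤ R}
  have hT : ∀ R, MeasurableSet[F 0] (T R) := fun R =>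
    (hmu0 (measurableSet_le measurable_norm measurable_const)).inter
      (hmv0 (measurableSet_le measurable_norm measurable_const))
  have key : ∀ R, ∀ᵐ θ ∂μ.restrict (T R), ∃ z ∈ viSol C A h,
      Tendsto (fun k => u k θ) atTop (𝓝 z) := by
    intro R
    have hT' : MeasurableSet (T R) := F.le 0 _ (hT R)
    have hu0 : MemLp (u 0) 2 (μ.restrict (T R)) :=
      MemLp.of_bound (hmu0.mono (F.le 0) le_rfl).aestronglyMeasurable R
        ((ae_restrict_mem hT').mono fun θ hθ => hθ.1)
    have hv0 : MemLp (v 0) 2 (μ.restrict (T R)) :=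
      MemLp.of_bound (hmv0.mono (F.le 0) le_rfl).aestronglyMeasurable R
        ((ae_restrict_mem hT').mono fun θ hθ => hθ.2)
    have h1 : ∀ z ∈ D, ∀ᵐ θ ∂μ.restrict (T R),
        (∃ l, Tendsto (fun k => ‖Q (v k θ - z)‖) atTop (𝓝 l)) ∧
        Tendsto (fun k => ‖Q (u k θ - v k θ)‖) atTop (𝓝 0) ∧
        Tendsto (fun k => ‖Q (u (k + 1) θ - u k θ)‖) atTop (𝓝 0) ∧
        Tendsto (fun k => e k θ) atTop (𝓝 0) := by
      intro z hz
      obtain ⟨b, hb0, hb, hnz⟩ := hn z (hDZ hz)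
      exact hr.ae_tendsto_of_memLp H hb0 hb (hDZ hz) (hnz.restrict (hT R)) hu0 hv0
    filter_upwards [(ae_ball_iff hDc).2 h1] with θ hθ
    obtain ⟨z₀, hz₀⟩ := hDne
    obtain ⟨-, g1, g2, g3⟩ := hθ z₀ hz₀
    exact H.exists_tendsto hC hh (fun k => hr.mem k θ) (fun k => hr.step k θ) ⟨z₀, hz₀⟩ hZD
      (fun z hz => (hθ z hz).1) g1 g2 g3
  have hall := ae_all_iff.2 fun R => (ae_restrict_iff' (F.le 0 _ (hT R))).1 (key R)
  filter_upwards [hall] with θ hθ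
  obtain ⟨R, hR⟩ := exists_nat_ge (max ‖u 0 θ‖ ‖v 0 θ‖)
  exact hθ R ⟨(le_max_left _ _).trans hR, (le_max_right _ _).trans hR⟩

end Abstract

/-- The gradient inequality of a convex function. -/
theorem add_fderiv_le_of_convexOn {E : Type*} [NormedAddCommGroup E] [NormedSpace ℝ E] {s : Set E}
    {f : E → ℝ} (hf : ConvexOn ℝ s f) {y y' : E} (hy : y ∈ s) (hy' : y' ∈ s) {f' : E →L[ℝ] ℝ}
    (hd : HasFDerivAt f f' y) : f y + f' (y' - y) ≤ f y' := by
  have hl : HasDerivAt (fun t : ℝ => f (y + t • (y' - y))) (f' (y' - y)) 0 := by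
    have h1 : HasDerivAt (fun t : ℝ => y + t • (y' - y)) (y' - y) 0 := by
      simpa using ((hasDerivAt_id (0 : ℝ)).smul_const (y' - y)).const_add y
    have h2 : HasFDerivAt f f' (y + (0 : ℝ) • (y' - y)) := by simpa using hd
    exact h2.comp_hasDerivAt 0 h1
  have ht := hl.tendsto_slope_zero_right
  have hle : f' (y' - y) ≤ f y' - f y := by
    refine le_of_tendsto ht ?_
    filter_upwards [Ioc_mem_nhdsGT (show (0 : ℝ) < 1 by norm_num)] with t ht
    have h3 := hf.2 hy hy' (show 0 ≤ 1 - t by linarith [ht.2]) ht.1.le (by ring)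
    have h4 : (1 - t) • y + t • y' = y + t • (y' - y) := by module
    rw [h4] at h3
    simp only [smul_eq_mul, zero_add, zero_smul, add_zero] at h3 ⊢
    rw [inv_mul_le_iff₀ ht.1]
    linarith
  linarith

/-! ### Block structure of the states and the metric of Φ. -/

section State

variable {N m : ℕ} {n : Fin N → ℕ}

theorem State.ext {a b : State n m} (hx : a.x = b.x) (hz : a.z = b.z) (hl : a.lam = b.lam) :
    a = b := by
  have : ∀ c : State n m, c = State.mk c.x c.z c.lam := fun _ => rfl
  rw [this a, this b, hx, hz, hl]

theorem State.inner_eq (a b : State n m) :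
    inner ℝ a b = ∑ i, inner ℝ (a.x i) (b.x i) + ∑ i, inner ℝ (a.z i) (b.z i)
      + ∑ i, inner ℝ (a.lam i) (b.lam i) := by
  rw [WithLp.prod_inner_apply, WithLp.prod_inner_apply, add_assoc]
  rfl

@[simp] theorem State.x_sub (a b : State n m) (i : Fin N) : (a - b).x i = a.x i - b.x i := rfl
@[simp] theorem State.z_sub (a b : State n m) (i : Fin N) : (a - b).z i = a.z i - b.z i := rfl
@[simp] theorem State.lam_sub (a b : State n m) (i : Fin N) :
    (a - b).lam i = a.lam i - b.lam i := rfl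
@[simp] theorem State.x_add (a b : State n m) (i : Fin N) : (a + b).x i = a.x i + b.x i := rfl
@[simp] theorem State.z_add (a b : State n m) (i : Fin N) : (a + b).z i = a.z i + b.z i := rfl
@[simp] theorem State.lam_add (a b : State n m) (i : Fin N) :
    (a + b).lam i = a.lam i + b.lam i := rfl
@[simp] theorem State.x_mk (x : Profile n) (z l : Dual N m) : (State.mk x z l).x = x := rfl
@[simp] theorem State.z_mk (x : Profile n) (z l : Dual N m) : (State.mk x z l).z = z := rfl
@[simp] theorem State.lam_mk (x : Profile n) (z l : Dual N m) : (State.mk x z l).lam = l := rfl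

theorem State.continuous_x : Continuous (State.x : State n m → Profile n) :=
  (WithLp.prod_continuous_ofLp 2 _ _).fst

theorem State.continuous_lam : Continuous (State.lam : State n m → Dual N m) :=
  (WithLp.prod_continuous_ofLp 2 _ _).comp (WithLp.prod_continuous_ofLp 2 _ _).snd |>.snd

@[simp] theorem Steps.phiInv_x (st : Steps N) (a : State n m) (i : Fin N) :
    (st.phiInv n m a).x i = st.α i • a.x i := rfl
@[simp] theorem Steps.phiInv_z (st : Steps N) (a : State n m) (i : Fin N) :
    (st.phiInv n m a).z i = st.ν i • a.z i := rfl
@[simp] theorem Steps.phiInv_lam (st : Steps N) (a : State n m) (i : Fin N) :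
    (st.phiInv n m a).lam i = st.τ i • a.lam i := rfl

/-- The step sizes whose diagonal operator is `Φ^{1/2}`. -/
noncomputable def Steps.invSqrt (st : Steps N) : Steps N where
  α i := (√(st.α i))⁻¹
  ν i := (√(st.ν i))⁻¹
  τ i := (√(st.τ i))⁻¹

theorem inv_sqrt_mul_self {a : ℝ} (ha : 0 < a) : (√a)⁻¹ * (√a)⁻¹ = a⁻¹ := by
  rw [← mul_inv, Real.mul_self_sqrt ha.le]

theorem Steps.Positive.inner_invSqrt {st : Steps N} (hst : st.Positive) (a b : State n m) :
    inner ℝ (st.invSqrt.phiInv n m a) (st.invSqrt.phiInv n m b)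
      = ∑ i, (st.α i)⁻¹ * inner ℝ (a.x i) (b.x i) + ∑ i, (st.ν i)⁻¹ * inner ℝ (a.z i) (b.z i)
        + ∑ i, (st.τ i)⁻¹ * inner ℝ (a.lam i) (b.lam i) := by
  rw [State.inner_eq]
  congr 1
  · congr 1
    · refine Finset.sum_congr rfl fun i _ => ?_
      rw [Steps.phiInv_x, Steps.phiInv_x, inner_smul_left, inner_smul_right, conj_trivial,
        ← mul_assoc, Steps.invSqrt, inv_sqrt_mul_self (hst.α i)]
    · refine Finset.sum_congr rfl fun i _ => ?_
      rw [Steps.phiInv_z, Steps.phiInv_z, inner_smul_left, inner_smul_right, conj_trivial,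
        ← mul_assoc, Steps.invSqrt, inv_sqrt_mul_self (hst.ν i)]
  · refine Finset.sum_congr rfl fun i _ => ?_
    rw [Steps.phiInv_lam, Steps.phiInv_lam, inner_smul_left, inner_smul_right, conj_trivial,
      ← mul_assoc, Steps.invSqrt, inv_sqrt_mul_self (hst.τ i)]

theorem mul_inv_sqrt_mul_inv_sqrt {a : ℝ} (ha : 0 < a) (c : ℝ) :
    a * ((√a)⁻¹ * ((√a)⁻¹ * c)) = c := by
  rw [← mul_assoc (√a)⁻¹, inv_sqrt_mul_self ha, mul_inv_cancel_left₀ ha.ne']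

/-- With b the image of a under the square root of Φ, ‖a‖² is the inner product of Φ⁻¹ b with b. -/
theorem Steps.Positive.norm_sq_le {st : Steps N} (hst : st.Positive) (a : State n m) :
    ‖a‖ ^ 2 ≤ ‖st.phiInv n m‖ * ‖st.invSqrt.phiInv n m a‖ ^ 2 := by
  set b := st.invSqrt.phiInv n m a with hb
  have h1 : ‖a‖ ^ 2 = inner ℝ (st.phiInv n m b) b := by
    rw [← real_inner_self_eq_norm_sq, State.inner_eq, State.inner_eq]
    congr 1
    · congr 1
      · refine Finset.sum_congr rfl fun i _ => ?_
        rw [Steps.phiInv_x, hb, Steps.phiInv_x, inner_smul_left, inner_smul_left,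
          inner_smul_right, conj_trivial, conj_trivial, Steps.invSqrt,
          mul_inv_sqrt_mul_inv_sqrt (hst.α i)]
      · refine Finset.sum_congr rfl fun i _ => ?_
        rw [Steps.phiInv_z, hb, Steps.phiInv_z, inner_smul_left, inner_smul_left,
          inner_smul_right, conj_trivial, conj_trivial, Steps.invSqrt,
          mul_inv_sqrt_mul_inv_sqrt (hst.ν i)]
    · refine Finset.sum_congr rfl fun i _ => ?_
      rw [Steps.phiInv_lam, hb, Steps.phiInv_lam, inner_smul_left, inner_smul_left,
        inner_smul_right, conj_trivial, conj_trivial, Steps.invSqrt,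
        mul_inv_sqrt_mul_inv_sqrt (hst.τ i)]
  rw [h1, sq, ← mul_assoc]
  refine (real_inner_le_norm _ _).trans ?_
  gcongr
  exact ContinuousLinearMap.le_opNorm _ _

end State

/-! ### The graph Laplacian. -/

section Laplacian

variable {N m : ℕ} {W : Fin N → Fin N → ℝ}

/-- Averaging the sum with its copy under i ↔ j gives the Dirichlet form. It displays symmetry,
positivity and the kernel at once. -/
theorem inner_laplacian (hW : ∀ i j, W i j = W j i) (v w : Dual N m) :
    ∑ i, inner ℝ (laplacian W v i) (w i)
      = ∑ i, ∑ j, W i j * inner ℝ (v i - v j) (w i - w j) / 2 := by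
  have h1 : ∑ i, inner ℝ (laplacian W v i) (w i)
      = ∑ i, ∑ j, W i j * inner ℝ (v i - v j) (w i) := by
    refine Finset.sum_congr rfl fun i _ => ?_
    simp only [laplacian, sum_inner, inner_smul_left, conj_trivial]
  have h2 : ∑ i, ∑ j, W i j * inner ℝ (v i - v j) (w i)
      = ∑ i, ∑ j, - (W i j * inner ℝ (v i - v j) (w j)) := by
    rw [Finset.sum_comm]
    refine Finset.sum_congr rfl fun i _ => Finset.sum_congr rfl fun j _ => ?_
    rw [hW j i, ← neg_sub (v i) (v j), inner_neg_left, mul_neg]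
  rw [h1]
  have h3 : ∀ a b : ℝ, a = b → a = (a + b) / 2 := fun a b h => by rw [h]; ring
  rw [h3 _ _ h2, ← Finset.sum_add_distrib, Finset.sum_div]
  refine Finset.sum_congr rfl fun i _ => ?_
  rw [← Finset.sum_add_distrib, Finset.sum_div]
  refine Finset.sum_congr rfl fun j _ => ?_
  rw [inner_sub_right]; ring

theorem inner_laplacian_comm (hW : ∀ i j, W i j = W j i) (v w : Dual N m) :
    ∑ i, inner ℝ (laplacian W v i) (w i) = ∑ i, inner ℝ (laplacian W w i) (v i) := by
  rw [inner_laplacian hW, inner_laplacian hW]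
  simp only [real_inner_comm]

/-- The Laplacian as a linear map. -/
noncomputable def laplacianLM (W : Fin N → Fin N → ℝ) : Dual N m →ₗ[ℝ] Dual N m where
  toFun := laplacian W
  map_add' v w := by
    ext1 i
    simp only [laplacian, PiLp.add_apply]
    rw [← Finset.sum_add_distrib]
    refine Finset.sum_congr rfl fun j _ => ?_
    rw [← smul_add]; congr 1; abel
  map_smul' c v := by
    ext1 i
    simp only [laplacian, PiLp.smul_apply, RingHom.id_apply, Finset.smul_sum]
    refine Finset.sum_congr rfl fun j _ => ?_
    rw [← smul_sub, smul_comm]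

theorem laplacianLM_apply (v : Dual N m) : laplacianLM W v = laplacian W v := rfl

theorem laplacian_sub (v w : Dual N m) : laplacian W (v - w) = laplacian W v - laplacian W w :=
  (laplacianLM W).map_sub v w

theorem sum_laplacian (hW : ∀ i j, W i j = W j i) (v : Dual N m) :
    ∑ i, laplacian W v i = 0 := by
  have h : ∑ i, ∑ j, W i j • (v i - v j) = - ∑ i, ∑ j, W i j • (v i - v j) := by
    conv_lhs => rw [Finset.sum_comm]
    simp only [← Finset.sum_neg_distrib]
    refine Finset.sum_congr rfl fun i _ => Finset.sum_congr rfl fun j _ => ?_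
    rw [hW j i, ← smul_neg, neg_sub]
  have h2 : (2 : ℝ) • ∑ i, ∑ j, W i j • (v i - v j) = 0 := by
    rw [two_smul]; exact add_eq_zero_iff_eq_neg.2 h
  exact (smul_eq_zero.1 h2).resolve_left two_ne_zero

theorem IsWeightMatrix.nonneg {A : SimpleGraph (Fin N)} (hW : IsWeightMatrix A W) (i j : Fin N) :
    0 ≤ W i j := by
  by_cases h : A.Adj i j
  · exact (hW.pos i j h).le
  · exact (hW.zero i j h).ge

theorem IsWeightMatrix.inner_laplacian_self_nonneg {A : SimpleGraph (Fin N)}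
    (hW : IsWeightMatrix A W) (v : Dual N m) : 0 ≤ ∑ i, inner ℝ (laplacian W v i) (v i) := by
  rw [inner_laplacian hW.symm]
  refine Finset.sum_nonneg fun i _ => Finset.sum_nonneg fun j _ => ?_
  have := mul_nonneg (hW.nonneg i j) (real_inner_self_nonneg (x := v i - v j))
  linarith

/-- The kernel of the Laplacian of a connected graph consists of the consensus vectors. -/
theorem IsWeightMatrix.eq_of_laplacian_eq_zero {A : SimpleGraph (Fin N)} (hA : A.Connected)
    (hW : IsWeightMatrix A W) {v : Dual N m} (hv : laplacian W v = 0) (i j : Fin N) :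
    v i = v j := by
  have h1 : ∑ i, ∑ j, W i j * inner ℝ (v i - v j) (v i - v j) / 2 = 0 := by
    rw [← inner_laplacian hW.symm, hv]; simp
  have h2 : ∀ i j, 0 ≤ W i j * inner ℝ (v i - v j) (v i - v j) / 2 := fun i j => by
    have := mul_nonneg (hW.nonneg i j) (real_inner_self_nonneg (x := v i - v j))
    linarith
  have h3 : ∀ i j, A.Adj i j → v i = v j := by
    intro i j hij
    have h4 := (Finset.sum_eq_zero_iff_of_nonneg fun i _ =>
      Finset.sum_nonneg fun j _ => h2 i j).1 h1 i (Finset.mem_univ i)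
    have h5 := (Finset.sum_eq_zero_iff_of_nonneg fun j _ => h2 i j).1 h4 j (Finset.mem_univ j)
    have h6 : inner ℝ (v i - v j) (v i - v j) = (0 : ℝ) := by
      rcases mul_eq_zero.1 (by linarith : W i j * inner ℝ (v i - v j) (v i - v j) = 0) with h | h
      · exact absurd h (hW.pos i j hij).ne'
      · exact h
    exact sub_eq_zero.1 (inner_self_eq_zero.1 h6)
  obtain ⟨p⟩ := hA.preconnected i j
  induction p with
  | nil => rfl
  | cons hadj _ ih => exact (h3 _ _ hadj).trans ih

/-- Vectors of zero sum are in the range of the Laplacian of a connected graph. -/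
theorem IsWeightMatrix.exists_laplacian_eq {A : SimpleGraph (Fin N)} (hA : A.Connected)
    (hW : IsWeightMatrix A W) {r : Dual N m} (hr : ∑ i, r i = 0) : ∃ z, laplacian W z = r := by
  have hsymm : (laplacianLM (m := m) W).IsSymmetric := fun v w => by
    rw [PiLp.inner_apply, PiLp.inner_apply]
    simp only [laplacianLM_apply]
    rw [inner_laplacian_comm hW.symm]
    simp only [real_inner_comm]
  -- The range of a symmetric map is the orthogonal complement of its kernel. The kernel consists of
  -- consensus vectors, and `hr` is orthogonality to those.
  have hmem : r ∈ (LinearMap.range (laplacianLM (m := m) W))ᗮᗮ := by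
    rw [hsymm.orthogonal_range, Submodule.mem_orthogonal]
    intro v hv
    have hv' : laplacian W v = 0 := hv
    obtain ⟨i₀⟩ := hA.nonempty
    rw [PiLp.inner_apply]
    have : ∀ i, inner ℝ (v i) (r i) = inner ℝ (v i₀) (r i) := fun i => by
      rw [hW.eq_of_laplacian_eq_zero hA hv' i i₀]
    simp only [this]
    rw [← inner_sum, hr, inner_zero_right]
  rw [Submodule.orthogonal_orthogonal] at hmem
  exact hmem

end Laplacian

theorem lipschitzOnWith_of_lipschitzConst_ne_top {X Y : Type*} [MetricSpace X]
    [MetricSpace Y] {F : X → Y} {s : Set X} (h : lipschitzConst F s ≠ ⊤) :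
    LipschitzOnWith (lipschitzConst F s).toNNReal F s := by
  intro a ha b hb
  rw [ENNReal.coe_toNNReal h]
  rcases eq_or_ne a b with rfl | hab
  · simp
  · have h0 : edist a b ≠ 0 := by simpa using hab
    have h1 : edist (F a) (F b) / edist a b ≤ lipschitzConst F s :=
      le_iSup₂_of_le a ha (le_iSup₂_of_le b hb le_rfl)
    exact (ENNReal.div_le_iff h0 (edist_ne_top a b)).1 h1

/-! ### Regularity of the data and monotonicity of the extended operator. -/

namespace Game

variable {N m d : ℕ} {n : Fin N → ℕ} {G : Game N m d n}

/-- The sum of the nonsmooth costs on the state space. -/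
noncomputable def nonsmooth (G : Game N m d n) (ω : State n m) : ℝ :=
  ∑ i, (G.f i (ω.x i)).toReal

theorem NonsmoothCostAssumption.coe_toReal (hf : G.NonsmoothCostAssumption) {i : Fin N}
    {y : EuclideanSpace ℝ (Fin (n i))} (hy : y ∈ G.Ω i) :
    ((G.f i y).toReal : EReal) = G.f i y := by
  rw [← hf.dom i] at hy
  exact EReal.coe_toReal (ne_of_lt hy) (hf.ne_bot i y)

theorem NonsmoothCostAssumption.convexOn (hf : G.NonsmoothCostAssumption)
    (hc : G.ConstraintQualification) (i : Fin N) :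
    ConvexOn ℝ (G.Ω i) fun y => (G.f i y).toReal := by
  refine ⟨hc.convex i, fun y hy y' hy' a b ha hb hab => ?_⟩
  have h1 := hf.convex i (show (y, (G.f i y).toReal) ∈ _ from (hf.coe_toReal hy).ge)
    (show (y', (G.f i y').toReal) ∈ _ from (hf.coe_toReal hy').ge) ha hb hab
  have h2 : G.f i (a • y + b • y') ≤
      ((a • (G.f i y).toReal + b • (G.f i y').toReal : ℝ) : EReal) := h1
  rw [← hf.coe_toReal (hc.convex i hy hy' ha hb hab)] at h2
  exact EReal.coe_le_coe_iff.1 h2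

theorem NonsmoothCostAssumption.lowerSemicontinuousOn (hf : G.NonsmoothCostAssumption)
    (i : Fin N) : LowerSemicontinuousOn (fun y => (G.f i y).toReal) (G.Ω i) := by
  intro y hy c hc
  have h1 : (c : EReal) < G.f i y := by
    rw [← hf.coe_toReal hy]; exact EReal.coe_lt_coe_iff.2 hc
  filter_upwards [nhdsWithin_le_nhds (hf.lsc i y _ h1), self_mem_nhdsWithin] with y' h2 h3
  rw [← hf.coe_toReal h3] at h2
  exact EReal.coe_lt_coe_iff.1 h2

theorem continuous_block (i : Fin N) : Continuous fun ω : State n m => ω.x i :=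
  (PiLp.continuous_apply 2 _ i).comp State.continuous_x

theorem continuous_lam_block (i : Fin N) : Continuous fun ω : State n m => ω.lam i :=
  (PiLp.continuous_apply 2 _ i).comp State.continuous_lam

theorem ConstraintQualification.isClosed_localSet (hc : G.ConstraintQualification) :
    IsClosed G.localSet := by
  have : G.localSet = ⋂ i, (fun x : Profile n => x i) ⁻¹' G.Ω i := by
    ext x; simp [localSet]
  rw [this]
  exact isClosed_iInter fun i => (hc.closed i).preimage (PiLp.continuous_apply 2 _ i)

theorem isClosed_orthant : IsClosed (orthant m) := by
  have : orthant m = ⋂ j, (fun v : EuclideanSpace ℝ (Fin m) => v j) ⁻¹' Set.Ici 0 := by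
    ext v; simp [orthant]
  rw [this]
  exact isClosed_iInter fun j => isClosed_Ici.preimage (PiLp.continuous_apply 2 _ j)

theorem ConstraintQualification.isClosed_stateDomain (hc : G.ConstraintQualification) :
    IsClosed G.stateDomain := by
  have : G.stateDomain = State.x ⁻¹' G.localSet ∩
      ⋂ i, (fun ω : State n m => ω.lam i) ⁻¹' orthant m := by
    ext ω; simp [stateDomain]
  rw [this]
  exact (hc.isClosed_localSet.preimage State.continuous_x).inter
    (isClosed_iInter fun i => isClosed_orthant.preimage (continuous_lam_block i))

theorem NonsmoothCostAssumption.lowerSemicontinuousOn_nonsmooth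
    (hf : G.NonsmoothCostAssumption) : LowerSemicontinuousOn G.nonsmooth G.stateDomain := by
  refine lowerSemicontinuousOn_sum fun i _ ω hω => ?_
  have h1 : Tendsto (fun ω : State n m => ω.x i) (𝓝[G.stateDomain] ω) (𝓝[G.Ω i] (ω.x i)) :=
    (continuous_block i).continuousAt.continuousWithinAt.tendsto_nhdsWithin
      fun ω' hω' => hω'.1 i
  intro c hc
  exact h1.eventually (hf.lowerSemicontinuousOn i _ (hω.1 i) c hc)

theorem convex_orthant : Convex ℝ (orthant m) := by
  intro v hv w hw a b ha hb _ j
  simp only [PiLp.add_apply, PiLp.smul_apply, smul_eq_mul]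
  have := mul_nonneg ha (hv j)
  have := mul_nonneg hb (hw j)
  linarith

theorem inner_le_inner_of_mem_orthant {v a b : EuclideanSpace ℝ (Fin m)} (hv : v ∈ orthant m)
    (hab : ∀ j, a j ≤ b j) : inner ℝ v a ≤ inner ℝ v b := by
  simp only [PiLp.inner_apply, RCLike.inner_apply, conj_trivial]
  exact Finset.sum_le_sum fun j _ => mul_le_mul_of_nonneg_right (hab j) (hv j)

theorem inner_jacT (G : Game N m d n) (i : Fin N) (y w : EuclideanSpace ℝ (Fin (n i)))
    (v : EuclideanSpace ℝ (Fin m)) :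
    inner ℝ (G.jacT i y v) w = inner ℝ v (fderiv ℝ (G.g i) y w) :=
  ContinuousLinearMap.adjoint_inner_left _ _ _

theorem CouplingAssumption.inner_jacT_le (hg : G.CouplingAssumption) {i : Fin N}
    {y y' : EuclideanSpace ℝ (Fin (n i))} {v : EuclideanSpace ℝ (Fin m)} (hv : v ∈ orthant m) :
    inner ℝ (G.jacT i y v) (y' - y) ≤ inner ℝ v (G.g i y' - G.g i y) := by
  rw [inner_jacT]
  refine inner_le_inner_of_mem_orthant hv fun j => ?_
  have hd : HasFDerivAt (fun y => G.g i y j)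
      ((EuclideanSpace.proj j).comp (fderiv ℝ (G.g i) y)) y :=
    (EuclideanSpace.proj (𝕜 := ℝ) j).hasFDerivAt.comp y (hg.differentiable i y).hasFDerivAt
  have h : G.g i y j + fderiv ℝ (G.g i) y (y' - y) j ≤ G.g i y' j :=
    add_fderiv_le_of_convexOn (hg.convex i j) (Set.mem_univ y) (Set.mem_univ y') hd
  rw [PiLp.sub_apply]
  linarith

/-- The extended operator is monotone. -/
theorem extOp_monotone (hg : G.CouplingAssumption) (hmono : G.MonotoneLipschitz)
    {A : SimpleGraph (Fin N)} {W : Fin N → Fin N → ℝ} (hW : IsWeightMatrix A W)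
    {a b : State n m} (ha : a ∈ G.stateDomain) (hb : b ∈ G.stateDomain) :
    0 ≤ inner ℝ (G.extOp W a - G.extOp W b) (a - b) := by
  have h1 := hmono.monotone a.x ha.1 b.x hb.1
  rw [PiLp.inner_apply] at h1
  -- The gradient inequality of g_i, used from both points and weighted with the nonnegative
  -- multipliers.
  have h2 : ∀ i, inner ℝ (G.g i (a.x i) - G.g i (b.x i)) (a.lam i - b.lam i)
      ≤ inner ℝ (G.jacT i (a.x i) (a.lam i) - G.jacT i (b.x i) (b.lam i)) (a.x i - b.x i) := by
    intro i
    have e1 := hg.inner_jacT_le (y := a.x i) (y' := b.x i) (ha.2 i)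
    have e2 := hg.inner_jacT_le (y := b.x i) (y' := a.x i) (hb.2 i)
    rw [← neg_sub (a.x i), ← neg_sub (G.g i (a.x i)), inner_neg_right, inner_neg_right] at e1
    rw [real_inner_comm, inner_sub_left, inner_sub_left]
    linarith
  -- The Laplacian acts on the multipliers as a positive semidefinite map. The coupling of z and lam
  -- is skew and cancels by symmetry.
  have h3 := hW.inner_laplacian_self_nonneg (a.lam - b.lam)
  have h4 := inner_laplacian_comm hW.symm (a.lam - b.lam) (a.z - b.z)
  have h5 := Finset.sum_le_sum fun i (_ : i ∈ Finset.univ) => h2 i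
  rw [State.inner_eq]
  simp only [extOp, State.x_sub, State.z_sub, State.lam_sub, State.x_mk, State.z_mk,
    State.lam_mk]
  rw [laplacian_sub, laplacian_sub] at h4
  rw [laplacian_sub] at h3
  simp only [PiLp.sub_apply, inner_sub_left, inner_sub_right, inner_add_left,
    Finset.sum_add_distrib, Finset.sum_sub_distrib] at h1 h3 h4 h5 ⊢
  linarith

theorem stepCondition (hg : G.CouplingAssumption) (hmono : G.MonotoneLipschitz)
    {A : SimpleGraph (Fin N)} {W : Fin N → Fin N → ℝ} (hW : IsWeightMatrix A W)
    {δ : ℝ} (hδ : 1 / Real.goldenRatio ≤ δ) (hδ1 : δ < 1)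
    {st : Steps N} (hst : st.Positive) (hbound : G.StepSizeBound W st δ) :
    ∃ ℓ : ℝ≥0, StepCondition (st.invSqrt.phiInv n m) G.stateDomain (G.extOp W) δ
      ‖st.phiInv n m‖ ℓ := by
  have hφ1 := Real.one_lt_goldenRatio
  have hφ2 := Real.goldenRatio_lt_two
  have hhalf : 1 / 2 ≤ δ :=
    (one_div_le_one_div_of_le (by linarith) hφ2.le).trans hδ
  -- 1/φ = φ - 1 is the positive root of t² + t = 1.
  have hgold : 1 ≤ δ ^ 2 + δ := by
    have h1 : 1 ≤ δ * Real.goldenRatio := by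
      rwa [div_le_iff₀ (by linarith)] at hδ
    have h2 := Real.goldenRatio_sq
    have h3 : 1 / Real.goldenRatio = Real.goldenRatio - 1 := by
      rw [div_eq_iff (by linarith)]; nlinarith
    nlinarith
  have hδ0 : 0 < δ := by linarith
  set η := ‖st.phiInv n m‖ with hη
  have hη0 : 0 ≤ η := norm_nonneg _
  have main : ∃ ℓ : ℝ≥0, LipschitzOnWith ℓ (G.extOp W) G.stateDomain ∧
      η * (2 * ℓ + 1) ≤ 1 / (2 * δ) := by
    -- For η = 0 the bound alone would not exclude an infinite Lipschitz constant, but then the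
    -- state space is a single point.
    rcases hη0.eq_or_lt with h0 | h0
    · have hzero : ∀ a : State n m, a = 0 := by
        intro a
        have := hst.norm_sq_le a
        rw [← hη, ← h0, zero_mul] at this
        rw [← norm_le_zero_iff]
        nlinarith [norm_nonneg a]
      refine ⟨0, fun a _ b _ => ?_, ?_⟩
      · rw [hzero a, hzero b]; simp
      · rw [← h0, zero_mul]; positivity
    · have hb := hbound
      unfold StepSizeBound at hb
      set K := lipschitzConst (G.extOp W) G.stateDomain with hK
      have hKt : K ≠ ⊤ := by
        intro h
        rw [h] at hb
        have hd : ENNReal.ofReal δ ≠ 0 := by simpa using hδ0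
        rw [ENNReal.mul_top (by norm_num), top_add, ENNReal.mul_top (by simpa using hδ0),
          ENNReal.div_top, nonpos_iff_eq_zero, ENNReal.ofReal_eq_zero] at hb
        linarith
      refine ⟨K.toNNReal, lipschitzOnWith_of_lipschitzConst_ne_top hKt, ?_⟩
      rw [← ENNReal.coe_toNNReal hKt] at hb
      set L := K.toNNReal
      have e1 : (1 : ℝ≥0∞) / (2 * ENNReal.ofReal δ * (2 * (L : ℝ≥0∞) + 1))
          = ENNReal.ofReal (1 / (2 * δ * (2 * L + 1))) := by
        rw [ENNReal.ofReal_div_of_pos (by positivity), ENNReal.ofReal_mul (by positivity),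
          ENNReal.ofReal_mul (by positivity), ENNReal.ofReal_add (by positivity) (by positivity),
          ENNReal.ofReal_mul (by positivity)]
        simp
      rw [e1, ENNReal.ofReal_le_ofReal_iff (by positivity)] at hb
      calc η * (2 * L + 1) ≤ 1 / (2 * δ * (2 * L + 1)) * (2 * L + 1) := by gcongr
        _ = 1 / (2 * δ) := by field_simp
  obtain ⟨ℓ, hℓ, hstep⟩ := main
  exact ⟨ℓ, ⟨hℓ, fun a ha b hb => extOp_monotone hg hmono hW ha hb, hη0, hst.norm_sq_le, hstep,
    hgold, hhalf, hδ1⟩⟩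

end Game

/-! ### Optimality conditions for proximal points and convex programs. -/

/-- The variational inequality of a proximal point. -/
theorem inner_add_sub_nonneg_of_isMinOn {E : Type*} [NormedAddCommGroup E]
    [InnerProductSpace ℝ E] {K : Set E} {φ : E → ℝ} (hφ : ConvexOn ℝ K φ) {u w : E} (hu : u ∈ K)
    (hmin : ∀ y ∈ K, φ u + ‖u - w‖ ^ 2 / 2 ≤ φ y + ‖y - w‖ ^ 2 / 2) {y : E} (hy : y ∈ K) :
    -- Minimality is tested at u + t (y - u), divided by t, and t tends to 0.
    0 ≤ inner ℝ (u - w) (y - u) + (φ y - φ u) := by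
  have ht : Tendsto (fun t : ℝ => inner ℝ (u - w) (y - u) + (φ y - φ u) + t / 2 * ‖y - u‖ ^ 2)
      (𝓝[>] 0) (𝓝 (inner ℝ (u - w) (y - u) + (φ y - φ u) + 0 / 2 * ‖y - u‖ ^ 2)) := by
    refine Tendsto.mono_left ?_ nhdsWithin_le_nhds
    exact Continuous.tendsto (by fun_prop) 0
  have h0 : 0 ≤ inner ℝ (u - w) (y - u) + (φ y - φ u) + 0 / 2 * ‖y - u‖ ^ 2 := by
    refine ge_of_tendsto ht ?_
    filter_upwards [Ioc_mem_nhdsGT (show (0 : ℝ) < 1 by norm_num)] with t ht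
    have h1 : 0 ≤ 1 - t := by linarith [ht.2]
    have h2 := hφ.2 hu hy h1 ht.1.le (by ring)
    have h3 := hmin _ (hφ.1 hu hy h1 ht.1.le (by ring))
    have h4 : (1 - t) • u + t • y - w = (u - w) + t • (y - u) := by module
    rw [h4, @norm_add_sq_real, inner_smul_right, norm_smul, mul_pow, Real.norm_eq_abs,
      sq_abs] at h3
    simp only [smul_eq_mul] at h2
    have h5 : 0 ≤ t * (inner ℝ (u - w) (y - u) + (φ y - φ u) + t / 2 * ‖y - u‖ ^ 2) := by
      nlinarith
    exact nonneg_of_mul_nonneg_right h5 ht.1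
  simpa using h0

theorem IsProj.inner_nonneg {E : Type*} [NormedAddCommGroup E] [InnerProductSpace ℝ E]
    {K : Set E} (hK : Convex ℝ K) {w u : E} (h : IsProj K w u) {y : E} (hy : y ∈ K) :
    0 ≤ inner ℝ (u - w) (y - u) := by
  have := inner_add_sub_nonneg_of_isMinOn (φ := fun _ => 0) (convexOn_const 0 hK) h.1
    (w := w) (fun y hy => by
      have h1 : ‖u - w‖ ≤ ‖y - w‖ := h.2 hy
      gcongr) hy
  simpa using this

/-- Lagrange multipliers exist under Slater's condition. -/
theorem exists_multiplier {E : Type*} [AddCommGroup E] [Module ℝ E] {m : ℕ} {K : Set E}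
    {φ : E → ℝ} {g : Fin m → E → ℝ} (hφ : ConvexOn ℝ K φ) (hg : ∀ j, ConvexOn ℝ K (g j))
    {x₀ : E} (hx₀ : x₀ ∈ K) (hslater : ∀ j, g j x₀ < 0) {x : E}
    (hmin : ∀ y ∈ K, (∀ j, g j y ≤ 0) → φ x ≤ φ y) :
    ∃ μ : Fin m → ℝ, (∀ j, 0 ≤ μ j) ∧ ∀ y ∈ K, φ x ≤ φ y + ∑ j, μ j * g j y := by
  -- The points strictly above some (g y, φ y - φ x) form an open convex set that misses the origin
  -- by `hmin`. The separating functional provides the multipliers.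
  let T : Set ((Fin m → ℝ) × ℝ) := {p | ∃ y ∈ K, (∀ j, g j y < p.1 j) ∧ φ y - φ x < p.2}
  have hTconv : Convex ℝ T := by
    rintro p ⟨y, hy, hy1, hy2⟩ q ⟨w, hw, hw1, hw2⟩ a b ha hb hab
    refine ⟨a • y + b • w, hφ.1 hy hw ha hb hab, fun j => ?_, ?_⟩
    · have h1 := (hg j).2 hy hw ha hb hab
      have h2 := hy1 j
      have h3 := hw1 j
      simp only [smul_eq_mul, Prod.fst_add, Prod.smul_fst, Pi.add_apply, Pi.smul_apply] at h1 ⊢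
      rcases ha.eq_or_lt with h0 | h0
      · have : b = 1 := by linarith
        subst this; subst h0; linarith
      · nlinarith
    · have h1 := hφ.2 hy hw ha hb hab
      simp only [smul_eq_mul, Prod.snd_add, Prod.smul_snd] at h1 ⊢
      have hb' : b = 1 - a := by linarith
      subst hb'
      rcases ha.eq_or_lt with h0 | h0
      · subst h0; linarith
      · nlinarith
  have hTopen : IsOpen T := by
    have : T = ⋃ y ∈ K, (Set.pi Set.univ fun j => Set.Ioi (g j y)) ×ˢ Set.Ioi (φ y - φ x) := by
      ext p
      simp only [T, Set.mem_ofPred_eq, Set.mem_iUnion, Set.mem_prod, Set.mem_pi, Set.mem_univ,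
        true_imp_iff, Set.mem_Ioi, exists_prop]
    rw [this]
    exact isOpen_biUnion fun y _ =>
      (isOpen_set_pi Set.finite_univ fun _ _ => isOpen_Ioi).prod isOpen_Ioi
  have hT0 : (0 : (Fin m → ℝ) × ℝ) ∉ T := by
    rintro ⟨y, hy, h1, h2⟩
    have := hmin y hy fun j => (h1 j).le
    simp only [Prod.snd_zero] at h2
    linarith
  obtain ⟨f, hf⟩ := geometric_hahn_banach_open_point hTconv hTopen hT0
  rw [map_zero] at hf
  set μ : Fin m → ℝ := fun j => - f (Pi.single j 1, 0) with hμ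
  set s : ℝ := - f (0, 1) with hs
  have hf' : ∀ p : (Fin m → ℝ) × ℝ, f p = - (∑ j, μ j * p.1 j + s * p.2) := by
    intro p
    have h1 : p = ∑ j, p.1 j • ((Pi.single j 1, 0) : (Fin m → ℝ) × ℝ) + p.2 • (0, 1) := by
      refine Prod.ext ?_ ?_
      · ext k
        simp [Prod.fst_sum, Finset.sum_apply, Pi.single_apply]
      · simp [Prod.snd_sum]
    conv_lhs => rw [h1]
    rw [map_add, map_sum, map_smul]
    simp only [map_smul, smul_eq_mul, hμ, hs, neg_mul, Finset.sum_neg_distrib]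
    rw [neg_add, neg_neg, neg_neg]
    congr 1
    · exact Finset.sum_congr rfl fun j _ => mul_comm _ _
    · exact mul_comm _ _
  have hpos : ∀ p ∈ T, 0 < ∑ j, μ j * p.1 j + s * p.2 := fun p hp => by
    have := hf p hp
    rw [hf'] at this
    linarith
  -- `T` is closed upwards, which forces the separating weights to be nonnegative.
  have hup : ∀ p ∈ T, ∀ q : (Fin m → ℝ) × ℝ, (∀ j, 0 ≤ q.1 j) → 0 ≤ q.2 → p + q ∈ T := by
    rintro p ⟨y, hy, h1, h2⟩ q hq1 hq2
    refine ⟨y, hy, fun j => ?_, ?_⟩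
    · have := h1 j; have := hq1 j
      simp only [Prod.fst_add, Pi.add_apply]; linarith
    · simp only [Prod.snd_add]; linarith
  have hmem : ∀ y ∈ K, ∀ ε > 0, ((fun j => g j y + ε, φ y - φ x + ε) : (Fin m → ℝ) × ℝ) ∈ T :=
    fun y hy ε hε => ⟨y, hy, fun j => by simp only; linarith, by simp only; linarith⟩
  have hq : ∀ q : (Fin m → ℝ) × ℝ, (∀ j, 0 ≤ q.1 j) → 0 ≤ q.2 → f q ≤ 0 := by
    intro q hq1 hq2
    by_contra! hlt
    set p : (Fin m → ℝ) × ℝ := (fun j => g j x₀ + 1, φ x₀ - φ x + 1)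
    have hp : p ∈ T := hmem x₀ hx₀ 1 one_pos
    have h1 := hf _ (hup p hp ((|f p| / f q) • q)
      (fun j => mul_nonneg (by positivity) (hq1 j)) (mul_nonneg (by positivity) hq2))
    rw [map_add, map_smul, smul_eq_mul, div_mul_cancel₀ _ hlt.ne'] at h1
    linarith [neg_abs_le (f p)]
  have hμ0 : ∀ j, 0 ≤ μ j := fun j => by
    have := hq (Pi.single j 1, 0) (fun k => by
      simp only [Pi.single_apply]; split_ifs <;> norm_num) le_rfl
    simp only [hμ]; linarith
  have hs0 : 0 ≤ s := by
    have := hq (0, 1) (fun k => le_rfl) zero_le_one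
    simp only [hs]; linarith
  -- Slater's condition excludes a vertical hyperplane: g(x₀) < g(x₀)/2 puts a point with constraint
  -- part g(x₀)/2 into `T`, and for s = 0 its weighted sum would be nonpositive.
  have hspos : 0 < s := by
    refine hs0.lt_of_ne fun h0 => ?_
    have h1 := hpos (fun j => g j x₀ / 2, φ x₀ - φ x + 1)
      ⟨x₀, hx₀, fun j => by have := hslater j; simp only; linarith, by simp only; linarith⟩
    rw [← h0, zero_mul, add_zero] at h1
    have h2 : ∑ j, μ j * (g j x₀ / 2) ≤ 0 := Finset.sum_nonpos fun j _ =>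
      mul_nonpos_of_nonneg_of_nonpos (hμ0 j) (by linarith [hslater j])
    exact absurd h1 (not_lt.2 h2)
  have hlag : ∀ y ∈ K, 0 ≤ ∑ j, μ j * g j y + s * (φ y - φ x) := by
    intro y hy
    have ht : Tendsto (fun ε : ℝ => ∑ j, μ j * (g j y + ε) + s * (φ y - φ x + ε)) (𝓝[>] 0)
        (𝓝 (∑ j, μ j * (g j y + 0) + s * (φ y - φ x + 0))) := by
      refine Tendsto.mono_left ?_ nhdsWithin_le_nhds
      exact Continuous.tendsto (by fun_prop) 0
    have := ge_of_tendsto ht (eventually_mem_nhdsWithin.mono fun ε hε =>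
      (hpos _ (hmem y hy ε hε)).le)
    simpa using this
  refine ⟨fun j => μ j / s, fun j => div_nonneg (hμ0 j) hs0, fun y hy => ?_⟩
  have h1 : ∑ j, μ j / s * g j y = (∑ j, μ j * g j y) / s := by
    rw [Finset.sum_div]; exact Finset.sum_congr rfl fun j _ => by ring
  have h2 := hlag y hy
  rw [h1]
  have h3 : 0 ≤ (∑ j, μ j * g j y + s * (φ y - φ x)) / s := div_nonneg h2 hs0
  rw [add_div, mul_div_cancel_left₀ _ hspos.ne'] at h3
  linarith

/-! ### The algorithm as a resolvent step, and zeros of the extended operator. -/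

namespace Game

variable {N m d : ℕ} {n : Fin N → ℕ} {G : Game N m d n}

/-- Comparison with a point of the nonempty set Ω_i rules out the value +∞. On Ω_i the problem is
real-valued. -/
theorem mem_and_inner_nonneg_of_isProx (hc : G.ConstraintQualification)
    (hf : G.NonsmoothCostAssumption) {i : Fin N} {α : ℝ} (hα : 0 < α)
    {w u : EuclideanSpace ℝ (Fin (n i))} (h : IsProx (fun y => (α : EReal) * G.f i y) w u) :
    u ∈ G.Ω i ∧ ∀ y ∈ G.Ω i,
      0 ≤ inner ℝ (u - w) (y - u) + α * ((G.f i y).toReal - (G.f i u).toReal) := by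
  have hle : ∀ y, (α : EReal) * G.f i u + ((‖u - w‖ ^ 2 / 2 : ℝ) : EReal)
      ≤ (α : EReal) * G.f i y + ((‖y - w‖ ^ 2 / 2 : ℝ) : EReal) := fun y => h (Set.mem_univ y)
  have hu : u ∈ G.Ω i := by
    rw [← hf.dom i]
    by_contra hu
    have hu' : G.f i u = ⊤ := by simpa using hu
    obtain ⟨y, hy⟩ := hc.nonempty i
    have h1 := hle y
    rw [hu', EReal.coe_mul_top_of_pos hα, EReal.top_add_coe, ← hf.coe_toReal hy,
      ← EReal.coe_mul, ← EReal.coe_add] at h1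
    exact EReal.coe_ne_top _ (top_le_iff.1 h1)
  refine ⟨hu, fun y hy => ?_⟩
  have := inner_add_sub_nonneg_of_isMinOn ((hf.convexOn hc i).smul hα.le) hu (w := w)
    (fun y hy => by
      have h1 := hle y
      rw [← hf.coe_toReal hy, ← hf.coe_toReal hu] at h1
      exact_mod_cast h1) hy
  simp only [smul_eq_mul] at this
  linarith

/-- The error of the mini-batch estimate, as a state. -/
noncomputable def batchError (G : Game N m d n) (S : ℕ) (x : Profile n)
    (ξ : Fin N → ℕ → EuclideanSpace ℝ (Fin d)) : State n m :=
  State.mk (WithLp.toLp 2 fun i => G.batchGrad S i x (ξ i) - G.pseudograd x i) 0 0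

theorem IsSRFB.isResolvent (hc : G.ConstraintQualification)
    (hf : G.NonsmoothCostAssumption) {W : Fin N → Fin N → ℝ} {st : Steps N} (hst : st.Positive)
    {δ : ℝ} {S : ℕ → ℕ} {ξ : ℕ → Fin N → ℕ → EuclideanSpace ℝ (Fin d)}
    {ω ωbar : ℕ → State n m} (h : G.IsSRFB W st δ S ξ ω ωbar) (k : ℕ) :
    IsResolvent (st.invSqrt.phiInv n m) G.stateDomain G.nonsmooth (ωbar (k + 1))
      (G.extOp W (ω k) + G.batchError (S k) (ω k).x (ξ k)) (ω (k + 1)) := by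
  have hx := fun i => mem_and_inner_nonneg_of_isProx hc hf (hst.α i) (h.primal k i)
  refine ⟨⟨fun i => (hx i).1, fun i => (h.dual k i).1⟩, fun y hy => ?_⟩
  rw [hst.inner_invSqrt, State.inner_eq, nonsmooth, nonsmooth]
  simp only [State.x_sub, State.z_sub, State.lam_sub, State.x_add, State.z_add, State.lam_add,
    extOp, batchError, State.x_mk, State.z_mk, State.lam_mk, PiLp.zero_apply, add_zero]
  -- Dividing each block by its own step size produces the metric of Φ. The z block has no
  -- constraint and gives an equality.
  have h1 : 0 ≤ ∑ i, ((st.α i)⁻¹ * inner ℝ ((ω (k + 1)).x i - (ωbar (k + 1)).x i)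
      (y.x i - (ω (k + 1)).x i)
      + inner ℝ (G.pseudograd (ω k).x i + G.jacT i ((ω k).x i) ((ω k).lam i)
        + (G.batchGrad (S k) i (ω k).x (ξ k i) - G.pseudograd (ω k).x i))
        (y.x i - (ω (k + 1)).x i)
      + ((G.f i (y.x i)).toReal - (G.f i ((ω (k + 1)).x i)).toReal)) := by
    refine Finset.sum_nonneg fun i _ => ?_
    have h2 := (hx i).2 (y.x i) (hy.1 i)
    have hα := hst.α i
    rw [sub_sub_eq_add_sub, add_sub_right_comm, inner_add_left, inner_smul_left,
      conj_trivial] at h2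
    have h3 := mul_nonneg (inv_nonneg.2 hα.le) h2
    have e1 : G.pseudograd (ω k).x i + G.jacT i ((ω k).x i) ((ω k).lam i)
        + (G.batchGrad (S k) i (ω k).x (ξ k i) - G.pseudograd (ω k).x i)
        = G.batchGrad (S k) i (ω k).x (ξ k i) + G.jacT i ((ω k).x i) ((ω k).lam i) := by abel
    rw [e1]
    rw [mul_add, mul_add, inv_mul_cancel_left₀ hα.ne', inv_mul_cancel_left₀ hα.ne'] at h3
    exact h3
  have h2 : ∑ i, ((st.ν i)⁻¹ * inner ℝ ((ω (k + 1)).z i - (ωbar (k + 1)).z i)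
      (y.z i - (ω (k + 1)).z i)
      + inner ℝ (laplacian W (ω k).lam i) (y.z i - (ω (k + 1)).z i)) = 0 := by
    refine Finset.sum_eq_zero fun i _ => ?_
    have e1 : (ω (k + 1)).z i - (ωbar (k + 1)).z i = - (st.ν i • laplacian W (ω k).lam i) := by
      rw [h.auxiliary k i]; simp [laplacian]
    rw [e1, inner_neg_left, inner_smul_left, conj_trivial, mul_neg,
      inv_mul_cancel_left₀ (hst.ν i).ne', neg_add_cancel]
  have h3 : 0 ≤ ∑ i, ((st.τ i)⁻¹ * inner ℝ ((ω (k + 1)).lam i - (ωbar (k + 1)).lam i)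
      (y.lam i - (ω (k + 1)).lam i)
      + inner ℝ (laplacian W (ω k).lam i - G.g i ((ω k).x i) - laplacian W (ω k).z i)
        (y.lam i - (ω (k + 1)).lam i)) := by
    refine Finset.sum_nonneg fun i _ => ?_
    have h4 := (h.dual k i).inner_nonneg convex_orthant (hy.2 i)
    have hτ := hst.τ i
    have e1 : ∑ j, W i j • (((ω k).z i - (ω k).z j) - ((ω k).lam i - (ω k).lam j))
        = laplacian W (ω k).z i - laplacian W (ω k).lam i := by
      simp only [laplacian, smul_sub, Finset.sum_sub_distrib]
    have e2 : (ω (k + 1)).lam i - ((ωbar (k + 1)).lam i + st.τ i • G.g i ((ω k).x i)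
        + st.τ i • (laplacian W (ω k).z i - laplacian W (ω k).lam i))
        = ((ω (k + 1)).lam i - (ωbar (k + 1)).lam i) + st.τ i •
          (laplacian W (ω k).lam i - G.g i ((ω k).x i) - laplacian W (ω k).z i) := by module
    rw [e1, e2, inner_add_left, inner_smul_left, conj_trivial] at h4
    have h5 := mul_nonneg (inv_nonneg.2 hτ.le) h4
    rwa [mul_add, inv_mul_cancel_left₀ hτ.ne'] at h5
  simp only [Finset.sum_add_distrib, Finset.sum_sub_distrib] at h1 h2 h3
  linarith

theorem IsSRFB.mem_stateDomain (hc : G.ConstraintQualification)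
    (hf : G.NonsmoothCostAssumption) {W : Fin N → Fin N → ℝ} {st : Steps N} (hst : st.Positive)
    {δ : ℝ} {S : ℕ → ℕ} {ξ : ℕ → Fin N → ℕ → EuclideanSpace ℝ (Fin d)}
    {ω ωbar : ℕ → State n m} (h : G.IsSRFB W st δ S ξ ω ωbar) :
    ∀ k, ω k ∈ G.stateDomain
  | 0 => h.init
  | k + 1 => (h.isResolvent hc hf hst k).1

theorem ConstraintQualification.convex_localSet (hc : G.ConstraintQualification) :
    Convex ℝ G.localSet :=
  fun _ hx _ hy _ _ ha hb hab i => hc.convex i (hx i) (hy i) ha hb hab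

theorem coupling_apply (x : Profile n) (j : Fin m) : G.coupling x j = ∑ i, G.g i (x i) j := by
  rw [coupling, WithLp.ofLp_sum, Finset.sum_apply]

theorem inner_coupling (v : EuclideanSpace ℝ (Fin m)) (x : Profile n) :
    inner ℝ v (G.coupling x) = ∑ i, inner ℝ v (G.g i (x i)) := inner_sum _ _ _

/-- Zeros of the extended operator give solutions of the stochastic variational inequality. -/
theorem isSVISol_of_mem_viSol (hg : G.CouplingAssumption)
    {A : SimpleGraph (Fin N)} (hA : A.Connected) {W : Fin N → Fin N → ℝ}
    (hW : IsWeightMatrix A W) {ω : State n m}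
    (hω : ω ∈ viSol G.stateDomain (G.extOp W) G.nonsmooth) : G.IsSVISol ω.x := by
  obtain ⟨⟨hx, hl⟩, hvi⟩ := hω
  -- Moving z by -L lam in the inequality yields -‖L lam‖² ≥ 0.
  have hL : laplacian W ω.lam = 0 := by
    have h1 := hvi (State.mk ω.x (ω.z - laplacian W ω.lam) ω.lam) ⟨hx, hl⟩
    rw [State.inner_eq] at h1
    simp only [extOp, nonsmooth, State.x_sub, State.z_sub, State.lam_sub, State.x_mk, State.z_mk,
      State.lam_mk, sub_self, inner_zero_right, Finset.sum_const_zero, PiLp.sub_apply,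
      sub_sub_cancel_left, inner_neg_right, Finset.sum_neg_distrib, add_zero, zero_add] at h1
    have h2 : inner ℝ (laplacian W ω.lam) (laplacian W ω.lam) ≤ (0 : ℝ) := by
      rw [PiLp.inner_apply]; linarith
    rw [real_inner_self_eq_norm_sq] at h2
    exact norm_eq_zero.1 (pow_eq_zero_iff two_ne_zero |>.1 (h2.antisymm (sq_nonneg _)))
  have hcons := hW.eq_of_laplacian_eq_zero hA hL
  obtain ⟨i₀⟩ := hA.nonempty
  set v := ω.lam i₀ with hv
  have hv0 : v ∈ orthant m := hl i₀
  -- Against a consensus multiplier the L z term sums to zero, so only the total constraint value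
  -- remains.
  have hdual : ∀ w ∈ orthant m, inner ℝ (G.coupling ω.x) (w - v) ≤ 0 := by
    intro w hw
    have h1 := hvi (State.mk ω.x ω.z (WithLp.toLp 2 fun _ => w)) ⟨hx, fun _ => hw⟩
    rw [State.inner_eq] at h1
    simp only [extOp, nonsmooth, State.x_sub, State.z_sub, State.lam_sub, State.x_mk, State.z_mk,
      State.lam_mk, sub_self, inner_zero_right, Finset.sum_const_zero, add_zero, zero_add, hL,
      PiLp.zero_apply, zero_sub, hcons _ i₀, ← sum_inner, Finset.sum_sub_distrib,
      sum_laplacian hW.symm, sub_zero, Finset.sum_neg_distrib, inner_neg_left] at h1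
    rw [coupling]
    linarith
  -- Increasing one coordinate of `v` gives feasibility. The choice w = 0 then gives complementary
  -- slackness.
  have hfeas : ∀ j, G.coupling ω.x j ≤ 0 := by
    intro j
    have h1 := hdual (v + EuclideanSpace.single j 1) (fun k => by
      have h2 := hv0 k
      have h3 : (0 : ℝ) ≤ EuclideanSpace.single j (1 : ℝ) k := by
        rw [PiLp.single_apply]; split_ifs <;> norm_num
      rw [PiLp.add_apply]
      exact add_nonneg h2 h3)
    rw [add_sub_cancel_left, EuclideanSpace.inner_single_right] at h1
    simpa using h1
  have hslack : 0 ≤ inner ℝ v (G.coupling ω.x) := by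
    have h1 := hdual 0 fun k => le_rfl
    rw [zero_sub, inner_neg_right, real_inner_comm] at h1
    linarith
  refine ⟨⟨hx, hfeas⟩, fun y hy => ?_⟩
  have h1 := hvi (State.mk y ω.z ω.lam) ⟨hy.1, hl⟩
  rw [State.inner_eq] at h1
  simp only [extOp, nonsmooth, State.x_sub, State.z_sub, State.lam_sub, State.x_mk, State.z_mk,
    State.lam_mk, sub_self, inner_zero_right, Finset.sum_const_zero, add_zero,
    inner_add_left, Finset.sum_add_distrib] at h1
  have h2 : ∑ i, inner ℝ (G.jacT i (ω.x i) (ω.lam i)) (y i - ω.x i)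
      ≤ ∑ i, inner ℝ v (G.g i (y i) - G.g i (ω.x i)) :=
    Finset.sum_le_sum fun i _ => by
      rw [hcons i i₀]
      exact hg.inner_jacT_le hv0
  simp only [inner_sub_right v, Finset.sum_sub_distrib] at h2
  rw [← inner_coupling, ← inner_coupling] at h2
  have h3 : inner ℝ v (G.coupling y) ≤ inner ℝ v (0 : EuclideanSpace ℝ (Fin m)) :=
    inner_le_inner_of_mem_orthant hv0 hy.2
  rw [inner_zero_right] at h3
  rw [PiLp.inner_apply, Finset.sum_sub_distrib]
  simp only [PiLp.sub_apply]
  linarith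

/-- A solution of the SVI minimizes the cost with 𝔽 frozen at x, y ↦ ⟨𝔽(x), y⟩ + ∑ f_i(y_i), over
the feasible set. This is a convex program, and its multiplier inequality at y = x gives
complementary slackness. -/
theorem exists_coupling_multiplier (hc : G.ConstraintQualification)
    (hg : G.CouplingAssumption) (hf : G.NonsmoothCostAssumption) {x : Profile n}
    (hx : G.IsSVISol x) :
    ∃ v ∈ orthant m, inner ℝ v (G.coupling x) = 0 ∧ ∀ y ∈ G.localSet,
      0 ≤ inner ℝ (G.pseudograd x) (y - x) + ∑ i, ((G.f i (y i)).toReal - (G.f i (x i)).toReal)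
        + inner ℝ v (G.coupling y) := by
  obtain ⟨x₀, hx₀, hsl⟩ := hc.slater
  have hφ : ConvexOn ℝ G.localSet fun y =>
      inner ℝ (G.pseudograd x) y + ∑ i, (G.f i (y i)).toReal := by
    refine ⟨hc.convex_localSet, fun y hy w hw a b ha hb hab => ?_⟩
    have h1 : ∑ i, (G.f i ((a • y + b • w) i)).toReal
        ≤ ∑ i, (a * (G.f i (y i)).toReal + b * (G.f i (w i)).toReal) :=
      Finset.sum_le_sum fun i _ => (hf.convexOn hc i).2 (hy i) (hw i) ha hb hab
    rw [Finset.sum_add_distrib, ← Finset.mul_sum, ← Finset.mul_sum] at h1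
    simp only [inner_add_right, inner_smul_right, smul_eq_mul]
    linarith
  have hgc : ∀ j, ConvexOn ℝ G.localSet fun y => G.coupling y j := by
    refine fun j => ⟨hc.convex_localSet, fun y hy w hw a b ha hb hab => ?_⟩
    simp only [coupling_apply]
    have h1 : ∑ i, G.g i ((a • y + b • w) i) j
        ≤ ∑ i, (a * G.g i (y i) j + b * G.g i (w i) j) :=
      Finset.sum_le_sum fun i _ =>
        (hg.convex i j).2 (Set.mem_univ _) (Set.mem_univ _) ha hb hab
    rwa [Finset.sum_add_distrib, ← Finset.mul_sum, ← Finset.mul_sum] at h1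
  obtain ⟨μ, hμ0, hμ⟩ := exists_multiplier hφ hgc hx₀ hsl (x := x) fun y hy hy' => by
    have := hx.2 y ⟨hy, hy'⟩
    rw [inner_sub_right, Finset.sum_sub_distrib] at this
    linarith
  have hinner : ∀ y, inner ℝ (WithLp.toLp 2 μ : EuclideanSpace ℝ (Fin m)) (G.coupling y)
      = ∑ j, μ j * G.coupling y j := fun y => by
    simp only [PiLp.inner_apply, RCLike.inner_apply, conj_trivial]
    exact Finset.sum_congr rfl fun j _ => mul_comm _ _
  refine ⟨WithLp.toLp 2 μ, hμ0, ?_, fun y hy => ?_⟩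
  · rw [hinner]
    have h1 := hμ x hx.1.1
    have h2 : ∑ j, μ j * G.coupling x j ≤ 0 :=
      Finset.sum_nonpos fun j _ => mul_nonpos_of_nonneg_of_nonpos (hμ0 j) (hx.1.2 j)
    linarith
  · rw [hinner, inner_sub_right, Finset.sum_sub_distrib]
    have h1 := hμ y hy
    linarith

/-- First-order form of the Lagrangian optimality condition. -/
theorem inner_jacT_add_nonneg (hc : G.ConstraintQualification)
    (hg : G.CouplingAssumption) (hf : G.NonsmoothCostAssumption) {x : Profile n}
    (hx : x ∈ G.localSet) {v : EuclideanSpace ℝ (Fin m)} (hv : inner ℝ v (G.coupling x) = 0)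
    (hlag : ∀ y ∈ G.localSet, 0 ≤ inner ℝ (G.pseudograd x) (y - x)
      + ∑ i, ((G.f i (y i)).toReal - (G.f i (x i)).toReal) + inner ℝ v (G.coupling y))
    {y : Profile n} (hy : y ∈ G.localSet) :
    0 ≤ inner ℝ (G.pseudograd x) (y - x) + ∑ i, ((G.f i (y i)).toReal - (G.f i (x i)).toReal)
      + ∑ i, inner ℝ (G.jacT i (x i) v) (y i - x i) := by
  -- `hlag` involves values of g, not derivatives. It is used at x + t (y - x) and divided by t,
  -- where convexity bounds the f_i and slackness removes the value at t = 0.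
  have hder : HasDerivAt (fun t : ℝ => ∑ i, inner ℝ v (G.g i (x i + t • (y i - x i))))
      (∑ i, inner ℝ (G.jacT i (x i) v) (y i - x i)) 0 := by
    refine HasDerivAt.fun_sum fun i _ => ?_
    have h1 : HasDerivAt (fun t : ℝ => x i + t • (y i - x i)) (y i - x i) 0 := by
      simpa using ((hasDerivAt_id (0 : ℝ)).smul_const (y i - x i)).const_add (x i)
    have h2 : HasFDerivAt (G.g i) (fderiv ℝ (G.g i) (x i)) (x i + (0 : ℝ) • (y i - x i)) := by
      simpa using (hg.differentiable i (x i)).hasFDerivAt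
    have h3 := h2.comp_hasDerivAt 0 h1
    rw [inner_jacT]
    exact (innerSL ℝ v).hasFDerivAt.comp_hasDerivAt 0 h3
  have ht := (hder.tendsto_slope_zero_right).const_add (inner ℝ (G.pseudograd x) (y - x)
    + ∑ i, ((G.f i (y i)).toReal - (G.f i (x i)).toReal))
  refine ge_of_tendsto ht ?_
  filter_upwards [Ioc_mem_nhdsGT (show (0 : ℝ) < 1 by norm_num)] with t ht
  have ht1 : 0 ≤ 1 - t := by linarith [ht.2]
  have h1 := hlag _ (hc.convex_localSet hx hy ht1 ht.1.le (by ring))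
  have e1 : (1 - t) • x + t • y - x = t • (y - x) := by module
  have e2 : ∀ i, ((1 - t) • x + t • y) i = x i + t • (y i - x i) := fun i => by
    simp only [PiLp.add_apply, PiLp.smul_apply]; module
  have h2 : ∑ i, ((G.f i (((1 - t) • x + t • y) i)).toReal - (G.f i (x i)).toReal)
      ≤ t * ∑ i, ((G.f i (y i)).toReal - (G.f i (x i)).toReal) := by
    rw [Finset.mul_sum]
    refine Finset.sum_le_sum fun i _ => ?_
    have := (hf.convexOn hc i).2 (hx i) (hy i) ht1 ht.1.le (by ring)
    simp only [smul_eq_mul, PiLp.add_apply, PiLp.smul_apply] at this ⊢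
    linarith
  rw [e1, inner_smul_right, inner_coupling] at h1
  rw [inner_coupling] at hv
  simp only [e2] at h1 h2
  simp only [zero_add, zero_smul, add_zero, hv, sub_zero, smul_eq_mul]
  have h3 : 0 ≤ t⁻¹ * (t * inner ℝ (G.pseudograd x) (y - x)
      + t * ∑ i, ((G.f i (y i)).toReal - (G.f i (x i)).toReal)
      + ∑ i, inner ℝ v (G.g i (x i + t • (y i - x i)))) :=
    mul_nonneg (inv_nonneg.2 ht.1.le) (by linarith)
  rwa [mul_add, mul_add, inv_mul_cancel_left₀ ht.1.ne', inv_mul_cancel_left₀ ht.1.ne'] at h3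

/-- Solutions of the stochastic variational inequality extend to zeros of the extended
operator. -/
theorem nonempty_viSol_of_isSVISol (hc : G.ConstraintQualification)
    (hg : G.CouplingAssumption) (hf : G.NonsmoothCostAssumption)
    {A : SimpleGraph (Fin N)} (hA : A.Connected) {W : Fin N → Fin N → ℝ}
    (hW : IsWeightMatrix A W) {x : Profile n} (hx : G.IsSVISol x) :
    (viSol G.stateDomain (G.extOp W) G.nonsmooth).Nonempty := by
  obtain ⟨v, hv0, hv, hlag⟩ := exists_coupling_multiplier hc hg hf hx
  have hN : (N : ℝ) ≠ 0 := by
    obtain ⟨i⟩ := hA.nonempty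
    exact_mod_cast (Fin.pos i).ne'
  -- The deviations of the g_i(x_i) from their mean sum to zero, so some z levels them. Every dual
  -- block of the operator is then -g(x)/N.
  obtain ⟨z, hz⟩ := hW.exists_laplacian_eq hA
    (r := (WithLp.toLp 2 fun i => (N : ℝ)⁻¹ • G.coupling x - G.g i (x i) : Dual N m)) (by
      simp only [Finset.sum_sub_distrib, Finset.sum_const, Finset.card_univ, Fintype.card_fin]
      rw [← Nat.cast_smul_eq_nsmul ℝ, smul_smul, mul_inv_cancel₀ hN, one_smul, coupling, sub_self])
  have hL0 : laplacian W (WithLp.toLp 2 fun _ => v : Dual N m) = 0 := by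
    ext1 i; simp [laplacian]
  refine ⟨State.mk x z (WithLp.toLp 2 fun _ => v), ⟨hx.1.1, fun _ => hv0⟩, fun y hy => ?_⟩
  have h1 := inner_jacT_add_nonneg hc hg hf hx.1.1 hv hlag hy.1
  rw [State.inner_eq]
  simp only [extOp, nonsmooth, State.x_sub, State.z_sub, State.lam_sub, State.x_mk, State.z_mk,
    State.lam_mk, hL0, hz, PiLp.zero_apply, inner_zero_left, Finset.sum_const_zero, add_zero,
    zero_sub, inner_add_left, Finset.sum_add_distrib]
  rw [PiLp.inner_apply, Finset.sum_sub_distrib] at h1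
  simp only [PiLp.sub_apply] at h1
  have h2 : 0 ≤ ∑ i, inner ℝ (-G.g i (x i) - ((N : ℝ)⁻¹ • G.coupling x - G.g i (x i)))
      (y.lam i - v) := by
    refine Finset.sum_nonneg fun i _ => ?_
    have e1 : -G.g i (x i) - ((N : ℝ)⁻¹ • G.coupling x - G.g i (x i))
        = -((N : ℝ)⁻¹ • G.coupling x) := by abel
    have h3 : inner ℝ (y.lam i) (G.coupling x) ≤ inner ℝ (y.lam i) 0 :=
      inner_le_inner_of_mem_orthant (hy.2 i) hx.1.2
    rw [inner_zero_right] at h3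
    rw [e1, inner_neg_left, inner_smul_left, inner_sub_right, real_inner_comm _ (G.coupling x),
      real_inner_comm _ (G.coupling x), hv, sub_zero, conj_trivial, ← mul_neg]
    exact mul_nonneg (by positivity) (by linarith)
  linarith

end Game

/-! ### Independence of past and present. -/

theorem map_restrict_prodMk {Θ 𝓧 𝓨 : Type*} [MeasurableSpace 𝓧] [MeasurableSpace 𝓨]
    {m₁ m0 : MeasurableSpace Θ} {μ : Measure Θ} [IsProbabilityMeasure μ] (h₁ : m₁ ≤ m0) {X : Θ → 𝓧} {Y : Θ → 𝓨}
    (hX : Measurable[m₁] X) (hY : Measurable Y)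
    (hind : Indep m₁ (MeasurableSpace.comap Y inferInstance) μ) {s : Set Θ}
    (hs : MeasurableSet[m₁] s) :
    (μ.restrict s).map (fun θ => (X θ, Y θ)) = ((μ.restrict s).map X).prod (μ.map Y) := by
  have hX' : Measurable X := hX.mono h₁ le_rfl
  have := Measure.isProbabilityMeasure_map (μ := μ) hY.aemeasurable
  symm
  refine Measure.prod_eq fun A B hA hB => ?_
  rw [Measure.map_apply (hX'.prodMk hY) (hA.prod hB), Measure.map_apply hX' hA,
    Measure.map_apply hY hB, Measure.restrict_apply ((hX'.prodMk hY) (hA.prod hB)),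
    Measure.restrict_apply (hX' hA)]
  rw [Indep_iff] at hind
  have e1 : (fun θ => (X θ, Y θ)) ⁻¹' A ×ˢ B ∩ s = (X ⁻¹' A ∩ s) ∩ Y ⁻¹' B := by
    ext θ; simp only [Set.mem_inter_iff, Set.mem_preimage, Set.mem_prod]; tauto
  -- The past event `s` is merged with X ∈ A before independence is applied.
  have hXA : MeasurableSet[m₁] (X ⁻¹' A ∩ s) := by
    have : MeasurableSet[m₁] (X ⁻¹' A) := hX hA
    exact this.inter hs
  rw [e1, hind _ _ hXA ⟨B, hB, rfl⟩]

section Independence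

variable {Θ : Type*} {m0 : MeasurableSpace Θ} {μ : Measure Θ}

/-- Chains two facts, initial data independent of all samples and old samples independent of new
ones. The intersections A ∩ B form a π-system generating the join. -/
theorem indep_sup_left_of_indep [IsProbabilityMeasure μ] {m₁ m₂ m₃ : MeasurableSpace Θ}
    (h₁ : m₁ ≤ m0) (h₂ : m₂ ≤ m0) (h₃ : m₃ ≤ m0) (h : Indep m₁ (m₂ ⊔ m₃) μ)
    (h' : Indep m₂ m₃ μ) : Indep (m₁ ⊔ m₂) m₃ μ := by
  let p : Set (Set Θ) := {t | ∃ A B, MeasurableSet[m₁] A ∧ MeasurableSet[m₂] B ∧ t = A ∩ B}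
  have hp : IsPiSystem p := by
    rintro _ ⟨A, B, hA, hB, rfl⟩ _ ⟨A', B', hA', hB', rfl⟩ -
    exact ⟨A ∩ A', B ∩ B', hA.inter hA', hB.inter hB', Set.inter_inter_inter_comm _ _ _ _⟩
  have hgen : m₁ ⊔ m₂ = MeasurableSpace.generateFrom p := by
    refine le_antisymm (sup_le (fun A hA => ?_) fun B hB => ?_)
      (MeasurableSpace.generateFrom_le ?_)
    · exact MeasurableSpace.measurableSet_generateFrom
        ⟨A, Set.univ, hA, MeasurableSet.univ, (Set.inter_univ A).symm⟩
    · exact MeasurableSpace.measurableSet_generateFrom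
        ⟨Set.univ, B, MeasurableSet.univ, hB, (Set.univ_inter B).symm⟩
    · rintro _ ⟨A, B, hA, hB, rfl⟩
      have hA' : MeasurableSet[m₁ ⊔ m₂] A := (le_sup_left : m₁ ≤ m₁ ⊔ m₂) _ hA
      have hB' : MeasurableSet[m₁ ⊔ m₂] B := (le_sup_right : m₂ ≤ m₁ ⊔ m₂) _ hB
      exact hA'.inter hB'
  refine IndepSets.indep (sup_le h₁ h₂) h₃ hp (@MeasurableSpace.isPiSystem_measurableSet Θ m₃)
    hgen (@MeasurableSpace.generateFrom_measurableSet Θ m₃).symm ?_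
  rw [IndepSets_iff]
  rintro _ C ⟨A, B, hA, hB, rfl⟩ hC
  have hB' : MeasurableSet[m₂ ⊔ m₃] B := (le_sup_left : m₂ ≤ m₂ ⊔ m₃) _ hB
  have hC' : MeasurableSet[m₂ ⊔ m₃] C := (le_sup_right : m₃ ≤ m₂ ⊔ m₃) _ hC
  rw [Indep_iff] at h h'
  rw [Set.inter_assoc, h A (B ∩ C) hA (hB'.inter hC'), h' B C hB hC, h A B hA hB', mul_assoc]

/-- Pairwise independent centered vectors are orthogonal. -/
theorem integral_norm_sq_sum {ι κ : Type*} [Fintype ι] {Z : κ → Θ → EuclideanSpace ℝ ι}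
    (s : Finset κ) (hZ : ∀ t, MemLp (Z t) 2 μ) (hZ0 : ∀ t, ∫ θ, Z t θ ∂μ = 0)
    [IsProbabilityMeasure μ] (hind : Pairwise fun t t' => IndepFun (Z t) (Z t') μ) :
    ∫ θ, ‖∑ t ∈ s, Z t θ‖ ^ 2 ∂μ = ∑ t ∈ s, ∫ θ, ‖Z t θ‖ ^ 2 ∂μ := by
  have hint : ∀ t t', Integrable (fun θ => inner ℝ (Z t θ) (Z t' θ)) μ := fun t t' =>
    integrable_inner_of_memLp (hZ t) (hZ t')
  have hcross : ∀ t t', t ≠ t' → ∫ θ, inner ℝ (Z t θ) (Z t' θ) ∂μ = 0 := by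
    intro t t' htt'
    have hc : ∀ t j, MemLp (fun θ => Z t θ j) 2 μ := fun t j => (hZ t).eval_piLp j
    have hc0 : ∀ t j, ∫ θ, Z t θ j ∂μ = 0 := fun t j => by
      rw [← eval_integral_piLp fun j => (hc t j).integrable one_le_two, hZ0]; rfl
    simp only [PiLp.inner_apply, RCLike.inner_apply, conj_trivial]
    rw [integral_finsetSum (f := fun j θ => Z t' θ j * Z t θ j) _
      fun j _ => (hc t' j).integrable_mul (hc t j)]
    refine Finset.sum_eq_zero fun j _ => ?_
    have hm : Measurable fun v : EuclideanSpace ℝ ι => v j :=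
      (PiLp.continuous_apply 2 _ j).measurable
    refine (((hind htt'.symm).comp hm hm).integral_fun_mul_eq_mul_integral
      (hc t' j).1 (hc t j).1).trans ?_
    simp only [Function.comp]
    rw [hc0 t j, mul_zero]
  have e1 : ∀ θ, ‖∑ t ∈ s, Z t θ‖ ^ 2 = ∑ t ∈ s, ∑ t' ∈ s, inner ℝ (Z t θ) (Z t' θ) := fun θ => by
    rw [← real_inner_self_eq_norm_sq, sum_inner]
    exact Finset.sum_congr rfl fun t _ => inner_sum _ _ _
  simp only [e1]
  rw [integral_finsetSum _ fun t _ => integrable_finsetSum _ fun t' _ => hint t t']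
  refine Finset.sum_congr rfl fun t ht => ?_
  rw [integral_finsetSum _ fun t' _ => hint t t', Finset.sum_eq_single_of_mem t ht
    fun t' _ h => hcross t t' h.symm]
  exact integral_congr_ae (Eventually.of_forall fun θ => real_inner_self_eq_norm_sq _)

end Independence

/-! ### Errors produced by independent batches. -/

section Noise

variable {E : Type*} [NormedAddCommGroup E] [InnerProductSpace ℝ E] [FiniteDimensional ℝ E]
  [MeasurableSpace E] [BorelSpace E] {𝓨 : Type*} [MeasurableSpace 𝓨]

/-- Fubini: z - x is constant on each section, so everything reduces to the moments of `e (x, ·)`.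
-/
theorem memLp_prod_of_section {e : E × 𝓨 → E} (he : Measurable e) {z : E} {b : ℝ}
    {μ : Measure E} [IsFiniteMeasure μ] {ν : Measure 𝓨} [IsProbabilityMeasure ν]
    (h2 : ∀ x, MemLp (fun y => e (x, y)) 2 ν)
    (hb : ∀ x, ∫ y, ‖e (x, y)‖ ^ 2 ∂ν ≤ b * (1 + ‖x - z‖ ^ 2))
    (h0 : ∀ x, ∫ y, e (x, y) ∂ν = 0) (hμ : MemLp (fun x => x - z) 2 μ) :
    MemLp e 2 (μ.prod ν) ∧
      ∫ p, ‖e p‖ ^ 2 ∂(μ.prod ν) ≤ b * ∫ x, (1 + ‖x - z‖ ^ 2) ∂μ ∧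
      ∫ p, inner ℝ (e p) (z - p.1) ∂(μ.prod ν) = 0 := by
  have hbi : Integrable (fun x => b * (1 + ‖x - z‖ ^ 2)) μ :=
    ((integrable_const 1).add (integrable_norm_sq hμ)).const_mul b
  have hsm : StronglyMeasurable fun p => ‖e p‖ ^ 2 := (he.norm.pow_const 2).stronglyMeasurable
  have hint : Integrable (fun p => ‖e p‖ ^ 2) (μ.prod ν) := by
    rw [integrable_prod_iff hsm.aestronglyMeasurable]
    refine ⟨Eventually.of_forall fun x => integrable_norm_sq (h2 x), ?_⟩
    simp only [norm_pow, norm_norm]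
    refine hbi.mono' hsm.integral_prod_right'.aestronglyMeasurable
      (Eventually.of_forall fun x => ?_)
    rw [Real.norm_of_nonneg (integral_nonneg fun y => sq_nonneg _)]
    exact hb x
  have hLp : MemLp e 2 (μ.prod ν) :=
    (memLp_two_iff_integrable_sq_norm he.aestronglyMeasurable).2 hint
  refine ⟨hLp, ?_, ?_⟩
  · rw [integral_prod _ hint, ← integral_const_mul]
    exact integral_mono hint.integral_prod_left hbi hb
  · have hz : MemLp (fun p : E × 𝓨 => z - p.1) 2 (μ.prod ν) := by
      have h3 : MemLp (fun x => z - x) 2 μ := by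
        have := hμ.neg
        refine (memLp_congr_ae (Eventually.of_forall fun x => ?_)).1 this
        simp
      exact h3.comp_fst ν
    rw [integral_prod _ (integrable_inner_of_memLp hLp hz)]
    refine integral_eq_zero_of_ae (Eventually.of_forall fun x => ?_)
    simp only [Pi.zero_apply]
    have h4 := integral_inner (𝕜 := ℝ) ((h2 x).integrable one_le_two) (z - x)
    rw [h0, inner_zero_right] at h4
    rw [← h4]
    exact integral_congr_ae (Eventually.of_forall fun y => real_inner_comm _ _)

/-- On a past event the current state and the new batch have a product law, so moments computed at a
frozen state carry over to the random state. -/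
theorem isNoise_of_indep {Θ : Type*} {m0 : MeasurableSpace Θ} {P : Measure Θ}
    [IsProbabilityMeasure P] {F : Filtration ℕ m0} {u : ℕ → Θ → E} {Y : ℕ → Θ → 𝓨}
    {e : ℕ → E × 𝓨 → E} {z : E} {b : ℕ → ℝ} (he : ∀ k, Measurable (e k))
    (hu : ∀ k, Measurable[F k] (u k)) (hY : ∀ k, Measurable (Y k))
    (hind : ∀ k, Indep (F k) (MeasurableSpace.comap (Y k) inferInstance) P)
    (h2 : ∀ k x, MemLp (fun θ => e k (x, Y k θ)) 2 P)
    (hb : ∀ k x, ∫ θ, ‖e k (x, Y k θ)‖ ^ 2 ∂P ≤ b k * (1 + ‖x - z‖ ^ 2))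
    (h0 : ∀ k x, ∫ θ, e k (x, Y k θ) ∂P = 0) :
    IsNoise P F u (fun k θ => e k (u k θ, Y k θ)) z b := by
  have main : ∀ k s, MeasurableSet[F k] s → MemLp (fun θ => u k θ - z) 2 (P.restrict s) →
      MemLp (fun θ => e k (u k θ, Y k θ)) 2 (P.restrict s) ∧
      ∫ θ in s, ‖e k (u k θ, Y k θ)‖ ^ 2 ∂P ≤ b k * ∫ θ in s, (1 + ‖u k θ - z‖ ^ 2) ∂P ∧
      ∫ θ in s, inner ℝ (e k (u k θ, Y k θ)) (z - u k θ) ∂P = 0 := by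
    intro k s hs hLp
    have hu' : Measurable (u k) := (hu k).mono (F.le k) le_rfl
    have hprod := map_restrict_prodMk (F.le k) (hu k) (hY k) (hind k) hs
    have hν := Measure.isProbabilityMeasure_map (μ := P) (hY k).aemeasurable
    have hpair : Measurable fun θ => (u k θ, Y k θ) := hu'.prodMk (hY k)
    have hsec : ∀ x, Measurable fun y => e k (x, y) := fun x => (he k).comp measurable_prodMk_left
    obtain ⟨g1, g2, g3⟩ := memLp_prod_of_section (he k) (z := z) (b := b k)
      (μ := (P.restrict s).map (u k)) (ν := P.map (Y k))
      (fun x => (memLp_map_measure_iff (hsec x).aestronglyMeasurable (hY k).aemeasurable).2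
        (h2 k x))
      (fun x => by
        rw [integral_map (hY k).aemeasurable
          ((hsec x).norm.pow_const 2).aestronglyMeasurable]
        exact hb k x)
      (fun x => by
        rw [integral_map (hY k).aemeasurable (hsec x).aestronglyMeasurable]
        exact h0 k x)
      ((memLp_map_measure_iff (measurable_id.sub_const z).aestronglyMeasurable
        hu'.aemeasurable).2 hLp)
    rw [← hprod] at g1 g2 g3
    refine ⟨(memLp_map_measure_iff (he k).aestronglyMeasurable hpair.aemeasurable).1 g1, ?_, ?_⟩
    · rw [integral_map hpair.aemeasurable ((he k).norm.pow_const 2).aestronglyMeasurable,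
        integral_map hu'.aemeasurable (Measurable.aestronglyMeasurable (by fun_prop))] at g2
      exact g2
    · have hin : Measurable fun p : E × 𝓨 => inner ℝ (e k p) (z - p.1) :=
        (he k).inner (measurable_const.sub measurable_fst)
      rwa [integral_map hpair.aemeasurable hin.aestronglyMeasurable] at g3
  exact ⟨fun k s hs hLp => ⟨(main k s hs hLp).1, (main k s hs hLp).2.1⟩,
    fun k s hs hLp => (main k s hs hLp).2.2⟩

end Noise

/-! ### Measurability and moments of the mini-batch error. -/

namespace Game

variable {N m d : ℕ} {n : Fin N → ℕ} {G : Game N m d n}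

theorem replace_self (x : Profile n) (i : Fin N) : replace x i (x i) = x := by
  simp [replace]

theorem SampleCostAssumption.hasGradientAt (hJ : G.SampleCostAssumption) (i : Fin N)
    {x : Profile n} (hx : x ∈ G.localSet) (ξ : EuclideanSpace ℝ (Fin d)) :
    HasGradientAt (fun y => G.J i (replace x i y) ξ) (G.partialGrad i x ξ) (x i) :=
  ((hJ.contDiff i x hx ξ (x i) (hx i)).differentiableAt one_ne_zero).hasGradientAt

theorem SampleCostAssumption.hasDerivAt (hJ : G.SampleCostAssumption) (i : Fin N)
    {x : Profile n} (hx : x ∈ G.localSet) (ξ : EuclideanSpace ℝ (Fin d)) (j : Fin (n i)) :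
    HasDerivAt (fun t : ℝ => G.J i (replace x i (x i + t • EuclideanSpace.single j 1)) ξ)
      (G.partialGrad i x ξ j) 0 := by
  have h1 : HasDerivAt (fun t : ℝ => x i + t • EuclideanSpace.single j (1 : ℝ))
      (EuclideanSpace.single j 1) 0 := by
    simpa using ((hasDerivAt_id (0 : ℝ)).smul_const (EuclideanSpace.single j (1 : ℝ))).const_add
      (x i)
  have h2 := (hJ.hasGradientAt i hx ξ).hasFDerivAt
  have h2' : HasFDerivAt (fun y => G.J i (replace x i y) ξ)
      (InnerProductSpace.toDual ℝ _ (G.partialGrad i x ξ))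
      (x i + (0 : ℝ) • EuclideanSpace.single j (1 : ℝ)) := by simpa using h2
  have h3 := h2'.comp_hasDerivAt 0 h1
  rw [InnerProductSpace.toDual_apply_apply, EuclideanSpace.inner_single_right] at h3
  simpa [Function.comp_def] using h3

theorem continuous_replace_add (i : Fin N) (c : EuclideanSpace ℝ (Fin (n i))) :
    Continuous fun x : Profile n => replace x i (x i + c) :=
  (PiLp.continuous_toLp 2 _).comp ((PiLp.continuous_ofLp 2 _).update i
    ((PiLp.continuous_apply 2 _ i).add continuous_const))

theorem measurableSet_localSet_prod (hc : G.ConstraintQualification) :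
    MeasurableSet (G.localSet ×ˢ (Set.univ : Set (EuclideanSpace ℝ (Fin d)))) :=
  hc.isClosed_localSet.measurableSet.prod MeasurableSet.univ

/-- The partial gradients are jointly measurable on `𝛀 × ℝ^d`. -/
theorem measurable_indicator_partialGrad (hc : G.ConstraintQualification)
    (hJ : G.SampleCostAssumption) (i : Fin N) :
    Measurable ((G.localSet ×ˢ Set.univ).indicator
      fun p : Profile n × EuclideanSpace ℝ (Fin d) => G.partialGrad i p.1 p.2) := by
  have hS := measurableSet_localSet_prod hc
  have key : ∀ j, Measurable ((G.localSet ×ˢ Set.univ).indicator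
      fun p : Profile n × EuclideanSpace ℝ (Fin d) => G.partialGrad i p.1 p.2 j) := by
    intro j
    -- Difference quotients are measurable because `J` is. On 𝛀 they converge even if the shifted
    -- point leaves Ω_i, since the sample cost is differentiable there as a function on the whole
    -- space.
    let t : ℕ → ℝ := fun k => 1 / ((k : ℝ) + 1)
    have ht0 : ∀ k, t k ≠ 0 := fun k => (Nat.one_div_pos_of_nat).ne'
    have ht : Tendsto t atTop (𝓝[≠] 0) :=
      tendsto_nhdsWithin_iff.2 ⟨tendsto_one_div_add_atTop_nhds_zero_nat,
        Eventually.of_forall ht0⟩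
    refine measurable_of_tendsto_metrizable (f := fun k => (G.localSet ×ˢ Set.univ).indicator
      fun p : Profile n × EuclideanSpace ℝ (Fin d) => (t k)⁻¹ •
        (G.J i (replace p.1 i (p.1 i + t k • EuclideanSpace.single j 1)) p.2
          - G.J i p.1 p.2)) (fun k => ?_) ?_
    · refine Measurable.indicator ?_ hS
      have h1 : Measurable fun p : Profile n × EuclideanSpace ℝ (Fin d) =>
          G.J i (replace p.1 i (p.1 i + t k • EuclideanSpace.single j 1)) p.2 :=
        (hJ.measurable i).comp
          (((continuous_replace_add i _).measurable.comp measurable_fst).prodMk measurable_snd)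
      have h2 : Measurable fun p : Profile n × EuclideanSpace ℝ (Fin d) => G.J i p.1 p.2 :=
        hJ.measurable i
      exact (h1.sub h2).const_smul ((t k)⁻¹)
    · rw [tendsto_pi_nhds]
      intro p
      by_cases hp : p ∈ G.localSet ×ˢ (Set.univ : Set (EuclideanSpace ℝ (Fin d)))
      · simp only [Set.indicator_of_mem hp]
        have h2 := (hJ.hasDerivAt i hp.1 p.2 j).tendsto_slope_zero.comp ht
        simpa [Function.comp_def, replace_self] using h2
      · simp only [Set.indicator_of_notMem hp]
        exact tendsto_const_nhds
  have h3 : ((G.localSet ×ˢ Set.univ).indicator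
      fun p : Profile n × EuclideanSpace ℝ (Fin d) => G.partialGrad i p.1 p.2)
      = fun p => WithLp.toLp 2 fun j => (G.localSet ×ˢ Set.univ).indicator
        (fun p : Profile n × EuclideanSpace ℝ (Fin d) => G.partialGrad i p.1 p.2 j) p := by
    funext p
    by_cases hp : p ∈ G.localSet ×ˢ (Set.univ : Set (EuclideanSpace ℝ (Fin d)))
    · simp only [Set.indicator_of_mem hp]
    · simp only [Set.indicator_of_notMem hp]; rfl
  rw [h3]
  exact (WithLp.measurable_toLp 2 _).comp (measurable_pi_iff.2 key)

theorem measurable_partialGrad (hc : G.ConstraintQualification)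
    (hJ : G.SampleCostAssumption) (i : Fin N) {x : Profile n} (hx : x ∈ G.localSet) :
    Measurable (G.partialGrad i x) := by
  have h := (measurable_indicator_partialGrad hc hJ i).comp (measurable_prodMk_left (x := x))
  have e : ((G.localSet ×ˢ Set.univ).indicator
      fun p : Profile n × EuclideanSpace ℝ (Fin d) => G.partialGrad i p.1 p.2) ∘ Prod.mk x
      = G.partialGrad i x := by
    funext ξ
    exact Set.indicator_of_mem (s := G.localSet ×ˢ Set.univ) ⟨hx, Set.mem_univ ξ⟩ _
  rwa [e] at h

theorem measurable_sampleGrad (hc : G.ConstraintQualification)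
    (hJ : G.SampleCostAssumption) {x : Profile n} (hx : x ∈ G.localSet) :
    Measurable (G.sampleGrad x) :=
  (WithLp.measurable_toLp 2 _).comp
    (measurable_pi_iff.2 fun i => measurable_partialGrad hc hJ i hx)

theorem memLp_sampleGrad_sub (hlaw : IsProbabilityMeasure G.law)
    (hc : G.ConstraintQualification) (hJ : G.SampleCostAssumption) (hvar : G.VarianceControl)
    {x' : Profile n} (hx' : G.IsSVISol x') :
    ∃ K : ℝ, 0 ≤ K ∧ ∀ x ∈ G.localSet,
      MemLp (fun ξ => G.sampleGrad x ξ - G.pseudograd x) 2 G.law ∧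
      ∫ ξ, ‖G.sampleGrad x ξ - G.pseudograd x‖ ^ 2 ∂G.law ≤ K * (1 + ‖x - x'‖ ^ 2) := by
  obtain ⟨p, σ₀, σ, hp, hσ₀, hσ⟩ := hvar
  refine ⟨2 * (σ x' ^ 2 + σ₀ ^ 2), by positivity, fun x hx => ?_⟩
  have hm : AEStronglyMeasurable (fun ξ => G.sampleGrad x ξ - G.pseudograd x) G.law :=
    ((measurable_sampleGrad hc hJ hx).sub_const _).aestronglyMeasurable
  have hle : eLpNorm (fun ξ => G.sampleGrad x ξ - G.pseudograd x) 2 G.law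
      ≤ ENNReal.ofReal (σ x' + σ₀ * ‖x - x'‖) :=
    (eLpNorm_le_eLpNorm_of_exponent_le (by exact_mod_cast hp) hm).trans (hσ x hx x' hx')
  have hLp : MemLp (fun ξ => G.sampleGrad x ξ - G.pseudograd x) 2 G.law :=
    ⟨hm, hle.trans_lt ENNReal.ofReal_lt_top⟩
  refine ⟨hLp, ?_⟩
  rw [hLp.eLpNorm_eq_integral_rpow_norm two_ne_zero ENNReal.ofNat_ne_top] at hle
  set I := ∫ ξ, ‖G.sampleGrad x ξ - G.pseudograd x‖ ^ 2 ∂G.law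
  have hI0 : 0 ≤ I := integral_nonneg fun _ => sq_nonneg _
  -- σ is an arbitrary real function, so σ x' + σ₀ ‖x - x'‖ may be negative. The absolute value
  -- covers this case.
  have hI : ENNReal.ofReal (√I) ≤ ENNReal.ofReal |σ x' + σ₀ * ‖x - x'‖| := by
    refine le_trans (le_of_eq ?_) (hle.trans (ENNReal.ofReal_le_ofReal (le_abs_self _)))
    simp only [ENNReal.toReal_ofNat, Real.rpow_ofNat, Real.sqrt_eq_rpow, I]
    norm_num
  rw [ENNReal.ofReal_le_ofReal_iff (abs_nonneg _)] at hI
  have h1 : I ≤ (σ x' + σ₀ * ‖x - x'‖) ^ 2 := by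
    rw [← sq_abs]
    calc I = √I ^ 2 := (Real.sq_sqrt hI0).symm
      _ ≤ _ := by gcongr
  nlinarith [sq_nonneg (σ x' - σ₀ * ‖x - x'‖), sq_nonneg (σ x'), sq_nonneg σ₀,
    mul_nonneg (sq_nonneg (σ x')) (sq_nonneg ‖x - x'‖)]

/-- The embedding of the profiles as primal blocks of states. -/
noncomputable def primalEmbedding (n : Fin N → ℕ) (m : ℕ) : Profile n →L[ℝ] State n m :=
  LinearMap.toContinuousLinearMap
    { toFun := fun x => State.mk x 0 0
      map_add' := fun _ _ => State.ext rfl (add_zero 0).symm (add_zero 0).symm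
      map_smul' := fun c _ => State.ext rfl (smul_zero c).symm (smul_zero c).symm }

theorem primalEmbedding_apply (x : Profile n) : primalEmbedding n m x = State.mk x 0 0 := rfl

theorem norm_mk_zero_sq (x : Profile n) :
    ‖(State.mk x 0 0 : State n m)‖ ^ 2 = ∑ i, ‖x i‖ ^ 2 := by
  rw [← real_inner_self_eq_norm_sq, State.inner_eq]
  simp

theorem norm_x_sub_sq_le (a b : State n m) : ‖a.x - b.x‖ ^ 2 ≤ ‖a - b‖ ^ 2 := by
  rw [← real_inner_self_eq_norm_sq (a - b), State.inner_eq, PiLp.norm_sq_eq_of_L2]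
  simp only [real_inner_self_eq_norm_sq, State.x_sub, PiLp.sub_apply]
  have h1 : 0 ≤ ∑ i, ‖(a - b).z i‖ ^ 2 := Finset.sum_nonneg fun _ _ => sq_nonneg _
  have h2 : 0 ≤ ∑ i, ‖(a - b).lam i‖ ^ 2 := Finset.sum_nonneg fun _ _ => sq_nonneg _
  linarith

/-- The mini-batch error, set to zero outside the domain of the states. -/
noncomputable def batchErrorOn (G : Game N m d n) (S : ℕ) :
    State n m × (Fin N → ℕ → EuclideanSpace ℝ (Fin d)) → State n m :=
  (G.stateDomain ×ˢ Set.univ).indicator fun p => G.batchError S p.1.x p.2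

theorem batchErrorOn_of_mem {S : ℕ} {ω : State n m} (hω : ω ∈ G.stateDomain)
    (y : Fin N → ℕ → EuclideanSpace ℝ (Fin d)) :
    G.batchErrorOn S (ω, y) = G.batchError S ω.x y :=
  Set.indicator_of_mem (s := G.stateDomain ×ˢ Set.univ) ⟨hω, Set.mem_univ y⟩ _

theorem batchErrorOn_of_notMem {S : ℕ} {ω : State n m} (hω : ω ∉ G.stateDomain)
    (y : Fin N → ℕ → EuclideanSpace ℝ (Fin d)) : G.batchErrorOn S (ω, y) = 0 :=
  Set.indicator_of_notMem (fun h => hω h.1) _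

/-- Off 𝛀 nothing is known about the gradients or 𝔽. The indicator permits replacing them by
measurable versions and a Lipschitz extension. -/
theorem measurable_batchErrorOn (hc : G.ConstraintQualification)
    (hJ : G.SampleCostAssumption) (hmono : G.MonotoneLipschitz) (S : ℕ) :
    Measurable (G.batchErrorOn S) := by
  obtain ⟨ℓ, hℓ⟩ := hmono.lipschitz
  obtain ⟨F, hF, hFeq⟩ := hℓ.extend_finite_dimension
  obtain ⟨M, hM, hMeq⟩ : ∃ M : ∀ i, Profile n × EuclideanSpace ℝ (Fin d) →
      EuclideanSpace ℝ (Fin (n i)), (∀ i, Measurable (M i)) ∧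
        ∀ i, ∀ x ∈ G.localSet, ∀ ξ, M i (x, ξ) = G.partialGrad i x ξ :=
    ⟨_, fun i => measurable_indicator_partialGrad hc hJ i, fun i x hx ξ =>
      Set.indicator_of_mem (s := G.localSet ×ˢ Set.univ) ⟨hx, Set.mem_univ ξ⟩ _⟩
  have hx : Measurable fun p : State n m × (Fin N → ℕ → EuclideanSpace ℝ (Fin d)) => p.1.x :=
    State.continuous_x.measurable.comp measurable_fst
  have hy : ∀ i t, Measurable fun p : State n m × (Fin N → ℕ → EuclideanSpace ℝ (Fin d)) =>
      p.2 i t := fun i t =>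
    (measurable_pi_apply t).comp ((measurable_pi_apply i).comp measurable_snd)
  have hsum : ∀ i, Measurable fun p : State n m × (Fin N → ℕ → EuclideanSpace ℝ (Fin d)) =>
      ∑ t ∈ Finset.range S, M i (p.1.x, p.2 i t) := fun i =>
    Finset.measurable_fun_sum _ fun t _ => (hM i).comp (hx.prodMk (hy i t))
  have hFx : ∀ i, Measurable fun p : State n m × (Fin N → ℕ → EuclideanSpace ℝ (Fin d)) =>
      F p.1.x i := fun i =>
    (PiLp.continuous_apply 2 _ i).measurable.comp (hF.continuous.measurable.comp hx)
  have hblock : ∀ i, Measurable fun p : State n m × (Fin N → ℕ → EuclideanSpace ℝ (Fin d)) =>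
      (S : ℝ)⁻¹ • ∑ t ∈ Finset.range S, M i (p.1.x, p.2 i t) - F p.1.x i := fun i =>
    ((hsum i).const_smul (S : ℝ)⁻¹).sub (hFx i)
  let g : State n m × (Fin N → ℕ → EuclideanSpace ℝ (Fin d)) → Profile n := fun p =>
    WithLp.toLp 2 fun i => (S : ℝ)⁻¹ • ∑ t ∈ Finset.range S, M i (p.1.x, p.2 i t) - F p.1.x i
  have hg : Measurable g := (WithLp.measurable_toLp 2 _).comp (measurable_pi_iff.2 hblock)
  have hg' : Measurable fun p => primalEmbedding n m (g p) :=
    (primalEmbedding n m).continuous.measurable.comp hg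
  have e1 : G.batchErrorOn S
      = (G.stateDomain ×ˢ Set.univ).indicator fun p => primalEmbedding n m (g p) := by
    refine Set.indicator_congr fun p hp => ?_
    rw [primalEmbedding_apply, batchError]
    simp only [g, batchGrad, hMeq _ _ hp.1.1, ← hFeq hp.1.1]
  rw [e1]
  exact hg'.indicator (hc.isClosed_stateDomain.measurableSet.prod MeasurableSet.univ)

section Batch

variable {Θ B : Type*} [MeasurableSpace Θ] [MeasurableSpace B] {P : Measure Θ}
  [IsProbabilityMeasure P] {ξ : ℕ → Fin N → ℕ → Θ → EuclideanSpace ℝ (Fin d)} {init : Θ → B}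

theorem memLp_partialGrad_sub {x : Profile n}
    (h : MemLp (fun ξ => G.sampleGrad x ξ - G.pseudograd x) 2 G.law) (i : Fin N) :
    MemLp (fun ξ => G.partialGrad i x ξ - G.pseudograd x i) 2 G.law := h.eval_piLp i

theorem integrable_partialGrad (hlaw : IsProbabilityMeasure G.law) {x : Profile n}
    (h : MemLp (fun ξ => G.sampleGrad x ξ - G.pseudograd x) 2 G.law) (i : Fin N) :
    Integrable (G.partialGrad i x) G.law := by
  have h1 := ((memLp_partialGrad_sub h i).integrable one_le_two).add
    (integrable_const (G.pseudograd x i))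
  refine h1.congr (Eventually.of_forall fun ξ => ?_)
  simp

theorem integral_partialGrad_sub (hlaw : IsProbabilityMeasure G.law) {x : Profile n}
    (h : MemLp (fun ξ => G.sampleGrad x ξ - G.pseudograd x) 2 G.law) (i : Fin N) :
    ∫ ξ, (G.partialGrad i x ξ - G.pseudograd x i) ∂G.law = 0 := by
  rw [integral_sub (integrable_partialGrad hlaw h i) (integrable_const _), integral_const]
  simp [pseudograd]

/-- Moments of one block of the mini-batch error. -/
theorem IsSampling.batchGrad_moments (hlaw : IsProbabilityMeasure G.law)
    (hc : G.ConstraintQualification) (hJ : G.SampleCostAssumption)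
    (hξ : G.IsSampling P ξ init) {x : Profile n} (hx : x ∈ G.localSet)
    (h : MemLp (fun ξ => G.sampleGrad x ξ - G.pseudograd x) 2 G.law) {S : ℕ} (hS : 0 < S)
    (k : ℕ) (i : Fin N) :
    MemLp (fun θ => G.batchGrad S i x (fun t => ξ k i t θ) - G.pseudograd x i) 2 P ∧
      ∫ θ, (G.batchGrad S i x (fun t => ξ k i t θ) - G.pseudograd x i) ∂P = 0 ∧
      ∫ θ, ‖G.batchGrad S i x (fun t => ξ k i t θ) - G.pseudograd x i‖ ^ 2 ∂P
        = (S : ℝ)⁻¹ * ∫ ξ, ‖G.partialGrad i x ξ - G.pseudograd x i‖ ^ 2 ∂G.law := by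
  set D : EuclideanSpace ℝ (Fin d) → EuclideanSpace ℝ (Fin (n i)) :=
    fun ξ => G.partialGrad i x ξ - G.pseudograd x i with hD
  have hDm : Measurable D := (measurable_partialGrad hc hJ i hx).sub_const _
  set Z : ℕ → Θ → EuclideanSpace ℝ (Fin (n i)) := fun t θ => D (ξ k i t θ) with hZ
  have hZLp : ∀ t, MemLp (Z t) 2 P := fun t => by
    have := memLp_partialGrad_sub h i
    rw [← hξ.law_eq k i t] at this
    exact (memLp_map_measure_iff hDm.aestronglyMeasurable
      (hξ.measurable k i t).aemeasurable).1 this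
  have hZ0 : ∀ t, ∫ θ, Z t θ ∂P = 0 := fun t => by
    rw [← integral_partialGrad_sub hlaw h i, ← hξ.law_eq k i t,
      integral_map (hξ.measurable k i t).aemeasurable hDm.aestronglyMeasurable]
  have hZ2 : ∀ t, ∫ θ, ‖Z t θ‖ ^ 2 ∂P = ∫ ξ, ‖D ξ‖ ^ 2 ∂G.law := fun t => by
    rw [← hξ.law_eq k i t, integral_map (hξ.measurable k i t).aemeasurable
      (hDm.norm.pow_const 2).aestronglyMeasurable]
  have hZind : Pairwise fun t t' => IndepFun (Z t) (Z t') P := fun t t' htt' =>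
    (hξ.indep.indepFun (i := (k, i, t)) (j := (k, i, t')) (by simpa using htt')).comp hDm hDm
  have hS' : (S : ℝ) ≠ 0 := by exact_mod_cast hS.ne'
  have hbatch : ∀ θ, G.batchGrad S i x (fun t => ξ k i t θ) - G.pseudograd x i
      = (S : ℝ)⁻¹ • ∑ t ∈ Finset.range S, Z t θ := fun θ => by
    simp only [batchGrad, hZ, hD, Finset.sum_sub_distrib, Finset.sum_const, Finset.card_range]
    rw [← Nat.cast_smul_eq_nsmul ℝ, smul_sub, smul_smul, inv_mul_cancel₀ hS', one_smul]
  have hsum : MemLp (fun θ => ∑ t ∈ Finset.range S, Z t θ) 2 P :=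
    memLp_finsetSum _ fun t _ => hZLp t
  simp only [hbatch]
  refine ⟨hsum.const_smul ((S : ℝ)⁻¹), ?_, ?_⟩
  · rw [integral_smul, integral_finsetSum _ fun t _ => (hZLp t).integrable one_le_two,
      Finset.sum_eq_zero fun t _ => hZ0 t, smul_zero]
  · simp only [norm_smul, mul_pow]
    rw [integral_const_mul, integral_norm_sq_sum _ hZLp hZ0 hZind, Finset.sum_congr rfl
      fun t _ => hZ2 t, Finset.sum_const, Finset.card_range, nsmul_eq_mul, norm_inv,
      Real.norm_natCast]
    field_simp
    rfl

/-- Moments of the mini-batch error at a fixed state. -/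
theorem IsSampling.batchErrorOn_moments (hlaw : IsProbabilityMeasure G.law)
    (hc : G.ConstraintQualification) (hJ : G.SampleCostAssumption)
    (hξ : G.IsSampling P ξ init) {K : ℝ} (hK : 0 ≤ K) {z : State n m}
    (h : ∀ x ∈ G.localSet, MemLp (fun ξ => G.sampleGrad x ξ - G.pseudograd x) 2 G.law ∧
      ∫ ξ, ‖G.sampleGrad x ξ - G.pseudograd x‖ ^ 2 ∂G.law ≤ K * (1 + ‖x - z.x‖ ^ 2))
    {S : ℕ} (hS : 0 < S) (k : ℕ) (ω : State n m) :
    MemLp (fun θ => G.batchErrorOn S (ω, fun i t => ξ k i t θ)) 2 P ∧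
      ∫ θ, ‖G.batchErrorOn S (ω, fun i t => ξ k i t θ)‖ ^ 2 ∂P
        ≤ (S : ℝ)⁻¹ * K * (1 + ‖ω - z‖ ^ 2) ∧
      ∫ θ, G.batchErrorOn S (ω, fun i t => ξ k i t θ) ∂P = 0 := by
  by_cases hω : ω ∈ G.stateDomain
  · obtain ⟨hLp, hle⟩ := h ω.x hω.1
    have hb := hξ.batchGrad_moments hlaw hc hJ hω.1 hLp hS k
    simp only [batchErrorOn_of_mem hω, batchError]
    set a : Θ → Profile n := fun θ => WithLp.toLp 2 fun i =>
      G.batchGrad S i ω.x (fun t => ξ k i t θ) - G.pseudograd ω.x i with ha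
    have haLp : MemLp a 2 P := MemLp.of_eval_piLp fun i => (hb i).1
    refine ⟨memLp_two_map haLp (primalEmbedding n m), ?_, ?_⟩
    · have e1 : ∀ θ, ‖(State.mk (a θ) 0 0 : State n m)‖ ^ 2 = ∑ i, ‖a θ i‖ ^ 2 := fun θ =>
        norm_mk_zero_sq _
      have e2 : ∫ ξ, ‖G.sampleGrad ω.x ξ - G.pseudograd ω.x‖ ^ 2 ∂G.law
          = ∑ i, ∫ ξ, ‖G.partialGrad i ω.x ξ - G.pseudograd ω.x i‖ ^ 2 ∂G.law := by
        rw [← integral_finsetSum _ fun i _ => integrable_norm_sq (memLp_partialGrad_sub hLp i)]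
        exact integral_congr_ae (Eventually.of_forall fun ξ => PiLp.norm_sq_eq_of_L2 _ _)
      rw [integral_congr_ae (Eventually.of_forall e1),
        integral_finsetSum _ fun i _ => integrable_norm_sq (hb i).1,
        Finset.sum_congr rfl fun i _ => (hb i).2.2, ← Finset.mul_sum, ← e2, mul_assoc]
      gcongr
      refine hle.trans ?_
      gcongr
      exact (sq_le_sq₀ (norm_nonneg _) (norm_nonneg _)).1 (norm_x_sub_sq_le ω z)
    · have e1 : ∫ θ, a θ ∂P = 0 := by
        ext1 i
        rw [eval_integral_piLp fun i => (hb i).1.integrable one_le_two]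
        exact (hb i).2.1
      have e2 := (primalEmbedding n m).integral_comp_comm (haLp.integrable one_le_two)
      rw [e1, map_zero] at e2
      exact e2
  -- `isNoise_of_indep` asks for the moments at every state. Off the domain the error is zero.
  · simp only [batchErrorOn_of_notMem hω]
    refine ⟨MemLp.zero', ?_, by simp⟩
    simp only [norm_zero, integral_const, smul_eq_mul]
    rw [zero_pow two_ne_zero, mul_zero]
    positivity

end Batch

/-- The σ-algebra of one sample. -/
abbrev sampleAlgebra {Θ : Type*} (ξ : ℕ → Fin N → ℕ → Θ → EuclideanSpace ℝ (Fin d))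
    (q : ℕ × Fin N × ℕ) : MeasurableSpace Θ :=
  MeasurableSpace.comap (ξ q.1 q.2.1 q.2.2) inferInstance

theorem comap_batch_le {Θ : Type*} {ξ : ℕ → Fin N → ℕ → Θ → EuclideanSpace ℝ (Fin d)}
    {m' : MeasurableSpace Θ} {k : ℕ}
    (h : ∀ i t, sampleAlgebra ξ (k, i, t) ≤ m') :
    MeasurableSpace.comap (fun θ i t => ξ k i t θ) inferInstance ≤ m' := by
  have h1 : ∀ i t, @Measurable _ _ m' _ (ξ k i t) := fun i t =>
    (comap_measurable (ξ k i t)).mono (h i t) le_rfl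
  exact (@measurable_pi_iff _ _ _ m' _ _).2 (fun i =>
    (@measurable_pi_iff _ _ _ m' _ _).2 (h1 i)) |>.comap_le

/-! ### The filtration of past samples. -/

section History

variable {Θ B : Type*} [m0 : MeasurableSpace Θ] [MeasurableSpace B] {P : Measure Θ}
  {ξ : ℕ → Fin N → ℕ → Θ → EuclideanSpace ℝ (Fin d)} {init : Θ → B}

theorem IsSampling.sampleAlgebra_le (hξ : G.IsSampling P ξ init) (q : ℕ × Fin N × ℕ) :
    sampleAlgebra ξ q ≤ m0 :=
  (hξ.measurable q.1 q.2.1 q.2.2).comap_le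

/-- The σ-algebras of the initial data and the samples of the previous iterations. -/
def IsSampling.history (hξ : G.IsSampling P ξ init) : Filtration ℕ m0 where
  seq k := MeasurableSpace.comap init inferInstance ⊔
    ⨆ q ∈ {q : ℕ × Fin N × ℕ | q.1 < k}, sampleAlgebra ξ q
  mono' _ _ hij := sup_le_sup_left (biSup_mono fun _ hq => lt_of_lt_of_le hq hij) _
  le' _ := sup_le hξ.measurable_init.comap_le (iSup₂_le fun q _ => hξ.sampleAlgebra_le q)

theorem IsSampling.measurable_init_history (hξ : G.IsSampling P ξ init) :
    Measurable[hξ.history 0] init :=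
  (comap_measurable init).mono le_sup_left le_rfl

theorem IsSampling.measurable_history_succ (hξ : G.IsSampling P ξ init) (k : ℕ) :
    Measurable[hξ.history (k + 1)] fun θ i t => ξ k i t θ :=
  Measurable.of_comap_le (comap_batch_le fun i t => le_sup_of_le_right
    (le_biSup (sampleAlgebra ξ) (i := (k, i, t)) (s := {q : ℕ × Fin N × ℕ | q.1 < k + 1})
      (Nat.lt_succ_self k)))

/-- The history uses samples of iterations below `k`, the new batch only those of iteration `k`:
disjoint index sets. -/
theorem IsSampling.indep_history [IsProbabilityMeasure P] (hξ : G.IsSampling P ξ init) (k : ℕ) :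
    Indep (hξ.history k)
      (MeasurableSpace.comap (fun θ i t => ξ k i t θ) inferInstance) P := by
  set c : ℕ × Fin N × ℕ → MeasurableSpace Θ := sampleAlgebra ξ with hcdef
  have hcle : ∀ q, c q ≤ m0 := hξ.sampleAlgebra_le
  have hnew : MeasurableSpace.comap (fun θ i t => ξ k i t θ) inferInstance
      ≤ ⨆ q ∈ {q : ℕ × Fin N × ℕ | q.1 = k}, c q :=
    comap_batch_le fun i t => le_biSup c (i := (k, i, t))
      (s := {q : ℕ × Fin N × ℕ | q.1 = k}) rfl
  have h23 : Indep (⨆ q ∈ {q : ℕ × Fin N × ℕ | q.1 < k}, c q)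
      (⨆ q ∈ {q : ℕ × Fin N × ℕ | q.1 = k}, c q) P :=
    indep_iSup_of_disjoint hcle hξ.indep
      (Set.disjoint_left.2 fun q hq hq' => (ne_of_lt hq) hq')
  have hall : ∀ T : Set (ℕ × Fin N × ℕ), ⨆ q ∈ T, c q
      ≤ MeasurableSpace.comap (fun θ (q : ℕ × Fin N × ℕ) => ξ q.1 q.2.1 q.2.2 θ)
        inferInstance := fun T => by
    refine iSup₂_le fun q _ => ?_
    have h1 : (ξ q.1 q.2.1 q.2.2) = (fun f : ℕ × Fin N × ℕ → EuclideanSpace ℝ (Fin d) => f q) ∘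
        (fun θ (q : ℕ × Fin N × ℕ) => ξ q.1 q.2.1 q.2.2 θ) := rfl
    rw [hcdef, sampleAlgebra, h1, ← MeasurableSpace.comap_comp]
    exact MeasurableSpace.comap_mono (measurable_pi_apply q).comap_le
  have h1 : Indep (MeasurableSpace.comap init inferInstance)
      ((⨆ q ∈ {q : ℕ × Fin N × ℕ | q.1 < k}, c q) ⊔
        ⨆ q ∈ {q : ℕ × Fin N × ℕ | q.1 = k}, c q) P :=
    indep_of_indep_of_le_right hξ.indep_init (sup_le (hall _) (hall _))
  exact indep_of_indep_of_le_right
    (indep_sup_left_of_indep hξ.measurable_init.comap_le (iSup₂_le fun q _ => hcle q)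
      (iSup₂_le fun q _ => hcle q) h1 h23) hnew

end History

end Game

theorem IncreasingBatch.pos {S : ℕ → ℕ} (hS : IncreasingBatch S) (k : ℕ) : 0 < S k := by
  obtain ⟨c, k₀, a, hc, hk₀, -, h⟩ := hS
  have h1 : 0 < c * ((k : ℝ) + k₀) ^ (a + 1) := by positivity
  exact_mod_cast h1.trans_le (h k)

theorem IncreasingBatch.summable_inv {S : ℕ → ℕ} (hS : IncreasingBatch S) :
    Summable fun k => (S k : ℝ)⁻¹ := by
  obtain ⟨c, k₀, a, hc, hk₀, ha, h⟩ := hS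
  have h1 : Summable fun k : ℕ => c⁻¹ * (1 / |(k : ℝ) + k₀| ^ (a + 1)) :=
    ((Real.summable_one_div_nat_add_rpow k₀ (a + 1)).2 (by linarith)).mul_left _
  refine Summable.of_nonneg_of_le (fun k => by positivity) (fun k => ?_) h1
  have hk : 0 < (k : ℝ) + k₀ := by positivity
  rw [abs_of_pos hk, one_div, ← mul_inv]
  exact inv_anti₀ (by positivity) (h k)

/-! ### From the SVI to equilibria, and from the algorithm to an adapted run. -/

namespace Game

variable {N m d : ℕ} {n : Fin N → ℕ} {G : Game N m d n}

/-- Solutions of the stochastic variational inequality are equilibria. -/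
theorem IsSVISol.isVSGNE (hlaw : IsProbabilityMeasure G.law)
    (hc : G.ConstraintQualification) (hf : G.NonsmoothCostAssumption)
    (hJ : G.SampleCostAssumption) (hvar : G.VarianceControl) {x : Profile n}
    (hx : G.IsSVISol x) : G.IsVSGNE x := by
  refine ⟨⟨hx.1, fun i y hy => ?_⟩, hx⟩
  -- Variance control makes the partial gradient integrable: it differs from the constant 𝔽(x) by an
  -- L² function.
  obtain ⟨K, -, hK⟩ := memLp_sampleGrad_sub hlaw hc hJ hvar hx
  have hxΩ := hx.1.1
  have hint := integrable_partialGrad hlaw (hK x hxΩ).1 i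
  have hri : replace x i y i = y := by simp [replace]
  have hrj : ∀ j, j ≠ i → replace x i y j = x j := fun j hj => by simp [replace, hj]
  have hyΩ : y ∈ G.Ω i := by
    have := hy.1 i
    rwa [hri] at this
  -- The gradient inequality is integrated sample by sample, which avoids differentiating under the
  -- expectation.
  have hconv : ∀ ξ, G.J i x ξ + inner ℝ (G.partialGrad i x ξ) (y - x i)
      ≤ G.J i (replace x i y) ξ := fun ξ => by
    have h1 := add_fderiv_le_of_convexOn (hJ.convex i x hxΩ ξ) (hxΩ i) hyΩ
      (hJ.hasGradientAt i hxΩ ξ).hasFDerivAt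
    rwa [replace_self, InnerProductSpace.toDual_apply_apply] at h1
  have hJx := hJ.integrable i x hx.1
  have hJy := hJ.integrable i _ hy
  have h2 : ∫ ξ, G.J i x ξ ∂G.law + inner ℝ (G.pseudograd x i) (y - x i)
      ≤ ∫ ξ, G.J i (replace x i y) ξ ∂G.law := by
    have e1 : ∫ ξ, inner ℝ (G.partialGrad i x ξ) (y - x i) ∂G.law
        = inner ℝ (G.pseudograd x i) (y - x i) := by
      have e0 : G.pseudograd x i = ∫ ξ, G.partialGrad i x ξ ∂G.law := rfl
      rw [e0, real_inner_comm, ← integral_inner hint]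
      exact integral_congr_ae (Eventually.of_forall fun ξ => real_inner_comm _ _)
    rw [← e1, ← integral_add hJx (hint.inner_const _)]
    exact integral_mono (hJx.add (hint.inner_const _)) hJy hconv
  -- For a unilateral deviation only the i-th block of the SVI survives.
  have h3 := hx.2 _ hy
  have h4 : inner ℝ (G.pseudograd x) (replace x i y - x)
      = inner ℝ (G.pseudograd x i) (y - x i) := by
    rw [PiLp.inner_apply, Finset.sum_eq_single i (fun j _ hj => by
      rw [PiLp.sub_apply, hrj j hj, sub_self, inner_zero_right]) (by simp)]
    rw [PiLp.sub_apply, hri]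
  have h5 : ∑ j, ((G.f j (replace x i y j)).toReal - (G.f j (x j)).toReal)
      = (G.f i y).toReal - (G.f i (x i)).toReal := by
    rw [Finset.sum_eq_single i (fun j _ hj => by rw [hrj j hj, sub_self]) (by simp), hri]
  rw [h4, h5] at h3
  unfold cost
  rw [hri, ← hf.coe_toReal (hxΩ i), ← hf.coe_toReal hyΩ, ← EReal.coe_add, ← EReal.coe_add]
  exact EReal.coe_le_coe_iff.2 (by linarith)

section Run

variable {Θ : Type*} [MeasurableSpace Θ] {P : Measure Θ}
  {ξ : ℕ → Fin N → ℕ → Θ → EuclideanSpace ℝ (Fin d)} {ω ωbar : ℕ → Θ → State n m}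

/-- The algorithm is an adapted run of the golden ratio iteration. -/
theorem isRun (hc : G.ConstraintQualification) (hf : G.NonsmoothCostAssumption)
    (hJ : G.SampleCostAssumption) (hmono : G.MonotoneLipschitz)
    {W : Fin N → Fin N → ℝ} {δ η : ℝ} {ℓ : ℝ≥0} {st : Steps N} (hst : st.Positive)
    (H : StepCondition (st.invSqrt.phiInv n m) G.stateDomain (G.extOp W) δ η ℓ) {S : ℕ → ℕ}
    (hξ : G.IsSampling P ξ (fun θ => (ω 0 θ, ωbar 0 θ)))
    (hrun : ∀ θ, G.IsSRFB W st δ S (fun k i t => ξ k i t θ)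
      (fun k => ω k θ) (fun k => ωbar k θ)) :
    IsRun (st.invSqrt.phiInv n m) G.stateDomain (G.extOp W) G.nonsmooth δ hξ.history ω
      (fun k => ωbar (k + 1))
      (fun k θ => G.batchErrorOn (S k) (ω k θ, fun i t => ξ k i t θ)) := by
  have hmem : ∀ k θ, ω k θ ∈ G.stateDomain := fun k θ => (hrun θ).mem_stateDomain hc hf hst k
  have hstep : ∀ k θ, IsResolvent (st.invSqrt.phiInv n m) G.stateDomain G.nonsmooth
      (ωbar (k + 1) θ) (G.extOp W (ω k θ)
        + G.batchErrorOn (S k) (ω k θ, fun i t => ξ k i t θ)) (ω (k + 1) θ) := fun k θ => by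
    rw [batchErrorOn_of_mem (hmem k θ)]
    exact (hrun θ).isResolvent hc hf hst k
  have hle : ∀ k, hξ.history k ≤ hξ.history (k + 1) := fun k => hξ.history.mono (Nat.le_succ k)
  have herr : ∀ k, Measurable[hξ.history k] (ω k) → Measurable[hξ.history (k + 1)]
      (fun θ => G.batchErrorOn (S k) (ω k θ, fun i t => ξ k i t θ)) := fun k hk =>
    (measurable_batchErrorOn hc hJ hmono (S k)).comp
      ((hk.mono (hle k) le_rfl).prodMk (hξ.measurable_history_succ k))
  -- `extOp` is regular on the state domain only. Its Lipschitz extension is measurable and agrees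
  -- with it along the run.
  obtain ⟨A, hA, hAeq⟩ := H.lip.extend_finite_dimension
  have hbar : ∀ k, ωbar (k + 1) = fun θ => (1 - δ) • ω k θ + δ • ωbar k θ := fun k =>
    funext fun θ => (hrun θ).average k
  have hsmul : ∀ c : ℝ, Measurable fun a : State n m => c • a := fun c =>
    (continuous_const_smul c).measurable
  have hmeas : ∀ k, Measurable[hξ.history k] (ω k) ∧ Measurable[hξ.history k] (ωbar (k + 1)) := by
    intro k
    induction k with
    | zero =>
      have h0 := hξ.measurable_init_history
      have h1 : Measurable[hξ.history 0] (ω 0) := measurable_fst.comp h0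
      have h2 : Measurable[hξ.history 0] (ωbar 0) := measurable_snd.comp h0
      refine ⟨h1, ?_⟩
      rw [hbar]
      exact ((hsmul (1 - δ)).comp h1).add ((hsmul δ).comp h2)
    | succ k ih =>
      have h1 : Measurable[hξ.history (k + 1)] (ω k) := ih.1.mono (hle k) le_rfl
      have h2 : Measurable[hξ.history (k + 1)] (ωbar (k + 1)) := ih.2.mono (hle k) le_rfl
      have h3 : Measurable[hξ.history (k + 1)] fun θ => G.extOp W (ω k θ)
          + G.batchErrorOn (S k) (ω k θ, fun i t => ξ k i t θ) := by
        have h4 : Measurable[hξ.history (k + 1)] fun θ => A (ω k θ) :=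
          hA.continuous.measurable.comp h1
        have h5 : (fun θ => G.extOp W (ω k θ)) = fun θ => A (ω k θ) :=
          funext fun θ => hAeq (hmem k θ)
        rw [← h5] at h4
        exact h4.add (herr k ih.1)
      have h6 : Measurable[hξ.history (k + 1)] (ω (k + 1)) :=
        @StepCondition.measurable_resolvent _ _ _ _ _ _ _ _ _ _ _ _ _ H _
          (hξ.history (k + 1)) _ _ _ h2 h3 (hstep k)
      refine ⟨h6, ?_⟩
      rw [hbar (k + 1)]
      exact ((hsmul (1 - δ)).comp h6).add ((hsmul δ).comp h2)
  exact ⟨hmem, fun k θ => (hrun θ).average (k + 1), hstep, fun k => (hmeas k).1,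
    fun k => (hmeas k).2, fun k => herr k (hmeas k).1⟩

end Run

end Game

end SGNE

theorem theorem1 {N m d : ℕ} {n : Fin N → ℕ} (G : SGNE.Game N m d n)
    (hlaw : IsProbabilityMeasure G.law)
    -- the game
    (hconstr : G.ConstraintQualification)
    (hcoupling : G.CouplingAssumption)
    (hf : G.NonsmoothCostAssumption)
    (hJ : G.SampleCostAssumption)
    (hsol : ∃ x, G.IsSVISol x)
    (hmono : G.MonotoneLipschitz)
    (hvar : G.VarianceControl)
    -- the multiplier graph
    (A : SimpleGraph (Fin N)) (hA : A.Connected)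
    (W : Fin N → Fin N → ℝ) (hW : SGNE.IsWeightMatrix A W)
    -- the parameters
    (δ : ℝ) (hδ : 1 / Real.goldenRatio ≤ δ) (hδ1 : δ < 1)
    (st : SGNE.Steps N) (hst : st.Positive) (hbound : G.StepSizeBound W st δ)
    (S : ℕ → ℕ) (hS : SGNE.IncreasingBatch S)
    -- the samples and the iterates
    {Θ : Type*} [MeasurableSpace Θ] (P : Measure Θ) [IsProbabilityMeasure P]
    (ξ : ℕ → Fin N → ℕ → Θ → EuclideanSpace ℝ (Fin d))
    (ω ωbar : ℕ → Θ → SGNE.State n m)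
    (hξ : G.IsSampling P ξ (fun θ => (ω 0 θ, ωbar 0 θ)))
    (hrun : ∀ θ, G.IsSRFB W st δ S (fun k i t => ξ k i t θ)
      (fun k => ω k θ) (fun k => ωbar k θ)) :
    ∀ᵐ θ ∂P, ∃ x, G.IsVSGNE x ∧ Tendsto (fun k => (ω k θ).x) atTop (𝓝 x) := by
  obtain ⟨ℓ, H⟩ := SGNE.Game.stepCondition hcoupling hmono hW hδ hδ1 hst hbound
  obtain ⟨x₀, hx₀⟩ := hsol
  have hY : ∀ k, Measurable fun θ i t => ξ k i t θ := fun k =>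
    measurable_pi_iff.2 fun i => measurable_pi_iff.2 fun t => hξ.measurable k i t
  have hr := SGNE.Game.isRun hconstr hf hJ hmono hst H hξ hrun
  have hconv := hr.ae_exists_tendsto (μ := P) H hconstr.isClosed_stateDomain
    hf.lowerSemicontinuousOn_nonsmooth
    (SGNE.Game.nonempty_viSol_of_isSVISol hconstr hcoupling hf hA hW hx₀) fun z hz => by
      have hzx := SGNE.Game.isSVISol_of_mem_viSol hcoupling hA hW hz
      obtain ⟨K, hK0, hK⟩ := SGNE.Game.memLp_sampleGrad_sub hlaw hconstr hJ hvar hzx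
      have hmom := fun k => hξ.batchErrorOn_moments hlaw hconstr hJ hK0 hK (hS.pos k) k
      -- Averaging S_k independent samples divides the variance by S_k, and `K` is the variance
      -- constant centered at the SVI solution `z.x`.
      exact ⟨fun k => (S k : ℝ)⁻¹ * K, fun k => by positivity, hS.summable_inv.mul_right K,
        SGNE.isNoise_of_indep (e := fun k => G.batchErrorOn (S k))
          (fun k => SGNE.Game.measurable_batchErrorOn hconstr hJ hmono (S k))
          hr.measurable_u hY hξ.indep_history (fun k x => (hmom k x).1)
          (fun k x => (hmom k x).2.1) (fun k x => (hmom k x).2.2)⟩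
  filter_upwards [hconv] with θ hθ
  obtain ⟨z, hz, hlim⟩ := hθ
  exact ⟨z.x, (SGNE.Game.isSVISol_of_mem_viSol hcoupling hA hW hz).isVSGNE hlaw hconstr hf hJ hvar,
    (SGNE.State.continuous_x.tendsto z).comp hlim⟩
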